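/- **Notation.** Let $\mathbb{R}_+=(0,\infty)$ and $\langle f,g\rangle_+=\int_0^\infty f(x)g(x)\,dx$. Let $\mathbf H_+$ be the space of real-valued $q\in L^2(\mathbb{R}_+)$ with $q',\,xq\in L^2(\mathbb{R}_+)$, with the norm $\|q\|^2=\int_0^\infty (|q|^2+|q'|^2+|xq|^2)\,dx$; such a $q$ is identified with its continuous representative on $[0,\infty)$, so that $q(0)$ makes sense. For $r\ge 0$ let $\ell^2_r$ be the space of real sequences $c=\{c_n\}_{n\ge0}$ with $\|c\|_{\ell^2_r}^2=\sum_{n\ge0}(1+n)^{2r}c_n^2<\infty$. Let $\mathcal H$ be the space of real sequences $h=\{h_n\}_{n\ge0}$ for which there is $f(z)=\sum_{n\ge0} f_nz^n$ with $\{f_n\}\in\ell^2_{3/4}$ and $$\sum_{n\ge0}h_nz^n=\frac{f(z)}{\sqrt{1-z}},\quad |z|<1,\qquad \|h\|_{\mathcal H}=\|\{f_n\}\|_{\ell^2_{3/4}} .$$ All square roots of complex numbers are principal. Let $\psi_n^0(x)=(2^n n!\sqrt\pi)^{-1/2}H_n(x)e^{-x^2/2}$ be the normalized Hermite functions, and let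 $\chi_n^0$ be the second solution of $-\psi''+x^2\psi=(2n+1)\psi$ that is uniquely determined by $\chi_n^0(\psi_n^0)'-(\chi_n^0)'\psi_n^0=1$ and $\psi_n^0\chi_n^0$ being odd. Explicitly, $\chi_n^0(x)=(n!\sqrt\pi/2)^{1/2}$ times $(-1)^{n/2}\operatorname{Im}D_{-n-1}(i\sqrt2x)$ for even $n$, and times $(-1)^{(n-1)/2}\operatorname{Re}D_{-n-1}(i\sqrt2x)$ for odd $n$, where $D_{-n-1}(w)=\frac{e^{-w^2/4}}{n!}\int_0^\infty t^ne^{-wt-t^2/2}\,dt$ is the Weber function. For $q\in\mathbf H_+$ and $n\ge0$ put $$\hat q_n=\langle q,(\psi_n^0)^2\rangle_+,\qquad \check q_n=\langle q,\psi_n^0\chi_n^0\rangle_+ .$$ With $\tilde\psi_n^0(x)=2^{1/4}\psi_n^0(\sqrt2x)$ and $E_k=\frac{(2k)!}{2^{2k}(k!)^2}$ put, for $|z|\le1$, $$(Fq)(z)=\frac1{(2\pi)^{1/4}}\sum_{k\ge0}\sqrt{E_k}\,\langle q,\tilde\psi_{2k}^0\rangle_+z^k,\qquad (G_Dq)(z^2)=\frac1{2z}\Bigl((Fq)(-z)\sqrt{1+z}-(Fq)(z)\sqrt{1-z}\Bigr)$$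 (extended by continuity to $z=0$), and define real numbers $\tilde q_n$, $n\ge0$, by $$\sum_{n\ge0}\tilde q_nz^n=\frac\pi2\cdot\frac1{2\pi i}\oint_{|\zeta|=1}\frac{(G_Dq)(\zeta)-(G_Dq)(1)}{\sqrt{-\zeta}}\,\frac{d\zeta}{\zeta-z},\qquad |z|<1. \tag{1}$$ **Theorem 3.7.** (i) For each $q\in\mathbf H_+$, the numbers $\tilde q_n$ are well defined by (1), i.e. the right-hand side of (1) is the sum of a power series with real coefficients in $|z|<1$, and for all $n\ge0$ $$\check q_{2n+1}=\frac{q(0)}{4(2n+1)}+\tilde q_n+\sum_{m\ge0}\frac{\hat q_{2m+1}}{2(n-m)+1},$$ where the series converges absolutely. (ii) The mapping $$q\mapsto\bigl(\{\hat q_{2n+1}\}_{n=0}^\infty,\;q(0),\;\{\tilde q_n\}_{n=0}^\infty\bigr)$$ is a linear isomorphism (a linear bijection, bounded together with its inverse) from $\mathbf H_+$ onto $\mathcal H\times\mathbb{R}\times\ell^2_{3/4}$. -/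

import Mathlib

open MeasureTheory Set
open scoped Nat

namespace HalfLineOscillator

/-! ### The space of potentials `H₊` -/

/-- Lebesgue measure on the half-line `ℝ₊ = (0, ∞)`. -/
noncomputable def halfLine : Measure ℝ := volume.restrict (Ioi 0)

theorem ae_differentiableAt_halfLine {f : ℝ → ℝ}
    (hf : ∀ R, 0 ≤ R → AbsolutelyContinuousOnInterval f 0 R) :
    ∀ᵐ x ∂halfLine, DifferentiableAt ℝ f x := by
  have h : ∀ᵐ x : ℝ, ∀ n : ℕ, x ∈ uIcc (0 : ℝ) n → DifferentiableAt ℝ f x :=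
    ae_all_iff.2 fun n => (hf n n.cast_nonneg).ae_differentiableAt
  rw [halfLine, ae_restrict_iff' measurableSet_Ioi]
  filter_upwards [h] with x hx hx0
  obtain ⟨n, hn⟩ := exists_nat_ge x
  refine hx n ?_
  rw [uIcc_of_le n.cast_nonneg]
  exact ⟨le_of_lt hx0, hn⟩

/-- The potentials `q ∈ L²(ℝ₊)` with `q', x q ∈ L²(ℝ₊)`, realised as their continuous
representatives on `[0, ∞)`: functions that are absolutely continuous on every `[0, R]`, whose a.e.
derivative is square integrable. (`IciExtend q` is the function `[0, ∞) → ℝ` seen as a function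
on `ℝ`, constant on `(-∞, 0]`; only its restriction to `[0, ∞)` matters.) -/
noncomputable def hPlusSubmodule : Submodule ℝ (Ici (0 : ℝ) → ℝ) where
  carrier := {q |
    (∀ R, 0 ≤ R → AbsolutelyContinuousOnInterval (IciExtend q) 0 R) ∧
    MemLp (IciExtend q) 2 halfLine ∧
    MemLp (deriv (IciExtend q)) 2 halfLine ∧
    MemLp (fun x => x * IciExtend q x) 2 halfLine}
  zero_mem' := by
    have h0 : IciExtend (0 : Ici (0 : ℝ) → ℝ) = fun _ => 0 := rfl
    have h1 : deriv (fun _ : ℝ => (0 : ℝ)) = fun _ => 0 := by simp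
    refine ⟨fun R _ => ?_, ?_, ?_, ?_⟩
    · rw [h0]
      exact (LipschitzWith.const (0 : ℝ)).lipschitzOnWith.absolutelyContinuousOnInterval (K := 0)
    · rw [h0]; exact MemLp.zero
    · rw [h0, h1]; exact MemLp.zero
    · simp only [h0, mul_zero]; exact MemLp.zero
  add_mem' := by
    rintro q p ⟨q1, q2, q3, q4⟩ ⟨p1, p2, p3, p4⟩
    have h0 : IciExtend (q + p) = IciExtend q + IciExtend p := rfl
    refine ⟨fun R hR => ?_, ?_, ?_, ?_⟩
    · rw [h0]; exact (q1 R hR).add (p1 R hR)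
    · rw [h0]; exact q2.add p2
    · refine (q3.add p3).ae_eq ?_
      filter_upwards [ae_differentiableAt_halfLine q1, ae_differentiableAt_halfLine p1] with x hq hp
      rw [h0, deriv_add hq hp, Pi.add_apply]
    · refine (q4.add p4).ae_eq (Filter.Eventually.of_forall fun x => ?_)
      simp [h0, mul_add]
  smul_mem' := by
    rintro c q ⟨q1, q2, q3, q4⟩
    have h0 : IciExtend (c • q) = fun x => c * IciExtend q x := rfl
    refine ⟨fun R hR => ?_, ?_, ?_, ?_⟩
    · rw [h0]; exact (q1 R hR).const_mul c
    · rw [h0]; exact q2.const_mul c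
    · refine (q3.const_mul c).ae_eq (Filter.Eventually.of_forall fun x => ?_)
      simp only [h0, deriv_const_mul_field]
    · refine (q4.const_mul c).ae_eq (Filter.Eventually.of_forall fun x => ?_)
      simp only [h0]; ring

/-- The real vector space `H₊`. -/
def HPlus : Type := hPlusSubmodule

noncomputable instance : AddCommGroup HPlus := inferInstanceAs (AddCommGroup hPlusSubmodule)
noncomputable instance : Module ℝ HPlus := inferInstanceAs (Module ℝ hPlusSubmodule)

/-- Values `q x`, `x ≥ 0`, of a potential. -/
noncomputable instance : CoeFun HPlus (fun _ => ℝ → ℝ) := ⟨fun q => IciExtend q.1⟩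

theorem HPlus.integrable_inner (q p : HPlus) : Integrable
    (fun x => q x * p x + deriv q x * deriv p x + (x * q x) * (x * p x)) halfLine :=
  ((q.2.2.1.integrable_mul p.2.2.1).add (q.2.2.2.1.integrable_mul p.2.2.2.1)).add
    (q.2.2.2.2.integrable_mul p.2.2.2.2)

/-- The inner product `⟨q, p⟩ + ⟨q', p'⟩ + ⟨x q, x p⟩` (in `L²(ℝ₊)`) on `H₊`. -/
@[reducible] noncomputable def hPlusCore : InnerProductSpace.Core ℝ HPlus where
  inner q p := ∫ x, (q x * p x + deriv q x * deriv p x + (x * q x) * (x * p x)) ∂halfLine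
  conj_inner_symm q p := by
    refine integral_congr_ae (Filter.Eventually.of_forall fun x => ?_)
    simp only
    ring
  re_inner_nonneg q := by
    refine integral_nonneg fun x => ?_
    simp only [Pi.zero_apply, ← pow_two]
    positivity
  definite q h := by
    have h1 := (integral_eq_zero_iff_of_nonneg (fun x => ?_) (q.integrable_inner q)).1 h
    swap
    · simp only [Pi.zero_apply, ← pow_two]
      positivity
    have h2 : ∀ᵐ x ∂halfLine, q x = 0 := by
      filter_upwards [h1] with x hx
      simp only [Pi.zero_apply, ← pow_two] at hx
      have := sq_nonneg (q x)
      have := sq_nonneg (deriv q x)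
      have := sq_nonneg (x * q x)
      exact pow_eq_zero_iff two_ne_zero |>.1 (by linarith)
    have hc : ContinuousOn (fun x => q x) (Ici 0) := by
      intro x hx
      have h3 := (q.2.1 (x + 1) (by linarith [mem_Ici.1 hx])).continuousOn x
        (by rw [uIcc_of_le (by linarith [mem_Ici.1 hx])]; exact ⟨hx, by linarith⟩)
      refine h3.mono_of_mem_nhdsWithin ?_
      rw [uIcc_of_le (by linarith [mem_Ici.1 hx])]
      exact Filter.mem_of_superset
        (inter_mem_nhdsWithin _ (Iio_mem_nhds (show x < x + 1 by linarith)))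
        fun y hy => ⟨hy.1, le_of_lt hy.2⟩
    have h4 : EqOn (fun x => q x) (fun _ => 0) (Ioi 0) :=
      Measure.eqOn_open_of_ae_eq h2 isOpen_Ioi (hc.mono Ioi_subset_Ici_self) continuousOn_const
    have h5 : EqOn (fun x => q x) (fun _ => 0) (Ici 0) :=
      h4.of_subset_closure hc continuousOn_const Ioi_subset_Ici_self (by rw [closure_Ioi])
    refine Subtype.ext (funext fun x => ?_)
    have h6 := h5 x.2
    have h7 : q.1 x = 0 := by simpa using h6
    exact h7
  add_left q p r := by
    have h := integral_add (q.integrable_inner r) (p.integrable_inner r)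
    refine Eq.trans (integral_congr_ae ?_) h
    filter_upwards [ae_differentiableAt_halfLine q.2.1, ae_differentiableAt_halfLine p.2.1]
      with x hq hp
    have h0 : IciExtend (q + p : HPlus).1 = IciExtend q.1 + IciExtend p.1 := rfl
    rw [h0, deriv_add hq hp, Pi.add_apply]
    ring
  smul_left q p c := by
    have h := integral_const_mul c
      (fun x => q x * p x + deriv q x * deriv p x + (x * q x) * (x * p x)) (μ := halfLine)
    refine Eq.trans (integral_congr_ae (Filter.Eventually.of_forall fun x => ?_)) h
    have h0 : IciExtend (c • q : HPlus).1 = fun x => c * IciExtend q.1 x := rfl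
    simp only [h0, deriv_const_mul_field]
    ring

noncomputable instance : NormedAddCommGroup HPlus := hPlusCore.toNormedAddCommGroup
noncomputable instance : InnerProductSpace ℝ HPlus := InnerProductSpace.ofCore hPlusCore.toCore

/-! ### The weighted spaces `ℓ²_r` and the space of spectral data -/

/-- Real sequences `c` with `∑ (1 + n)^(2r) |c n|² < ∞`. -/
def ell2Submodule (r : ℝ) : Submodule ℝ (ℕ → ℝ) where
  carrier := {c | Summable fun n : ℕ => (1 + n : ℝ) ^ (2 * r) * c n ^ 2}
  zero_mem' := by
    simp [summable_zero]
  add_mem' := by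
    intro c d hc hd
    refine Summable.of_nonneg_of_le (fun n => by positivity) (fun n => ?_)
      ((hc.mul_left 2).add (hd.mul_left 2))
    have h : (0 : ℝ) ≤ (1 + n : ℝ) ^ (2 * r) := by positivity
    simp only [Pi.add_apply]
    nlinarith [mul_nonneg h (sq_nonneg (c n - d n))]
  smul_mem' := by
    intro a c hc
    refine (hc.mul_left (a ^ 2)).congr fun n => ?_
    simp only [Pi.smul_apply, smul_eq_mul]
    ring

/-- The real weighted space `ℓ²_r`. -/
def Ell2 (r : ℝ) : Type := ell2Submodule r

noncomputable instance (r : ℝ) : AddCommGroup (Ell2 r) :=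
  inferInstanceAs (AddCommGroup (ell2Submodule r))
noncomputable instance (r : ℝ) : Module ℝ (Ell2 r) :=
  inferInstanceAs (Module ℝ (ell2Submodule r))

instance (r : ℝ) : CoeFun (Ell2 r) (fun _ => ℕ → ℝ) := ⟨fun c => c.1⟩

theorem Ell2.summable_inner {r : ℝ} (c d : Ell2 r) :
    Summable fun n : ℕ => (1 + n : ℝ) ^ (2 * r) * (c n * d n) := by
  refine Summable.of_norm_bounded (c.2.add d.2) fun n => ?_
  have h : (0 : ℝ) ≤ (1 + n : ℝ) ^ (2 * r) := by positivity
  rw [Real.norm_eq_abs, abs_mul, abs_of_nonneg h, ← mul_add]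
  refine mul_le_mul_of_nonneg_left (abs_le.2 ⟨?_, ?_⟩) h
  · nlinarith [sq_nonneg (c n + d n), sq_nonneg (c n - d n)]
  · nlinarith [sq_nonneg (c n + d n), sq_nonneg (c n - d n)]

/-- The inner product of `ℓ²_r`; its norm satisfies `‖c‖² = ∑ (1 + n)^(2r) |c n|²`. -/
@[reducible] noncomputable def ell2Core (r : ℝ) : InnerProductSpace.Core ℝ (Ell2 r) where
  inner c d := ∑' n : ℕ, (1 + n : ℝ) ^ (2 * r) * (c n * d n)
  conj_inner_symm c d := by
    simp only [conj_trivial]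
    exact tsum_congr fun n => by ring
  re_inner_nonneg c := by
    refine tsum_nonneg fun n => ?_
    rw [← pow_two]
    positivity
  definite c h := by
    have h1 : HasSum (fun n : ℕ => (1 + n : ℝ) ^ (2 * r) * (c n * c n)) 0 := by
      have h2 := (c.summable_inner c).hasSum
      rwa [h] at h2
    have h3 := (hasSum_zero_iff_of_nonneg fun n => by
      simp only [← pow_two]; positivity).1 h1
    refine Subtype.ext (funext fun n => ?_)
    have h4 := congrFun h3 n
    have h5 : (0 : ℝ) < (1 + n : ℝ) ^ (2 * r) := by positivity
    have h6 : c.1 n = 0 := by simpa [h5.ne'] using h4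
    exact h6
  add_left c d e := by
    refine Eq.trans (tsum_congr fun n => ?_)
      ((c.summable_inner e).tsum_add (d.summable_inner e))
    have h0 : (c + d : Ell2 r).1 n = c.1 n + d.1 n := rfl
    rw [h0]
    ring
  smul_left c d a := by
    refine Eq.trans (tsum_congr fun n => ?_) tsum_mul_left
    have h0 : (a • c : Ell2 r).1 n = a * c.1 n := rfl
    rw [h0]
    simp only [conj_trivial]
    ring

noncomputable instance (r : ℝ) : NormedAddCommGroup (Ell2 r) := (ell2Core r).toNormedAddCommGroup
noncomputable instance (r : ℝ) : InnerProductSpace ℝ (Ell2 r) :=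
  InnerProductSpace.ofCore (ell2Core r).toCore

/-- `∑ h_n z^n ≡ f(z) / √(1 - z)` on the unit disc, where `f(z) = ∑ f_n z^n`. As `{f_n}` runs over
`ℓ²_r`, the function `f` runs over the Hardy–Sobolev space `H²_r`, with the same norm. -/
def IsNumerator (h f : ℕ → ℝ) : Prop :=
  ∀ z : ℂ, ‖z‖ < 1 →
    HasSum (fun n => (h n : ℂ) * z ^ n) ((∑' n, (f n : ℂ) * z ^ n) / (1 - z) ^ (1 / 2 : ℂ))

theorem Ell2.summable_pow {r : ℝ} (hr : 0 ≤ r) (f : Ell2 r) {z : ℂ} (hz : ‖z‖ < 1) :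
    Summable fun n => (f n : ℂ) * z ^ n := by
  have hg : Summable fun n : ℕ => ‖z‖ ^ n :=
    summable_geometric_of_lt_one (norm_nonneg z) hz
  refine Summable.of_norm_bounded (f.2.add hg) fun n => ?_
  rw [norm_mul, norm_pow, Complex.norm_real, Real.norm_eq_abs]
  have h1 : (1 : ℝ) ≤ (1 + n : ℝ) ^ (2 * r) :=
    Real.one_le_rpow (by linarith [n.cast_nonneg (α := ℝ)]) (by linarith)
  have h2 : ‖z‖ ^ n ≤ 1 := pow_le_one₀ (norm_nonneg z) hz.le
  have h3 : 0 ≤ ‖z‖ ^ n := by positivity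
  have h4 : f n ^ 2 ≤ (1 + n : ℝ) ^ (2 * r) * f n ^ 2 :=
    le_mul_of_one_le_left (sq_nonneg _) h1
  have h5 : |f n| * ‖z‖ ^ n ≤ f n ^ 2 + ‖z‖ ^ n := by
    rw [← sq_abs]
    rcases le_total |f n| 1 with h | h
    · nlinarith [mul_le_mul_of_nonneg_right h h3, sq_nonneg |f n|]
    · nlinarith [mul_le_mul_of_nonneg_left h2 (abs_nonneg (f n))]
  linarith

theorem one_sub_cpow_ne_zero {z : ℂ} (hz : ‖z‖ < 1) : (1 - z) ^ (1 / 2 : ℂ) ≠ 0 := by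
  refine fun h => ?_
  have h1 := (Complex.cpow_eq_zero_iff _ _).1 h
  have h2 : z = 1 := (sub_eq_zero.1 h1.1).symm
  rw [h2, norm_one] at hz
  exact lt_irrefl _ hz

/-- A power series with real coefficients that vanishes on the unit disc is zero. -/
theorem eq_zero_of_hasSum_zero {f : ℕ → ℝ}
    (h : ∀ z : ℂ, ‖z‖ < 1 → HasSum (fun n => (f n : ℂ) * z ^ n) 0) : f = 0 := by
  have h1 : HasFPowerSeriesOnBall (fun _ : ℂ => (0 : ℂ))
      (FormalMultilinearSeries.ofScalars ℂ (fun n => (f n : ℂ))) 0 1 := by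
    refine ⟨?_, one_pos, fun {y} hy => ?_⟩
    · refine ENNReal.le_of_forall_nnreal_lt fun t ht => ?_
      refine FormalMultilinearSeries.le_radius_of_summable _ ?_
      have ht' : ‖((t : ℝ) : ℂ)‖ < 1 := by
        rw [Complex.norm_real, Real.norm_eq_abs, NNReal.abs_eq]
        exact_mod_cast ht
      have h2 := (h t ht').summable.norm
      refine h2.congr fun n => ?_
      simp
    · have hy' : ‖y‖ < 1 := by simpa [Metric.mem_eball, edist_zero_right, enorm_eq_nnnorm, ← NNReal.coe_lt_coe] using hy
      simpa [FormalMultilinearSeries.ofScalars_apply_eq, smul_eq_mul, mul_comm] using h y hy'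
  have h2 := h1.hasFPowerSeriesAt.eq_zero
  funext n
  have h3 := FormalMultilinearSeries.ext_iff.1 h2 n
  simpa [FormalMultilinearSeries.ofScalars_eq_zero] using h3

theorem IsNumerator.unique {h : ℕ → ℝ} {f g : Ell2 (3 / 4)}
    (hf : IsNumerator h f) (hg : IsNumerator h g) : f = g := by
  have h0 : (fun n => f n - g n) = 0 := by
    refine eq_zero_of_hasSum_zero fun z hz => ?_
    have h1 := (f.summable_pow (by norm_num) hz).hasSum.sub
      (g.summable_pow (by norm_num) hz).hasSum
    have h2 := (hf z hz).unique (hg z hz)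
    rw [div_left_inj' (one_sub_cpow_ne_zero hz)] at h2
    rw [h2, sub_self] at h1
    simpa [sub_mul] using h1
  exact Subtype.ext (funext fun n => sub_eq_zero.1 (congrFun h0 n))

theorem IsNumerator.add {h k : ℕ → ℝ} {f g : Ell2 (3 / 4)}
    (hf : IsNumerator h f) (hg : IsNumerator k g) :
    IsNumerator (h + k) (f + g : Ell2 (3 / 4)) := by
  intro z hz
  have h1 := (hf z hz).add (hg z hz)
  rw [← add_div, ← (f.summable_pow (by norm_num) hz).tsum_add
    (g.summable_pow (by norm_num) hz)] at h1
  have h0 : ∀ n, (f + g : Ell2 (3 / 4)).1 n = f.1 n + g.1 n := fun n => rfl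
  simpa [h0, add_mul] using h1

theorem IsNumerator.smul {h : ℕ → ℝ} {f : Ell2 (3 / 4)} (c : ℝ) (hf : IsNumerator h f) :
    IsNumerator (c • h) (c • f : Ell2 (3 / 4)) := by
  intro z hz
  have h1 := (hf z hz).mul_left (c : ℂ)
  rw [← mul_div_assoc, ← tsum_mul_left] at h1
  have h0 : ∀ n, (c • f : Ell2 (3 / 4)).1 n = c * f.1 n := fun n => rfl
  simpa [h0, mul_assoc] using h1

/-- The sequences `h` with `∑ h_n z^n ≡ f(z) / √(1 - z)` for some `f ∈ H²_{3/4}`. -/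
def spectralSubmodule : Submodule ℝ (ℕ → ℝ) where
  carrier := {h | ∃ f : Ell2 (3 / 4), IsNumerator h f}
  zero_mem' := by
    refine ⟨0, fun z hz => ?_⟩
    have h0 : ∀ n, (0 : Ell2 (3 / 4)).1 n = 0 := fun n => rfl
    simp [h0, hasSum_zero]
  add_mem' := by
    rintro h k ⟨f, hf⟩ ⟨g, hg⟩
    exact ⟨f + g, hf.add hg⟩
  smul_mem' := by
    rintro c h ⟨f, hf⟩
    exact ⟨c • f, hf.smul c⟩

/-- The space `ℋ` of spectral data. -/
def SpectralSpace : Type := spectralSubmodule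

noncomputable instance : AddCommGroup SpectralSpace :=
  inferInstanceAs (AddCommGroup spectralSubmodule)
noncomputable instance : Module ℝ SpectralSpace := inferInstanceAs (Module ℝ spectralSubmodule)

instance : CoeFun SpectralSpace (fun _ => ℕ → ℝ) := ⟨fun h => h.1⟩

/-- The (unique) `f ∈ H²_{3/4}` with `∑ h_n z^n ≡ f(z) / √(1 - z)`. -/
noncomputable def numerator : SpectralSpace →ₗ[ℝ] Ell2 (3 / 4) where
  toFun h := Classical.choose h.2
  map_add' h k := by
    exact IsNumerator.unique (Classical.choose_spec (h + k).2)
      ((Classical.choose_spec h.2).add (Classical.choose_spec k.2))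
  map_smul' c h := by
    exact IsNumerator.unique (Classical.choose_spec (c • h).2)
      ((Classical.choose_spec h.2).smul c)

theorem numerator_injective : Function.Injective numerator := by
  refine (injective_iff_map_eq_zero numerator).2 fun h hh => ?_
  have h1 : IsNumerator h.1 (numerator h).1 := Classical.choose_spec h.2
  rw [hh] at h1
  have h0 : ∀ n, (0 : Ell2 (3 / 4)).1 n = 0 := fun n => rfl
  refine Subtype.ext (eq_zero_of_hasSum_zero fun z hz => ?_)
  simpa [h0] using h1 z hz

/-- The norm of `ℋ`: `‖h‖ = ‖f‖` in `H²_{3/4}`. -/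
noncomputable instance : NormedAddCommGroup SpectralSpace :=
  NormedAddCommGroup.induced SpectralSpace (Ell2 (3 / 4)) numerator numerator_injective
noncomputable instance : NormedSpace ℝ SpectralSpace :=
  NormedSpace.induced ℝ SpectralSpace (Ell2 (3 / 4)) numerator

/-! ### Unperturbed solutions -/

/-- The normalized eigenfunction `ψ_n⁰(x) = (n! √π)^(-1/2) D_n(√2 x)` of `-d²/dx² + x²` on
`L²(ℝ)`. Here `D_n(y) = He_n(y) e^(-y²/4)` with `He_n` the probabilists' Hermite polynomial
(Mathlib's `Polynomial.hermite`), so `ψ_n⁰(x) = (2^n n! √π)^(-1/2) H_n(x) e^(-x²/2)`. -/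
noncomputable def psi (n : ℕ) (x : ℝ) : ℝ :=
  (√(n ! * √Real.pi))⁻¹ * Polynomial.aeval (√2 * x) (Polynomial.hermite n) * Real.exp (-x ^ 2 / 2)

/-- The Weber (parabolic cylinder) function `D_{-n-1}(w)`, `n ≥ 0`, `w ∈ ℂ`. -/
noncomputable def weberD (n : ℕ) (w : ℂ) : ℂ :=
  Complex.exp (-w ^ 2 / 4) / n ! *
    ∫ t in Ioi (0 : ℝ), (t : ℂ) ^ n * Complex.exp (-w * t - (t : ℂ) ^ 2 / 2)

/-- The second solution `χ_n⁰` of `-ψ'' + x² ψ = (2n + 1) ψ`, normalized by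
`χ_n⁰ (ψ_n⁰)' - (χ_n⁰)' ψ_n⁰ = 1` and `ψ_n⁰ χ_n⁰` odd. -/
noncomputable def chi (n : ℕ) (x : ℝ) : ℝ :=
  √(n ! * √Real.pi / 2) *
    if Even n then (-1) ^ (n / 2) * (weberD n (Complex.I * (√2 * x : ℝ))).im
    else (-1) ^ ((n - 1) / 2) * (weberD n (Complex.I * (√2 * x : ℝ))).re

/-- `ψ̃_n⁰(x) = 2^(1/4) ψ_n⁰(√2 x)`. -/
noncomputable def psiTilde (n : ℕ) (x : ℝ) : ℝ := (2 : ℝ) ^ (1 / 4 : ℝ) * psi n (√2 * x)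

/-! ### The coefficients `q̂`, `q̌`, `q̃` -/

/-- `q̂_n = ⟨q, (ψ_n⁰)²⟩₊`. -/
noncomputable def qHat (q : HPlus) (n : ℕ) : ℝ := ∫ x, q x * psi n x ^ 2 ∂halfLine

/-- `q̌_n = ⟨q, ψ_n⁰ χ_n⁰⟩₊`. -/
noncomputable def qCheck (q : HPlus) (n : ℕ) : ℝ := ∫ x, q x * (psi n x * chi n x) ∂halfLine

/-- `E_k = (2k)! / (2^(2k) (k!)²)`. -/
noncomputable def coeffE (k : ℕ) : ℝ := (2 * k)! / (2 ^ (2 * k) * (k ! : ℝ) ^ 2)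

/-- `(Fq)(z) = (2π)^(-1/4) ∑ √E_k ⟨q, ψ̃_{2k}⁰⟩₊ z^k` on the closed unit disc. -/
noncomputable def funF (q : HPlus) (z : ℂ) : ℂ :=
  ∑' k : ℕ, (((2 * Real.pi) ^ (-(1 / 4) : ℝ) * √(coeffE k) *
    ∫ x, q x * psiTilde (2 * k) x ∂halfLine : ℝ) : ℂ) * z ^ k

/-- The function with
`(G_D q)(z²) = (1 / (2z)) ((Fq)(-z) √(1 + z) - (Fq)(z) √(1 - z))` on the closed unit disc.
The right-hand side is even in `z`, so any square root `z` of the argument may be used; `dslope`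
is the quotient by `z`, extended by continuity to `z = 0`. -/
noncomputable def funGD (q : HPlus) (w : ℂ) : ℂ :=
  dslope (fun z : ℂ =>
    (funF q (-z) * (1 + z) ^ (1 / 2 : ℂ) - funF q z * (1 - z) ^ (1 / 2 : ℂ)) / 2) 0
    (w ^ (1 / 2 : ℂ))

/-- The projector `(P₊ f)(z) = (2πi)⁻¹ ∮_{|ζ| = 1} f(ζ) / (ζ - z) dζ`, `|z| < 1`. -/
noncomputable def projPlus (f : ℂ → ℂ) (z : ℂ) : ℂ :=
  (2 * Real.pi * Complex.I)⁻¹ * ∮ ζ in C(0, 1), f ζ / (ζ - z)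

/-- The function `(π / 2) P₊[(1 / √(-ζ)) ((G_D q)(ζ) - (G_D q)(1))]` on the unit disc. -/
noncomputable def tildeGen (q : HPlus) (z : ℂ) : ℂ :=
  (Real.pi / 2 : ℂ) *
    projPlus (fun ζ => ((-ζ) ^ (1 / 2 : ℂ))⁻¹ * (funGD q ζ - funGD q 1)) z

/-- `q̃_n`: the `n`-th Taylor coefficient at `0` of `tildeGen q` (these coefficients are real). -/
noncomputable def qTilde (q : HPlus) (n : ℕ) : ℝ := (iteratedDeriv n (tildeGen q) 0 / n !).re

end HalfLineOscillator

open HalfLineOscillator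

namespace HalfLineOscillator

/-! ### The Taylor coefficients of `(1 - z)^(-1/2)` and `(1 - z)^(1/2)` -/

/-! Everything is read off the Taylor coefficients of F. Integration by parts, with the Neumann
condition ψ_{2k}'(0) = 0 removing the boundary term, turns ψ_{2k} / √(2k+1) into an orthonormal
basis of H₊ (`psiBasis`); completeness is a moment argument. As E_k has order k^(-1/2), the factor
√E_k converts the weight 2k+1 into k^(3/2), so q ↦ F is an isomorphism of H₊ onto ℓ²_{3/4}
(`exists_coefF_equiv`). Squares of Hermite polynomials linearize in such a way that ∑ q̂_n z^n =
F(z) / √(1-z) (`herm_sq`, `qHat_eq`).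

From 1/√(1-z) = √(1+z) / √(1-z²), the odd-index q̂ have generating function f(z)/√(1-z) with 2z
f(z²) = F(z)√(1+z) - F(-z)√(1-z). With G = G_D q this is a 2×2 system whose determinant (1+z) -
(1-z) = 2z cancels the division by 2z: F(z) = √(1+z) f(z²) + √(1-z) G(z²). Since ℓ²_{3/4} is a
convolution algebra containing √(1±z), F ↔ (f, G) is an isomorphism of ℓ²_{3/4} onto its square
(`exists_numSeries_dirSeries_equiv`). The component f accounts for the factor ℋ.

The component G accounts for q(0) and q̃. Its coefficients are G_m = q̂_{2m} - q̂_{2m+1}, and G(1) =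
q(0)/4. Write κ(n,m) = 1/(2(n-m)+1). The factor 1/√(-ζ) shifts Fourier frequencies by one half, so
the Cauchy integral gives q̃_n = ∑ (κ(n,m) - κ(n,0)) G_m. The map G ↦ (G(1), q̃) is bounded by a
weighted Hilbert inequality and is inverted by an explicit matrix, because the rows and columns of κ
are orthogonal for weights built from E_n (`exists_hilbert_equiv`).

For the formula of part (i), the Green function with a Neumann condition at 0, on the diagonal,
gives ψ_{2n+1} χ_{2n+1} = ∑ κ(n,m) ψ_{2m}² (`hasSum_psi_mul_chi`). Integrating against q yields
q̌_{2n+1} = ∑ κ(n,m) q̂_{2m} (`hasSum_qCheck`); subtracting ∑ κ(n,m) G_m = q(0)/(4(2n+1)) + q̃_n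
leaves the sum over odd indices. -/

theorem coeffE_zero : coeffE 0 = 1 := by simp [coeffE]

theorem coeffE_succ (k : ℕ) : coeffE (k + 1) = coeffE k * ((2 * k + 1) / (2 * k + 2)) := by
  have h : 2 * (k + 1) = 2 * k + 1 + 1 := by ring
  have hk : ((k ! : ℕ) : ℝ) ≠ 0 := by positivity
  have h2 : (2 * k + 2 : ℝ) ≠ 0 := by positivity
  rw [coeffE, coeffE, h, Nat.factorial_succ, Nat.factorial_succ, Nat.factorial_succ, pow_succ,
    pow_succ]
  push_cast
  field_simp
  ring

theorem coeffE_pos (k : ℕ) : 0 < coeffE k := by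
  unfold coeffE; positivity

/-- The left side decreases in k because (2k+1)(2k+3) ≤ (2k+2)². With `one_le_coeffE_sq_mul` this
pins the order of E_k to k^(-1/2), which is where all exponents below come from. -/
theorem coeffE_sq_mul_le (k : ℕ) : coeffE k ^ 2 * (2 * k + 1) ≤ 1 := by
  induction k with
  | zero => simp [coeffE_zero]
  | succ k ih =>
    refine le_trans ?_ ih
    rw [coeffE_succ, mul_pow, mul_assoc]
    refine mul_le_mul_of_nonneg_left ?_ (sq_nonneg _)
    have h2 : (0 : ℝ) < 2 * k + 2 := by positivity
    rw [div_pow, div_mul_eq_mul_div, div_le_iff₀ (by positivity)]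
    push_cast
    nlinarith [(Nat.cast_nonneg k : (0 : ℝ) ≤ k)]

theorem one_le_coeffE_sq_mul (k : ℕ) : 1 ≤ coeffE k ^ 2 * (4 * k + 1) := by
  induction k with
  | zero => simp [coeffE_zero]
  | succ k ih =>
    refine le_trans ih ?_
    rw [coeffE_succ, mul_pow, mul_assoc]
    refine mul_le_mul_of_nonneg_left ?_ (sq_nonneg _)
    have h2 : (0 : ℝ) < 2 * k + 2 := by positivity
    rw [div_pow, div_mul_eq_mul_div, le_div_iff₀ (by positivity)]
    push_cast
    nlinarith [(Nat.cast_nonneg k : (0 : ℝ) ≤ k)]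

theorem coeffE_le_one (k : ℕ) : coeffE k ≤ 1 := by
  have h := coeffE_sq_mul_le k
  have hk : (0 : ℝ) ≤ k := Nat.cast_nonneg k
  nlinarith [coeffE_pos k, mul_nonneg (sq_nonneg (coeffE k)) hk]

theorem tendsto_coeffE : Filter.Tendsto coeffE Filter.atTop (nhds 0) := by
  have h1 : Filter.Tendsto (fun k : ℕ => √(1 / ((k : ℝ) + 1))) Filter.atTop (nhds 0) := by
    have h := (Real.continuous_sqrt.tendsto 0).comp
      (tendsto_one_div_add_atTop_nhds_zero_nat (𝕜 := ℝ))
    rwa [Real.sqrt_zero] at h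
  refine squeeze_zero (fun k => (coeffE_pos k).le) (fun k => ?_) h1
  refine Real.le_sqrt_of_sq_le ?_
  rw [le_div_iff₀ (by positivity)]
  have h := coeffE_sq_mul_le k
  nlinarith [mul_nonneg (sq_nonneg (coeffE k)) (Nat.cast_nonneg k : (0 : ℝ) ≤ k)]

/-- The Taylor coefficients of `√(1 - z)`. -/
noncomputable def sqrtCoeff (k : ℕ) : ℝ := coeffE k / (1 - 2 * k)

theorem one_sub_two_mul_ne_zero (k : ℕ) : (1 - 2 * k : ℝ) ≠ 0 := by
  intro h
  have h1 : ((2 * k : ℕ) : ℝ) = (1 : ℕ) := by push_cast; linarith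
  have := Nat.cast_injective h1
  omega

theorem sqrtCoeff_zero : sqrtCoeff 0 = 1 := by simp [sqrtCoeff, coeffE_zero]

/-- Coefficientwise form of √(1-z) = (1-z) · (1-z)^(-1/2). -/
theorem sqrtCoeff_succ (k : ℕ) : sqrtCoeff (k + 1) = coeffE (k + 1) - coeffE k := by
  have h := one_sub_two_mul_ne_zero (k + 1)
  have h2 : (2 * k + 2 : ℝ) ≠ 0 := by positivity
  rw [sqrtCoeff, coeffE_succ, div_eq_iff h]
  push_cast
  field_simp
  ring

theorem coeffE_succ_le (k : ℕ) : coeffE (k + 1) ≤ coeffE k := by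
  rw [coeffE_succ]
  refine mul_le_of_le_one_right (coeffE_pos k).le ?_
  rw [div_le_one (by positivity)]
  linarith

theorem abs_sqrtCoeff_succ (k : ℕ) : |sqrtCoeff (k + 1)| = coeffE k - coeffE (k + 1) := by
  rw [sqrtCoeff_succ, abs_of_nonpos (by linarith [coeffE_succ_le k])]
  ring

/-- The absolute values telescope, since E_k decreases to 0. The exact value 1 is what later keeps
the sum of the series in the right half-plane. -/
theorem hasSum_abs_sqrtCoeff_succ : HasSum (fun k => |sqrtCoeff (k + 1)|) 1 := by
  refine (hasSum_iff_tendsto_nat_of_nonneg (fun k => abs_nonneg _) _).2 ?_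
  have h : ∀ n, ∑ k ∈ Finset.range n, |sqrtCoeff (k + 1)| = 1 - coeffE n := fun n => by
    simp_rw [abs_sqrtCoeff_succ]
    rw [Finset.sum_range_sub', coeffE_zero]
  simp_rw [h]
  simpa using tendsto_coeffE.const_sub 1

theorem summable_abs_sqrtCoeff : Summable fun k => |sqrtCoeff k| :=
  (summable_nat_add_iff 1).1 hasSum_abs_sqrtCoeff_succ.summable

open PowerSeries in
-- The recurrence for E_k is the equation 2(1-X)A' = A, which makes the derivative of A²(1-X)
-- vanish; the constant term is 1.
theorem mk_coeffE_sq_mul : (mk coeffE) ^ 2 * (1 - X) = (1 : PowerSeries ℝ) := by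
  have h : 2 * (1 - X) * derivative ℝ (mk coeffE) = mk coeffE := by
    ext n
    rw [mul_assoc, two_mul, map_add, sub_mul, one_mul]
    cases n with
    | zero =>
      rw [map_sub, coeff_zero_X_mul, coeff_derivative, coeff_mk, coeff_mk, coeffE_succ, coeffE_zero]
      norm_num
    | succ n =>
      rw [map_sub, coeff_succ_X_mul, coeff_derivative, coeff_derivative, coeff_mk, coeff_mk,
        coeffE_succ (n + 1)]
      have h2 : (2 * n + 4 : ℝ) ≠ 0 := by positivity
      push_cast
      have : (2 * (n + 1) + 2 : ℝ) ≠ 0 := by positivity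
      field_simp
      ring
  refine derivative.ext ?_ ?_
  · have h1 : derivative ℝ ((mk coeffE) ^ 2 * (1 - X)) =
        mk coeffE * (2 * (1 - X) * derivative ℝ (mk coeffE) - mk coeffE) := by
      simp [Derivation.leibniz, Derivation.leibniz_pow]
      ring
    rw [h1, h]
    simp
  · simp [coeffE_zero]

open PowerSeries in
theorem one_sub_X_mul_mk_coeffE : (1 - X) * mk coeffE = (mk sqrtCoeff : PowerSeries ℝ) := by
  ext n
  rw [sub_mul, one_mul, map_sub]
  cases n with
  | zero => simp [sqrtCoeff_zero, coeffE_zero]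
  | succ n => rw [coeff_succ_X_mul]; simp [sqrtCoeff_succ]

open PowerSeries in
theorem mk_sqrtCoeff_mul_mk_coeffE : mk sqrtCoeff * mk coeffE = (1 : PowerSeries ℝ) := by
  rw [← one_sub_X_mul_mk_coeffE]
  linear_combination mk_coeffE_sq_mul

open PowerSeries in
theorem mk_sqrtCoeff_sq : (mk sqrtCoeff) ^ 2 = (1 - X : PowerSeries ℝ) := by
  rw [← one_sub_X_mul_mk_coeffE]
  linear_combination (1 - X) * mk_coeffE_sq_mul

theorem summable_norm_sqrtCoeff_mul_pow {z : ℂ} (hz : ‖z‖ ≤ 1) :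
    Summable fun k => ‖(sqrtCoeff k : ℂ) * z ^ k‖ := by
  refine Summable.of_nonneg_of_le (fun _ => norm_nonneg _) (fun k => ?_) summable_abs_sqrtCoeff
  rw [norm_mul, norm_pow, Complex.norm_real, Real.norm_eq_abs]
  exact mul_le_of_le_one_right (abs_nonneg _) (pow_le_one₀ (norm_nonneg _) hz)

/-- A Cauchy product of absolutely summable power series. -/
theorem hasSum_powerSeries_mul {a b : ℕ → ℝ} {z : ℂ}
    (ha : Summable fun k => ‖(a k : ℂ) * z ^ k‖) (hb : Summable fun k => ‖(b k : ℂ) * z ^ k‖) :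
    HasSum (fun n => ((PowerSeries.coeff n (PowerSeries.mk a * PowerSeries.mk b) : ℝ) : ℂ) * z ^ n)
      ((∑' k, (a k : ℂ) * z ^ k) * ∑' k, (b k : ℂ) * z ^ k) := by
  rw [tsum_mul_tsum_eq_tsum_sum_antidiagonal_of_summable_norm ha hb]
  have h := (summable_norm_sum_mul_antidiagonal_of_summable_norm ha hb).of_norm.hasSum
  refine h.congr_fun fun n => ?_
  rw [PowerSeries.coeff_mul, Complex.ofReal_sum, Finset.sum_mul]
  refine Finset.sum_congr rfl fun p hp => ?_
  rw [← Finset.HasAntidiagonal.mem_antidiagonal.1 hp]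
  simp only [PowerSeries.coeff_mk, Complex.ofReal_mul, pow_add]
  ring

/-- The sum S squares to 1-z by the formal identity. It is the principal root because Re S ≥ 0, and
this persists up to the unit circle by absolute convergence. -/
theorem tsum_sqrtCoeff_mul_pow {z : ℂ} (hz : ‖z‖ ≤ 1) :
    ∑' k, (sqrtCoeff k : ℂ) * z ^ k = (1 - z) ^ (1 / 2 : ℂ) := by
  set S := ∑' k, (sqrtCoeff k : ℂ) * z ^ k with hS
  have hsum := summable_norm_sqrtCoeff_mul_pow hz
  have hsq : S ^ 2 = 1 - z := by
    have h1 := hasSum_powerSeries_mul hsum hsum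
    rw [← pow_two, ← pow_two, mk_sqrtCoeff_sq] at h1
    have h2 : HasSum (fun n => ((PowerSeries.coeff n (1 - PowerSeries.X : PowerSeries ℝ) : ℝ) : ℂ)
        * z ^ n) (∑ n ∈ Finset.range 2,
          ((PowerSeries.coeff n (1 - PowerSeries.X : PowerSeries ℝ) : ℝ) : ℂ) * z ^ n) := by
      refine hasSum_sum_of_ne_finset_zero fun n hn => ?_
      have hn' : ¬ n < 2 := by simpa using hn
      simp [PowerSeries.coeff_one, PowerSeries.coeff_X, show n ≠ 0 by omega, show n ≠ 1 by omega]
    have h3 := h1.unique h2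
    rw [hS, h3]
    simp [Finset.sum_range_succ, PowerSeries.coeff_one, PowerSeries.coeff_X]
    ring
  have hre : 0 ≤ S.re := by
    have h1 : S = 1 + ∑' k, (sqrtCoeff (k + 1) : ℂ) * z ^ (k + 1) := by
      rw [hS, hsum.of_norm.tsum_eq_zero_add]
      simp [sqrtCoeff_zero]
    have h2 : ‖∑' k, (sqrtCoeff (k + 1) : ℂ) * z ^ (k + 1)‖ ≤ 1 := by
      refine tsum_of_norm_bounded hasSum_abs_sqrtCoeff_succ fun k => ?_
      rw [norm_mul, norm_pow, Complex.norm_real, Real.norm_eq_abs]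
      exact mul_le_of_le_one_right (abs_nonneg _) (pow_le_one₀ (norm_nonneg _) hz)
    have h3 := (abs_le.1 ((Complex.abs_re_le_norm _).trans h2)).1
    rw [h1, Complex.add_re, Complex.one_re]
    linarith
  have key : S = (S ^ 2) ^ (1 / 2 : ℂ) := by
    rcases hre.lt_or_eq with h | h
    · have h1 : |S.arg| < Real.pi / 2 := Complex.abs_arg_lt_pi_div_two_iff.2 (Or.inl h)
      have h2 := abs_lt.1 h1
      have := Complex.pow_cpow_nat_inv (x := S) (n := 2) two_ne_zero (by push_cast; linarith [h2.1])
        (by push_cast; linarith [h2.2])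
      rw [← this]
      simp
    -- If Re S = 0, then -(Im S)² = Re(1-z) ≥ 0 forces S = 0, so the cut of the root causes no
    -- ambiguity.
    · have h0 : S = 0 := by
        have h1 : z.re ≤ 1 := (Complex.re_le_norm z).trans hz
        have h2 := congrArg Complex.re hsq
        rw [pow_two, Complex.mul_re, ← h, Complex.sub_re, Complex.one_re] at h2
        have h3 : S.im = 0 := by nlinarith
        exact Complex.ext h.symm h3
      rw [h0]
      simp
  rw [key, hsq]

theorem summable_norm_coeffE_mul_pow {z : ℂ} (hz : ‖z‖ < 1) :
    Summable fun k => ‖(coeffE k : ℂ) * z ^ k‖ := by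
  refine Summable.of_nonneg_of_le (fun _ => norm_nonneg _) (fun k => ?_)
    (summable_geometric_of_lt_one (norm_nonneg z) hz)
  rw [norm_mul, norm_pow, Complex.norm_real, Real.norm_eq_abs, abs_of_pos (coeffE_pos k)]
  exact mul_le_of_le_one_left (by positivity) (coeffE_le_one k)

theorem tsum_coeffE_mul_pow {z : ℂ} (hz : ‖z‖ < 1) :
    ∑' k, (coeffE k : ℂ) * z ^ k = ((1 - z) ^ (1 / 2 : ℂ))⁻¹ := by
  have h1 := hasSum_powerSeries_mul (summable_norm_sqrtCoeff_mul_pow hz.le)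
    (summable_norm_coeffE_mul_pow hz)
  rw [mk_sqrtCoeff_mul_mk_coeffE, tsum_sqrtCoeff_mul_pow hz.le] at h1
  have h2 : HasSum (fun n => ((PowerSeries.coeff n (1 : PowerSeries ℝ) : ℝ) : ℂ) * z ^ n) 1 := by
    have := hasSum_single (f := fun n => ((PowerSeries.coeff n (1 : PowerSeries ℝ) : ℝ) : ℂ) * z ^ n)
      0 (fun n hn => by simp [PowerSeries.coeff_one, hn])
    simpa using this
  exact eq_inv_of_mul_eq_one_right (h1.unique h2)


/-! ### Even and odd parts of power series -/

section EvenOdd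

open PowerSeries

/-- The series `P(X²)`. -/
noncomputable def expandTwo : PowerSeries ℝ →ₐ[ℝ] PowerSeries ℝ := expand 2 two_ne_zero

/-- The series `Q` with `P(X) - P(-X) = 2 X Q(X²)`. -/
noncomputable def oddPart (P : PowerSeries ℝ) : PowerSeries ℝ := mk fun m => coeff (2 * m + 1) P

theorem coeff_even_expandTwo (P : PowerSeries ℝ) (m : ℕ) :
    coeff (2 * m) (expandTwo P) = coeff m P := coeff_expand_mul 2 two_ne_zero P m

theorem coeff_odd_expandTwo (P : PowerSeries ℝ) (m : ℕ) :
    coeff (2 * m + 1) (expandTwo P) = 0 :=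
  coeff_expand_of_not_dvd 2 two_ne_zero P (by omega)

theorem eq_expandTwo_add (P : PowerSeries ℝ) :
    ∃ A, P = expandTwo A + X * expandTwo (oddPart P) := by
  refine ⟨mk fun m => coeff (2 * m) P, ?_⟩
  ext n
  rw [map_add]
  obtain ⟨m, rfl | rfl⟩ := n.even_or_odd'
  · rw [coeff_even_expandTwo, coeff_mk]
    cases m with
    | zero => simp
    | succ m =>
      rw [show 2 * (m + 1) = 2 * m + 1 + 1 by ring, coeff_succ_X_mul, coeff_odd_expandTwo, add_zero]
  · rw [coeff_odd_expandTwo, coeff_succ_X_mul, coeff_even_expandTwo, oddPart, coeff_mk, zero_add]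

theorem oddPart_expandTwo_add (A B : PowerSeries ℝ) :
    oddPart (expandTwo A + X * expandTwo B) = B := by
  ext m
  rw [oddPart, coeff_mk, map_add, coeff_odd_expandTwo, coeff_succ_X_mul, coeff_even_expandTwo,
    zero_add]

theorem oddPart_expandTwo_mul (A P : PowerSeries ℝ) :
    oddPart (expandTwo A * P) = A * oddPart P := by
  obtain ⟨B, hB⟩ := eq_expandTwo_add P
  have h : expandTwo A * P = expandTwo (A * B) + X * expandTwo (A * oddPart P) := by
    conv_lhs => rw [hB]
    rw [map_mul, map_mul]
    ring
  rw [h, oddPart_expandTwo_add]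

theorem evalNegHom_expandTwo (P : PowerSeries ℝ) : evalNegHom (expandTwo P) = expandTwo P := by
  ext n
  rw [evalNegHom, coeff_rescale]
  obtain ⟨m, rfl | rfl⟩ := n.even_or_odd'
  · rw [pow_mul]; simp
  · rw [coeff_odd_expandTwo, mul_zero]

theorem sub_evalNegHom (P : PowerSeries ℝ) : P - evalNegHom P = 2 * X * expandTwo (oddPart P) := by
  obtain ⟨A, hA⟩ := eq_expandTwo_add P
  conv_lhs => rw [hA]
  rw [map_add, map_mul, evalNegHom_X, evalNegHom_expandTwo, evalNegHom_expandTwo]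
  ring

theorem evalNegHom_evalNegHom (P : PowerSeries ℝ) : evalNegHom (evalNegHom P) = P := by
  ext n
  rw [evalNegHom, coeff_rescale, coeff_rescale, ← mul_assoc, ← mul_pow]
  simp

theorem evalNegHom_mk_sqrtCoeff_sq : (evalNegHom (mk sqrtCoeff)) ^ 2 = (1 + X : PowerSeries ℝ) := by
  have h := congrArg (evalNegHom (A := ℝ)) mk_sqrtCoeff_sq
  simpa [evalNegHom_X] using h

/-- Both sides square to (1-X²)^(-1), so they agree up to sign in the domain of power series; the
constant terms decide the sign. -/
theorem mk_coeffE_mul_evalNegHom :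
    mk coeffE * evalNegHom (mk coeffE) = expandTwo (mk coeffE) := by
  have h1 : (evalNegHom (mk coeffE)) ^ 2 * (1 + X) = (1 : PowerSeries ℝ) := by
    simpa [evalNegHom_X] using congrArg (evalNegHom (A := ℝ)) mk_coeffE_sq_mul
  have h2 : (expandTwo (mk coeffE)) ^ 2 * (1 - X ^ 2) = (1 : PowerSeries ℝ) := by
    simpa [expandTwo] using congrArg expandTwo mk_coeffE_sq_mul
  have h3 : (mk coeffE * evalNegHom (mk coeffE)) ^ 2 * (1 - X ^ 2) = (1 : PowerSeries ℝ) := by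
    linear_combination (evalNegHom (mk coeffE)) ^ 2 * (1 + X) * mk_coeffE_sq_mul + h1
  have h0 : (1 - X ^ 2 : PowerSeries ℝ) ≠ 0 := fun h => by simp [h] at h2
  rcases sq_eq_sq_iff_eq_or_eq_neg.1 (mul_right_cancel₀ h0 (h3.trans h2.symm)) with h | h
  · exact h
  · have h4 := congrArg (coeff 0) h
    have h5 := coeff_even_expandTwo (mk coeffE) 0
    rw [mul_zero, coeff_mk, coeffE_zero] at h5
    rw [coeff_mul, Finset.Nat.antidiagonal_zero, Finset.sum_singleton, map_neg, evalNegHom,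
      coeff_rescale, coeff_mk, coeffE_zero, h5] at h4
    norm_num at h4

theorem mk_coeffE_eq :
    mk coeffE = expandTwo (mk coeffE) * evalNegHom (mk sqrtCoeff) := by
  have h := congrArg (evalNegHom (A := ℝ)) mk_sqrtCoeff_mul_mk_coeffE
  rw [map_mul, map_one] at h
  rw [← mk_coeffE_mul_evalNegHom]
  linear_combination -(mk coeffE) * h

theorem mk_sqrtCoeff_mul_evalNegHom :
    mk sqrtCoeff * evalNegHom (mk sqrtCoeff) = expandTwo (mk sqrtCoeff) := by
  have h := congrArg (evalNegHom (A := ℝ)) mk_sqrtCoeff_mul_mk_coeffE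
  have h2 := congrArg expandTwo mk_sqrtCoeff_mul_mk_coeffE
  rw [map_mul, map_one] at h h2
  rw [← mk_coeffE_mul_evalNegHom] at h2
  linear_combination (-mk sqrtCoeff * evalNegHom (mk sqrtCoeff)) * h2 +
    expandTwo (mk sqrtCoeff) * evalNegHom (mk sqrtCoeff) * evalNegHom (mk coeffE) *
      mk_sqrtCoeff_mul_mk_coeffE + expandTwo (mk sqrtCoeff) * h

/-- If `F` is the generating function of the coefficients of a potential, `numSeries F` is the
numerator of the odd part of `F(z) / √(1 - z)`. -/
noncomputable def numSeries (F : PowerSeries ℝ) : PowerSeries ℝ :=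
  oddPart (evalNegHom (mk sqrtCoeff) * F)

/-- The series `G` with `2 X G(X²) = F(-X) √(1 + X) - F(X) √(1 - X)`. -/
noncomputable def dirSeries (F : PowerSeries ℝ) : PowerSeries ℝ := - oddPart (mk sqrtCoeff * F)

/-- Writing 1/√(1-X) = √(1+X)/√(1-X²) splits off a factor in X², which passes through the odd part.
-/
theorem oddPart_mk_coeffE_mul (F : PowerSeries ℝ) :
    oddPart (mk coeffE * F) = mk coeffE * numSeries F := by
  conv_lhs => rw [mk_coeffE_eq, mul_assoc, oddPart_expandTwo_mul]
  rfl

/-- Because √(1-X) = (1-X)/√(1-X), the coefficients are consecutive differences of those of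
F/√(1-X). -/
theorem coeff_dirSeries (F : PowerSeries ℝ) (m : ℕ) :
    coeff m (dirSeries F) = coeff (2 * m) (mk coeffE * F) - coeff (2 * m + 1) (mk coeffE * F) := by
  rw [dirSeries, map_neg, oddPart, coeff_mk, ← one_sub_X_mul_mk_coeffE, mul_assoc, sub_mul, map_sub,
    coeff_succ_X_mul, one_mul]
  ring

/-- With a = √(1+X), b = √(1-X): a times the equation for f plus b times the equation for g gives
(a² - b²)F = 2X(a f(X²) + b g(X²)), and a² - b² = 2X cancels exactly. No regularity is lost. -/
theorem eq_of_numSeries_dirSeries (F : PowerSeries ℝ) :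
    F = evalNegHom (mk sqrtCoeff) * expandTwo (numSeries F) +
      mk sqrtCoeff * expandTwo (dirSeries F) := by
  have h1 := sub_evalNegHom (evalNegHom (mk sqrtCoeff) * F)
  have h2 := sub_evalNegHom (mk sqrtCoeff * F)
  rw [map_mul, evalNegHom_evalNegHom] at h1
  rw [map_mul] at h2
  have h3 : expandTwo (dirSeries F) = - expandTwo (oddPart (mk sqrtCoeff * F)) := by
    rw [dirSeries, map_neg]
  have h0 : (2 * X : PowerSeries ℝ) ≠ 0 := fun h => by
    have := congrArg (coeff 1) h
    rw [two_mul, map_add, coeff_one_X, map_zero] at this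
    norm_num at this
  refine mul_left_cancel₀ h0 ?_
  rw [numSeries, h3]
  linear_combination evalNegHom (mk sqrtCoeff) * h1 - mk sqrtCoeff * h2 -
    F * evalNegHom_mk_sqrtCoeff_sq + F * mk_sqrtCoeff_sq

theorem numSeries_dirSeries_of_eq (f g : PowerSeries ℝ) :
    numSeries (evalNegHom (mk sqrtCoeff) * expandTwo f + mk sqrtCoeff * expandTwo g) = f ∧
    dirSeries (evalNegHom (mk sqrtCoeff) * expandTwo f + mk sqrtCoeff * expandTwo g) = g := by
  constructor
  · have h : evalNegHom (mk sqrtCoeff) *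
        (evalNegHom (mk sqrtCoeff) * expandTwo f + mk sqrtCoeff * expandTwo g) =
        expandTwo (f + mk sqrtCoeff * g) + X * expandTwo f := by
      rw [map_add, map_mul]
      linear_combination expandTwo f * evalNegHom_mk_sqrtCoeff_sq +
        expandTwo g * mk_sqrtCoeff_mul_evalNegHom
    rw [numSeries, h, oddPart_expandTwo_add]
  · have h : mk sqrtCoeff *
        (evalNegHom (mk sqrtCoeff) * expandTwo f + mk sqrtCoeff * expandTwo g) =
        expandTwo (g + mk sqrtCoeff * f) + X * expandTwo (-g) := by
      rw [map_add, map_mul, map_neg]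
      linear_combination expandTwo g * mk_sqrtCoeff_sq +
        expandTwo f * mk_sqrtCoeff_mul_evalNegHom
    rw [dirSeries, h, oddPart_expandTwo_add, neg_neg]

end EvenOdd

/-! ### Matrices with bounded bilinear forms -/

/-- The bilinear form of the matrix `K` is bounded on `ℓ²`. -/
def FormBound (K : ℕ → ℕ → ℝ) (C : ℝ) : Prop :=
  ∀ (N : ℕ) (x y : ℕ → ℝ), ∑ n ∈ Finset.range N, ∑ m ∈ Finset.range N, K n m * x n * y m ≤
    C * (∑ n ∈ Finset.range N, x n ^ 2 + ∑ m ∈ Finset.range N, y m ^ 2)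

theorem FormBound.transpose {K : ℕ → ℕ → ℝ} {C : ℝ} (h : FormBound K C) :
    FormBound (fun n m => K m n) C := by
  intro N x y
  have h1 := h N y x
  rw [Finset.sum_comm, add_comm (∑ n ∈ Finset.range N, y n ^ 2)] at h1
  refine le_trans (le_of_eq ?_) h1
  exact Finset.sum_congr rfl fun n _ => Finset.sum_congr rfl fun m _ => by ring

theorem FormBound.add {K L : ℕ → ℕ → ℝ} {C D : ℝ} (h : FormBound K C) (h' : FormBound L D) :
    FormBound (fun n m => K n m + L n m) (C + D) := by
  intro N x y
  have h1 := add_le_add (h N x y) (h' N x y)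
  rw [← Finset.sum_add_distrib, ← add_mul] at h1
  refine le_trans (le_of_eq ?_) h1
  refine Finset.sum_congr rfl fun n _ => ?_
  rw [← Finset.sum_add_distrib]
  exact Finset.sum_congr rfl fun m _ => by ring

theorem FormBound.mono_const {K : ℕ → ℕ → ℝ} {C D : ℝ} (h : FormBound K C) (hCD : C ≤ D) :
    FormBound K D := fun N x y => (h N x y).trans (mul_le_mul_of_nonneg_right hCD
  (add_nonneg (Finset.sum_nonneg fun _ _ => sq_nonneg _)
    (Finset.sum_nonneg fun _ _ => sq_nonneg _)))

/-- The Schur test, in the form of an arbitrary splitting of the kernel. -/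
theorem formBound_of_split {K a b : ℕ → ℕ → ℝ} {A B : ℝ} (hA : 0 ≤ A) (hB : 0 ≤ B)
    (hK : ∀ n m x y, K n m * x * y ≤ a n m * x ^ 2 + b n m * y ^ 2)
    (ha : ∀ N n, ∑ m ∈ Finset.range N, a n m ≤ A)
    (hb : ∀ N m, ∑ n ∈ Finset.range N, b n m ≤ B) : FormBound K (A + B) := by
  intro N x y
  have h1 : ∑ n ∈ Finset.range N, ∑ m ∈ Finset.range N, a n m * x n ^ 2 ≤
      A * ∑ n ∈ Finset.range N, x n ^ 2 := by
    rw [Finset.mul_sum]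
    refine Finset.sum_le_sum fun n _ => ?_
    rw [← Finset.sum_mul]
    exact mul_le_mul_of_nonneg_right (ha N n) (sq_nonneg _)
  have h2 : ∑ n ∈ Finset.range N, ∑ m ∈ Finset.range N, b n m * y m ^ 2 ≤
      B * ∑ m ∈ Finset.range N, y m ^ 2 := by
    rw [Finset.mul_sum, Finset.sum_comm]
    refine Finset.sum_le_sum fun m _ => ?_
    rw [← Finset.sum_mul]
    exact mul_le_mul_of_nonneg_right (hb N m) (sq_nonneg _)
  have h3 : ∑ n ∈ Finset.range N, ∑ m ∈ Finset.range N, K n m * x n * y m ≤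
      ∑ n ∈ Finset.range N, ∑ m ∈ Finset.range N, (a n m * x n ^ 2 + b n m * y m ^ 2) :=
    Finset.sum_le_sum fun n _ => Finset.sum_le_sum fun m _ => hK n m _ _
  simp_rw [Finset.sum_add_distrib] at h3
  have h4 : 0 ≤ ∑ n ∈ Finset.range N, x n ^ 2 := Finset.sum_nonneg fun _ _ => sq_nonneg _
  have h5 : 0 ≤ ∑ n ∈ Finset.range N, y n ^ 2 := Finset.sum_nonneg fun _ _ => sq_nonneg _
  nlinarith

/-- Duality: a bilinear bound tested on a multiple of Ky itself bounds the norm of Ky. The cutoffs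
allow different numbers of rows and columns. -/
theorem FormBound.sum_sq_le {K : ℕ → ℕ → ℝ} {C : ℝ} (hC : 0 < C) (h : FormBound K C)
    (y : ℕ → ℝ) (N M : ℕ) :
    ∑ n ∈ Finset.range N, (∑ m ∈ Finset.range M, K n m * y m) ^ 2 ≤
      4 * C ^ 2 * ∑ m ∈ Finset.range M, y m ^ 2 := by
  set S : ℕ → ℝ := fun n => ∑ m ∈ Finset.range M, K n m * y m with hS
  -- With Q = ∑ S_n² and Y = ∑ y_m², the choice x = S/(2C) gives Q/(2C) ≤ Q/(4C) + CY, that is Q ≤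
  -- 4C²Y.
  have h1 := h (max N M) (fun n => (2 * C)⁻¹ * if n < N then S n else 0)
    (fun m => if m < M then y m else 0)
  have e1 : ∀ f : ℕ → ℝ, ∑ n ∈ Finset.range (max N M), (if n < N then f n else 0) =
      ∑ n ∈ Finset.range N, f n := fun f => by
    rw [← Finset.sum_filter]
    refine Finset.sum_congr (Finset.ext fun n => ?_) fun _ _ => rfl
    simp only [Finset.mem_filter, Finset.mem_range, lt_max_iff]
    tauto
  have e2 : ∀ f : ℕ → ℝ, ∑ n ∈ Finset.range (max N M), (if n < M then f n else 0) =
      ∑ n ∈ Finset.range M, f n := fun f => by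
    rw [← Finset.sum_filter]
    refine Finset.sum_congr (Finset.ext fun n => ?_) fun _ _ => rfl
    simp only [Finset.mem_filter, Finset.mem_range, lt_max_iff]
    tauto
  have h2 : ∑ n ∈ Finset.range (max N M), ∑ m ∈ Finset.range (max N M),
      K n m * ((2 * C)⁻¹ * if n < N then S n else 0) * (if m < M then y m else 0) =
      (2 * C)⁻¹ * ∑ n ∈ Finset.range N, S n ^ 2 := by
    rw [← e1 (fun n => S n ^ 2), Finset.mul_sum]
    refine Finset.sum_congr rfl fun n _ => ?_
    split_ifs with hn
    · have hSn : S n = ∑ m ∈ Finset.range (max N M), if m < M then K n m * y m else 0 :=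
        (e2 fun m => K n m * y m).symm
      have hsq : (2 * C)⁻¹ * S n ^ 2 = ∑ m ∈ Finset.range (max N M),
          (2 * C)⁻¹ * S n * if m < M then K n m * y m else 0 := by
        rw [← Finset.mul_sum, ← hSn]
        ring
      rw [hsq]
      refine Finset.sum_congr rfl fun m _ => ?_
      split_ifs <;> ring
    · simp
  have h3 : ∑ n ∈ Finset.range (max N M), ((2 * C)⁻¹ * if n < N then S n else 0) ^ 2 =
      (2 * C)⁻¹ ^ 2 * ∑ n ∈ Finset.range N, S n ^ 2 := by
    rw [← e1 (fun n => S n ^ 2), Finset.mul_sum]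
    refine Finset.sum_congr rfl fun n _ => ?_
    split_ifs <;> ring
  have h4 : ∑ n ∈ Finset.range (max N M), (if n < M then y n else 0) ^ 2 =
      ∑ n ∈ Finset.range M, y n ^ 2 := by
    rw [← e2 (fun n => y n ^ 2)]
    refine Finset.sum_congr rfl fun n _ => ?_
    split_ifs <;> ring
  rw [h2, h3, h4] at h1
  set Q := ∑ n ∈ Finset.range N, S n ^ 2
  set Y := ∑ n ∈ Finset.range M, y n ^ 2
  have h5 : (2 * C)⁻¹ * Q = 2 * C * ((2 * C)⁻¹ ^ 2 * Q) := by field_simp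
  have h6 : C * (2 * C)⁻¹ ^ 2 * Q ≤ C * Y := by nlinarith
  have h7 : C * (2 * C)⁻¹ ^ 2 * Q = Q / (4 * C) := by field_simp; ring
  rw [h7, div_le_iff₀ (by positivity)] at h6
  linarith

theorem summable_mul_of_summable_sq {a b : ℕ → ℝ} (ha : Summable fun n => a n ^ 2)
    (hb : Summable fun n => b n ^ 2) : Summable fun n => a n * b n := by
  refine Summable.of_norm_bounded (ha.add hb) fun n => ?_
  rw [Real.norm_eq_abs, abs_le]
  constructor <;> nlinarith [sq_nonneg (a n + b n), sq_nonneg (a n - b n)]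

theorem FormBound.summable_row {K : ℕ → ℕ → ℝ} {C : ℝ} (hC : 0 < C) (h : FormBound K C) (n : ℕ) :
    Summable fun m => K n m ^ 2 := by
  refine summable_of_sum_range_le (c := 4 * C ^ 2) (fun _ => sq_nonneg _) fun M => ?_
  -- Applying the transposed matrix to the n-th unit vector isolates the n-th row.
  have h1 := h.transpose.sum_sq_le hC (fun k => if k = n then 1 else 0) M (n + 1)
  simpa using h1

theorem FormBound.summable_mul {K : ℕ → ℕ → ℝ} {C : ℝ} (hC : 0 < C) (h : FormBound K C)
    {y : ℕ → ℝ} (hy : Summable fun m => y m ^ 2) (n : ℕ) : Summable fun m => K n m * y m :=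
  summable_mul_of_summable_sq (h.summable_row hC n) hy

theorem FormBound.sum_tsum_sq_le {K : ℕ → ℕ → ℝ} {C : ℝ} (hC : 0 < C) (h : FormBound K C)
    {y : ℕ → ℝ} (hy : Summable fun m => y m ^ 2) (N : ℕ) :
    ∑ n ∈ Finset.range N, (∑' m, K n m * y m) ^ 2 ≤ 4 * C ^ 2 * ∑' m, y m ^ 2 := by
  have h1 : Filter.Tendsto
      (fun M => ∑ n ∈ Finset.range N, (∑ m ∈ Finset.range M, K n m * y m) ^ 2) Filter.atTop
      (nhds (∑ n ∈ Finset.range N, (∑' m, K n m * y m) ^ 2)) :=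
    tendsto_finsetSum _ fun n _ => ((h.summable_mul hC hy n).hasSum.tendsto_sum_nat).pow 2
  refine le_of_tendsto' h1 fun M => (h.sum_sq_le hC y N M).trans ?_
  exact mul_le_mul_of_nonneg_left (hy.sum_le_tsum _ fun _ _ => sq_nonneg _) (by positivity)

/-! ### The spaces `ℓ²_r` -/

theorem one_add_rpow_sq (r : ℝ) (n : ℕ) : (1 + n : ℝ) ^ (2 * r) = ((1 + n : ℝ) ^ r) ^ 2 := by
  rw [mul_comm, Real.rpow_mul (by positivity)]
  norm_num

theorem mem_ell2Submodule_iff {r : ℝ} {c : ℕ → ℝ} :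
    c ∈ ell2Submodule r ↔ Summable fun n : ℕ => ((1 + n : ℝ) ^ r * c n) ^ 2 := by
  change Summable _ ↔ _
  simp_rw [one_add_rpow_sq, mul_pow]

theorem Ell2.norm_sq {r : ℝ} (c : Ell2 r) : ‖c‖ ^ 2 = ∑' n : ℕ, ((1 + n : ℝ) ^ r * c n) ^ 2 := by
  rw [← real_inner_self_eq_norm_sq]
  refine tsum_congr fun n => ?_
  rw [one_add_rpow_sq]
  ring

theorem Ell2.summable_sq {r : ℝ} (c : Ell2 r) : Summable fun n : ℕ => ((1 + n : ℝ) ^ r * c n) ^ 2 :=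
  mem_ell2Submodule_iff.1 c.2

@[ext] theorem Ell2.ext {r : ℝ} {c d : Ell2 r} (h : ∀ n, c n = d n) : c = d :=
  Subtype.ext (funext h)

theorem Ell2.smul_apply {r : ℝ} (a : ℝ) (c : Ell2 r) (n : ℕ) : (a • c) n = a * c n := rfl

theorem Ell2.zero_apply {r : ℝ} (n : ℕ) : (0 : Ell2 r) n = 0 := rfl

theorem Ell2.memℓp {r : ℝ} (c : Ell2 r) : Memℓp (fun n : ℕ => (1 + n : ℝ) ^ r * c n) 2 := by
  refine memℓp_gen (c.summable_sq.congr fun n => ?_)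
  rw [ENNReal.toReal_ofNat, Real.rpow_ofNat, Real.norm_eq_abs, sq_abs]

/-- The isometry `c ↦ {(1 + n)^r c_n}` of `ℓ²_r` onto `ℓ²`. -/
noncomputable def Ell2.toLp (r : ℝ) : Ell2 r ≃ₗᵢ[ℝ] lp (fun _ : ℕ => ℝ) 2 where
  toFun c := ⟨fun n => (1 + n : ℝ) ^ r * c n, c.memℓp⟩
  invFun d := ⟨fun n => d n / (1 + n : ℝ) ^ r, mem_ell2Submodule_iff.2 <| by
    have h := (memℓp_gen_iff (by norm_num)).1 d.2
    refine h.congr fun n => ?_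
    have : (1 + n : ℝ) ^ r ≠ 0 := by positivity
    rw [mul_div_cancel₀ _ this]
    simp⟩
  left_inv c := by
    ext n
    have : (1 + n : ℝ) ^ r ≠ 0 := by positivity
    exact mul_div_cancel_left₀ _ this
  right_inv d := by
    ext n
    have : (1 + n : ℝ) ^ r ≠ 0 := by positivity
    exact mul_div_cancel₀ _ this
  map_add' c d := by
    ext n
    exact mul_add _ _ _
  map_smul' a c := by
    ext n
    exact mul_left_comm _ _ _
  norm_map' c := by
    have h1 := lp.norm_rpow_eq_tsum (p := 2) (by norm_num)
      (⟨fun n => (1 + n : ℝ) ^ r * c n, c.memℓp⟩ : lp (fun _ : ℕ => ℝ) 2)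
    simp only [ENNReal.toReal_ofNat, Real.rpow_ofNat, Real.norm_eq_abs, sq_abs] at h1
    refine (sq_eq_sq₀ (norm_nonneg _) (norm_nonneg _)).1 ?_
    rw [c.norm_sq]
    exact h1

theorem Ell2.toLp_apply {r : ℝ} (c : Ell2 r) (n : ℕ) :
    Ell2.toLp r c n = (1 + n : ℝ) ^ r * c n := rfl

instance (r : ℝ) : CompleteSpace (Ell2 r) :=
  ((Ell2.toLp r).isometry.isUniformInducing.completeSpace_congr (Ell2.toLp r).surjective).2
    inferInstance

/-- The sequence with the only nonzero entry `1` at `j`. -/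
noncomputable def Ell2.single (r : ℝ) (j : ℕ) : Ell2 r :=
  ⟨Pi.single j 1, mem_ell2Submodule_iff.2 <| by
    refine summable_of_ne_finset_zero (s := {j}) fun n hn => ?_
    have : n ≠ j := by simpa using hn
    simp [this]⟩

theorem Ell2.single_apply (r : ℝ) (j n : ℕ) :
    Ell2.single r j n = if n = j then 1 else 0 := by
  change (Pi.single j 1 : ℕ → ℝ) n = _
  rw [Pi.single_apply]

/-- Unit vectors span a dense subspace; this is transported from the unweighted space. It reduces
all operator identities below to matrix identities. -/
theorem Ell2.clm_ext {r : ℝ} {E : Type*} [NormedAddCommGroup E] [NormedSpace ℝ E]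
    {f g : Ell2 r →L[ℝ] E} (h : ∀ j, f (Ell2.single r j) = g (Ell2.single r j)) : f = g := by
  have h1 : f.comp ((Ell2.toLp r).symm : lp (fun _ : ℕ => ℝ) 2 →L[ℝ] Ell2 r) =
      g.comp ((Ell2.toLp r).symm : lp (fun _ : ℕ => ℝ) 2 →L[ℝ] Ell2 r) := by
    refine lp.ext_continuousLinearMap (by norm_num) fun j => ?_
    refine ContinuousLinearMap.ext_ring ?_
    have h2 : (Ell2.toLp r).symm (lp.single 2 j (1 : ℝ)) =
        ((1 + j : ℝ) ^ r)⁻¹ • Ell2.single r j := by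
      refine (LinearIsometryEquiv.symm_apply_eq _).2 ?_
      ext n
      rw [Ell2.toLp_apply, Ell2.smul_apply, Ell2.single_apply, lp.single_apply, Pi.single_apply]
      split_ifs with hn
      · rw [hn]
        have : (1 + j : ℝ) ^ r ≠ 0 := by positivity
        field_simp
      · simp
    simp [h2, h]
  ext c
  have h3 := DFunLike.congr_fun h1 (Ell2.toLp r c)
  simpa using h3

/-- The functional `c ↦ ∑ ρ_m c_m`. -/
theorem Ell2.exists_functional {r : ℝ} {ρ : ℕ → ℝ}
    (h : Summable fun m : ℕ => (ρ m / (1 + m : ℝ) ^ r) ^ 2) :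
    ∃ T : Ell2 r →L[ℝ] ℝ, ∀ c, HasSum (fun m => ρ m * c m) (T c) := by
  have h1 : Memℓp (fun m : ℕ => ρ m / (1 + m : ℝ) ^ r) 2 := by
    refine memℓp_gen (h.congr fun n => ?_)
    rw [ENNReal.toReal_ofNat, Real.rpow_ofNat, Real.norm_eq_abs, sq_abs]
  let R : lp (fun _ : ℕ => ℝ) 2 := ⟨_, h1⟩
  refine ⟨(innerSL ℝ R).comp (Ell2.toLp r : Ell2 r →L[ℝ] lp (fun _ : ℕ => ℝ) 2), fun c => ?_⟩
  have h2 := lp.hasSum_inner (𝕜 := ℝ) R (Ell2.toLp r c)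
  refine h2.congr_fun fun m => ?_
  have : (1 + m : ℝ) ^ r ≠ 0 := by positivity
  rw [Ell2.toLp_apply]
  change _ = (1 + m : ℝ) ^ r * c m * (ρ m / (1 + m : ℝ) ^ r)
  field_simp

theorem Ell2.continuous_apply {r : ℝ} (n : ℕ) : Continuous fun c : Ell2 r => c n := by
  obtain ⟨T, hT⟩ := Ell2.exists_functional (r := r) (ρ := fun m => if m = n then 1 else 0) (by
    refine summable_of_ne_finset_zero (s := {n}) fun m hm => ?_
    have : m ≠ n := by simpa using hm
    simp [this])
  refine T.continuous.congr fun c => (hT c).unique ?_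
  have h := hasSum_ite_eq n (c n)
  refine h.congr_fun fun m => ?_
  split_ifs with hm
  · rw [hm, one_mul]
  · rw [zero_mul]

/-- A linear map into `ℓ²_r` with continuous coordinates is continuous. -/
theorem Ell2.continuous_of_apply {r : ℝ} {E : Type*} [NormedAddCommGroup E] [NormedSpace ℝ E]
    [CompleteSpace E] (T : E →ₗ[ℝ] Ell2 r) (h : ∀ n, Continuous fun x => T x n) :
    Continuous T := by
  refine T.continuous_of_seq_closed_graph fun u x y hu hy => ?_
  ext n
  have h1 := ((Ell2.continuous_apply n).tendsto y).comp hy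
  have h2 := ((h n).tendsto x).comp hu
  exact tendsto_nhds_unique h1 h2

/-- The operator `ℓ²_r → ℓ²_r'` with matrix `K`. -/
theorem Ell2.exists_clm {r r' : ℝ} {K : ℕ → ℕ → ℝ} {C : ℝ} (hC : 0 < C)
    (h : FormBound (fun n m => (1 + n : ℝ) ^ r' * K n m / (1 + m : ℝ) ^ r) C) :
    ∃ T : Ell2 r →L[ℝ] Ell2 r', ∀ c n, HasSum (fun m => K n m * c m) (T c n) := by
  have e1 : ∀ (c : Ell2 r) (n m : ℕ), (1 + n : ℝ) ^ r' * K n m / (1 + m : ℝ) ^ r *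
      ((1 + m : ℝ) ^ r * c m) = (1 + n : ℝ) ^ r' * (K n m * c m) := fun c n m => by
    have : (1 + m : ℝ) ^ r ≠ 0 := by positivity
    field_simp
  have hs : ∀ (c : Ell2 r) (n : ℕ), Summable fun m => K n m * c m := fun c n => by
    have h1 := h.summable_mul hC c.summable_sq n
    simp_rw [e1] at h1
    exact (summable_mul_left_iff (by positivity)).1 h1
  have hb : ∀ (c : Ell2 r) (N : ℕ), ∑ n ∈ Finset.range N,
      ((1 + n : ℝ) ^ r' * ∑' m, K n m * c m) ^ 2 ≤ 4 * C ^ 2 * ‖c‖ ^ 2 := fun c N => by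
    have h1 := h.sum_tsum_sq_le hC c.summable_sq N
    simp_rw [e1, tsum_mul_left] at h1
    rwa [c.norm_sq]
  let L : Ell2 r →ₗ[ℝ] Ell2 r' :=
    { toFun := fun c => ⟨fun n => ∑' m, K n m * c m, mem_ell2Submodule_iff.2
        (summable_of_sum_range_le (fun _ => sq_nonneg _) (hb c))⟩
      map_add' := fun c d => by
        ext n
        change ∑' m, K n m * (c m + d m) = ∑' m, K n m * c m + ∑' m, K n m * d m
        rw [← (hs c n).tsum_add (hs d n)]
        exact tsum_congr fun m => mul_add _ _ _
      map_smul' := fun a c => by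
        ext n
        change ∑' m, K n m * (a * c m) = a * ∑' m, K n m * c m
        rw [← tsum_mul_left]
        exact tsum_congr fun m => mul_left_comm _ _ _ }
  refine ⟨L.mkContinuous (2 * C) fun c => ?_, fun c n => (hs c n).hasSum⟩
  refine abs_le_of_sq_le_sq' ?_ (by positivity) |>.2
  rw [Ell2.norm_sq, mul_pow, mul_pow]
  norm_num only
  exact (summable_of_sum_range_le (fun _ => sq_nonneg _) (hb c)).tsum_le_of_sum_range_le (hb c)

/-! ### The discrete Hilbert kernel `1 / (2 (n - m) + 1)` -/

/-- The kernel `1 / (2 (n - m) + 1)`. -/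
noncomputable def hilbertKernel (n m : ℕ) : ℝ := 1 / (2 * ((n : ℝ) - m) + 1)

/-- The denominator is an odd integer. -/
theorem one_le_abs_hilbertKernel_den (n m : ℕ) : 1 ≤ |2 * ((n : ℝ) - m) + 1| := by
  have h : (1 : ℤ) ≤ |2 * ((n : ℤ) - m) + 1| := Int.one_le_abs (by omega)
  exact_mod_cast h

theorem hilbertKernel_den_ne_zero (n m : ℕ) : 2 * ((n : ℝ) - m) + 1 ≠ 0 := by
  intro h
  have := one_le_abs_hilbertKernel_den n m
  rw [h, abs_zero] at this
  linarith

theorem abs_hilbertKernel_le_one (n m : ℕ) : |hilbertKernel n m| ≤ 1 := by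
  rw [hilbertKernel, abs_div, abs_one, div_le_one (by linarith [one_le_abs_hilbertKernel_den n m])]
  exact one_le_abs_hilbertKernel_den n m

theorem abs_sub_mul_hilbertKernel_le (n m : ℕ) : |(n : ℝ) - m| * |hilbertKernel n m| ≤ 1 := by
  have h1 := one_le_abs_hilbertKernel_den n m
  rw [hilbertKernel, abs_div, abs_one, mul_one_div, div_le_one (by linarith)]
  have h : |(n : ℤ) - m| ≤ |2 * ((n : ℤ) - m) + 1| := by
    rcases abs_cases ((n : ℤ) - m) with h | h <;>
      rcases abs_cases (2 * ((n : ℤ) - m) + 1) with h' | h' <;> omega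
  exact_mod_cast h

/-- A half-integer frequency does not integrate to zero over a period; this realizes the kernel as a
Fourier integral. -/
theorem integral_sin_half (n m : ℕ) :
    ∫ θ in (0 : ℝ)..(2 * Real.pi), Real.sin ((n * θ + θ / 2) - m * θ) = 4 * hilbertKernel n m := by
  have h0 := hilbertKernel_den_ne_zero n m
  have e : ∀ θ : ℝ, (n * θ + θ / 2) - m * θ = (2 * ((n : ℝ) - m) + 1) / 2 * θ := fun θ => by ring
  simp_rw [e]
  rw [intervalIntegral.integral_comp_mul_left (fun x => Real.sin x) (by simpa using h0),
    integral_sin]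
  have h1 : (2 * ((n : ℝ) - m) + 1) / 2 * (2 * Real.pi) =
      Real.pi + ((n - m : ℤ) : ℝ) * (2 * Real.pi) := by push_cast; ring
  rw [h1, Real.cos_add_int_mul_two_pi, hilbertKernel]
  simp
  field_simp
  ring

theorem integral_cos_sub (n m : ℕ) :
    ∫ θ in (0 : ℝ)..(2 * Real.pi), Real.cos ((n * θ) - m * θ) =
      if n = m then 2 * Real.pi else 0 := by
  split_ifs with h
  · simp [h]
  · have h0 : (n : ℝ) - m ≠ 0 := sub_ne_zero.2 (by exact_mod_cast h)
    simp_rw [← sub_mul]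
    rw [intervalIntegral.integral_comp_mul_left (fun x => Real.cos x) h0, integral_cos]
    have h1 : ((n : ℝ) - m) * (2 * Real.pi) = ((2 * (n - m) : ℤ) : ℝ) * Real.pi := by
      push_cast; ring
    rw [h1, Real.sin_int_mul_pi]
    simp

/-- Parseval for |∑ x_n e^(i(nθ + p(θ)))|², from which the common phase p drops out. -/
theorem integral_sq_add_sq (N : ℕ) (x : ℕ → ℝ) (p : ℝ → ℝ) :
    ∫ θ in (0 : ℝ)..(2 * Real.pi), ((∑ n ∈ Finset.range N, x n * Real.sin (n * θ + p θ)) ^ 2 +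
      (∑ n ∈ Finset.range N, x n * Real.cos (n * θ + p θ)) ^ 2) =
      2 * Real.pi * ∑ n ∈ Finset.range N, x n ^ 2 := by
  have e : ∀ θ : ℝ, (∑ n ∈ Finset.range N, x n * Real.sin (n * θ + p θ)) ^ 2 +
      (∑ n ∈ Finset.range N, x n * Real.cos (n * θ + p θ)) ^ 2 =
      ∑ n ∈ Finset.range N, ∑ m ∈ Finset.range N, x n * x m * Real.cos (n * θ - m * θ) := by
    intro θ
    rw [pow_two, pow_two, Finset.sum_mul_sum, Finset.sum_mul_sum, ← Finset.sum_add_distrib]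
    refine Finset.sum_congr rfl fun n _ => ?_
    rw [← Finset.sum_add_distrib]
    refine Finset.sum_congr rfl fun m _ => ?_
    have : (n * θ - m * θ : ℝ) = (n * θ + p θ) - (m * θ + p θ) := by ring
    rw [this, Real.cos_sub]
    ring
  simp_rw [e]
  rw [intervalIntegral.integral_finsetSum fun n _ => by
    exact Continuous.intervalIntegrable (by fun_prop) _ _, Finset.mul_sum]
  refine Finset.sum_congr rfl fun n hn => ?_
  rw [intervalIntegral.integral_finsetSum fun m _ => by
    exact Continuous.intervalIntegrable (by fun_prop) _ _]
  simp_rw [intervalIntegral.integral_const_mul, integral_cos_sub]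
  simp only [mul_ite, mul_zero, Finset.sum_ite_eq, hn, if_true]
  ring

/-- Hilbert's inequality. -/
theorem formBound_hilbertKernel : FormBound hilbertKernel (Real.pi / 4) := by
  intro N x y
  have hx := integral_sq_add_sq N x (fun θ => θ / 2)
  have hy := integral_sq_add_sq N y (fun _ => 0)
  -- The form is ¼ ∫ Im(X Ȳ) with X = ∑ x_n e^(i(n+1/2)θ) and Y = ∑ y_m e^(imθ). Then Im(X Ȳ) ≤
  -- (|X|² + |Y|²)/2 and Parseval give the constant ¼ · ½ · 2π.
  have e : ∑ n ∈ Finset.range N, ∑ m ∈ Finset.range N, hilbertKernel n m * x n * y m =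
      4⁻¹ * ∫ θ in (0 : ℝ)..(2 * Real.pi),
        ((∑ n ∈ Finset.range N, x n * Real.sin (n * θ + θ / 2)) *
          (∑ m ∈ Finset.range N, y m * Real.cos (m * θ + 0)) -
        (∑ n ∈ Finset.range N, x n * Real.cos (n * θ + θ / 2)) *
          (∑ m ∈ Finset.range N, y m * Real.sin (m * θ + 0))) := by
    have e1 : ∀ θ : ℝ, (∑ n ∈ Finset.range N, x n * Real.sin (n * θ + θ / 2)) *
          (∑ m ∈ Finset.range N, y m * Real.cos (m * θ + 0)) -
        (∑ n ∈ Finset.range N, x n * Real.cos (n * θ + θ / 2)) *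
          (∑ m ∈ Finset.range N, y m * Real.sin (m * θ + 0)) =
        ∑ n ∈ Finset.range N, ∑ m ∈ Finset.range N,
          x n * y m * Real.sin ((n * θ + θ / 2) - m * θ) := by
      intro θ
      rw [Finset.sum_mul_sum, Finset.sum_mul_sum, ← Finset.sum_sub_distrib]
      refine Finset.sum_congr rfl fun n _ => ?_
      rw [← Finset.sum_sub_distrib]
      refine Finset.sum_congr rfl fun m _ => ?_
      rw [Real.sin_sub, add_zero]
      ring
    simp_rw [e1]
    rw [intervalIntegral.integral_finsetSum fun n _ => by
      exact Continuous.intervalIntegrable (by fun_prop) _ _, Finset.mul_sum]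
    refine Finset.sum_congr rfl fun n _ => ?_
    rw [intervalIntegral.integral_finsetSum fun m _ => by
      exact Continuous.intervalIntegrable (by fun_prop) _ _, Finset.mul_sum]
    refine Finset.sum_congr rfl fun m _ => ?_
    rw [intervalIntegral.integral_const_mul, integral_sin_half]
    ring
  rw [e]
  have h := intervalIntegral.integral_mono_on (μ := volume) (a := 0) (b := 2 * Real.pi)
    (f := fun θ => (∑ n ∈ Finset.range N, x n * Real.sin (n * θ + θ / 2)) *
          (∑ m ∈ Finset.range N, y m * Real.cos (m * θ + 0)) -
        (∑ n ∈ Finset.range N, x n * Real.cos (n * θ + θ / 2)) *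
          (∑ m ∈ Finset.range N, y m * Real.sin (m * θ + 0)))
    (g := fun θ => 2⁻¹ * (((∑ n ∈ Finset.range N, x n * Real.sin (n * θ + θ / 2)) ^ 2 +
      (∑ n ∈ Finset.range N, x n * Real.cos (n * θ + θ / 2)) ^ 2) +
      ((∑ n ∈ Finset.range N, y n * Real.sin (n * θ + 0)) ^ 2 +
      (∑ n ∈ Finset.range N, y n * Real.cos (n * θ + 0)) ^ 2)))
    (by positivity) (Continuous.intervalIntegrable (by fun_prop) _ _)
    (Continuous.intervalIntegrable (by fun_prop) _ _)
    (fun θ _ => by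
      set a := ∑ n ∈ Finset.range N, x n * Real.sin (n * θ + θ / 2)
      set b := ∑ n ∈ Finset.range N, x n * Real.cos (n * θ + θ / 2)
      set c := ∑ n ∈ Finset.range N, y n * Real.sin (n * θ + 0)
      set d := ∑ n ∈ Finset.range N, y n * Real.cos (n * θ + 0)
      nlinarith [sq_nonneg (a - d), sq_nonneg (b + c)])
  rw [intervalIntegral.integral_const_mul, intervalIntegral.integral_add
    (Continuous.intervalIntegrable (by fun_prop) _ _)
    (Continuous.intervalIntegrable (by fun_prop) _ _), hx, hy] at h
  linarith

/-! ### Hilbert's inequality in the weights n^(±1/4), by a Schur test -/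

/-- `N^(1/4)`. -/
noncomputable def fourthRoot (N : ℕ) : ℝ := (N : ℝ) ^ (1 / 4 : ℝ)

theorem fourthRoot_nonneg (N : ℕ) : 0 ≤ fourthRoot N := by unfold fourthRoot; positivity

theorem fourthRoot_pos (N : ℕ) : 0 < fourthRoot (N + 1) := by
  unfold fourthRoot; positivity

theorem fourthRoot_pow (N : ℕ) : fourthRoot N ^ 4 = N := by
  rw [fourthRoot, ← Real.rpow_natCast, ← Real.rpow_mul (by positivity)]
  norm_num

theorem fourthRoot_mono {M N : ℕ} (h : M ≤ N) : fourthRoot M ≤ fourthRoot N :=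
  Real.rpow_le_rpow (by positivity) (by exact_mod_cast h) (by norm_num)

theorem fourthRoot_zero : fourthRoot 0 = 0 := by simp [fourthRoot]

/-- Discrete version of ∫ x^(-3/4) dx = 4 x^(1/4), from factoring v⁴ - w⁴ = 1. With
`fourthRoot_succ_sq_sub`, its analogue for x^(-1/2), it makes the Schur sums telescope. -/
theorem fourthRoot_succ_sub (N : ℕ) : 1 ≤ 4 * fourthRoot (N + 1) ^ 3 *
    (fourthRoot (N + 1) - fourthRoot N) := by
  have h1 := fourthRoot_pow N
  have h2 := fourthRoot_pow (N + 1)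
  have h3 := fourthRoot_mono (Nat.le_succ N)
  have h4 := fourthRoot_nonneg N
  push_cast at h2
  set v := fourthRoot (N + 1)
  set w := fourthRoot N
  have h5 : 1 = (v - w) * ((v + w) * (v ^ 2 + w ^ 2)) := by linear_combination h1 - h2
  have h6 : (v + w) * (v ^ 2 + w ^ 2) ≤ (2 * v) * (2 * v ^ 2) := by
    gcongr <;> nlinarith
  nlinarith [mul_le_mul_of_nonneg_left h6 (sub_nonneg.2 h3)]

theorem fourthRoot_succ_sq_sub (N : ℕ) : 1 ≤ 2 * fourthRoot (N + 1) ^ 2 *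
    (fourthRoot (N + 1) ^ 2 - fourthRoot N ^ 2) := by
  have h1 := fourthRoot_pow N
  have h2 := fourthRoot_pow (N + 1)
  have h3 := fourthRoot_mono (Nat.le_succ N)
  have h4 := fourthRoot_nonneg N
  push_cast at h2
  set v := fourthRoot (N + 1)
  set w := fourthRoot N
  have h7 : w ^ 2 ≤ v ^ 2 := by gcongr
  nlinarith

theorem sum_schur_row (N n : ℕ) : ∑ m ∈ Finset.range N, fourthRoot (n + 1) /
    (fourthRoot (m + 1) ^ 2 * max (fourthRoot (n + 1)) (fourthRoot (m + 1)) ^ 3) ≤ 6 := by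
  set u := fourthRoot (n + 1) with hu
  have hu0 : 0 < u := fourthRoot_pos n
  -- The two regimes correspond to the max being u or the summation variable. At N = n+1 both bounds
  -- equal 2, and the tail adds at most 4.
  have key : ∀ N, ∑ m ∈ Finset.range N, u /
      (fourthRoot (m + 1) ^ 2 * max u (fourthRoot (m + 1)) ^ 3) ≤
      if N ≤ n + 1 then 2 * fourthRoot N ^ 2 / u ^ 2 else 6 - 4 * u / fourthRoot N := by
    intro N
    induction N with
    | zero => simp [fourthRoot_zero]
    | succ N ih =>
      rw [Finset.sum_range_succ]
      have hv : 0 < fourthRoot (N + 1) := fourthRoot_pos N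
      by_cases hN : N + 1 ≤ n + 1
      · rw [if_pos (by omega)] at ih
        rw [if_pos hN, max_eq_left (fourthRoot_mono hN)]
        have h1 := fourthRoot_succ_sq_sub N
        have h2 : u / (fourthRoot (N + 1) ^ 2 * u ^ 3) ≤
            2 * fourthRoot (N + 1) ^ 2 / u ^ 2 - 2 * fourthRoot N ^ 2 / u ^ 2 := by
          rw [← sub_div, div_le_div_iff₀ (by positivity) (by positivity)]
          nlinarith [mul_le_mul_of_nonneg_left h1 (by positivity : 0 ≤ u ^ 3)]
        linarith
      · have hw : u ≤ fourthRoot N := fourthRoot_mono (by omega)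
        have hw0 : 0 < fourthRoot N := hu0.trans_le hw
        have hwv := fourthRoot_mono (Nat.le_succ N)
        rw [if_neg hN, max_eq_right (hw.trans hwv)]
        have ih' : ∑ m ∈ Finset.range N, u /
            (fourthRoot (m + 1) ^ 2 * max u (fourthRoot (m + 1)) ^ 3) ≤
            6 - 4 * u / fourthRoot N := by
          split_ifs at ih with hN'
          · have : N = n + 1 := by omega
            rw [this, ← hu] at ih ⊢
            refine ih.trans (le_of_eq ?_)
            field_simp
            norm_num
          · exact ih
        have h1 := fourthRoot_succ_sub N
        have h2 : u / (fourthRoot (N + 1) ^ 2 * fourthRoot (N + 1) ^ 3) ≤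
            4 * u / fourthRoot N - 4 * u / fourthRoot (N + 1) := by
          rw [div_sub_div _ _ hw0.ne' hv.ne', div_le_div_iff₀ (by positivity) (by positivity)]
          have h3 : fourthRoot N * fourthRoot (N + 1) ≤ fourthRoot (N + 1) ^ 2 := by nlinarith
          have h4 := mul_le_mul_of_nonneg_left h1
            (by positivity : 0 ≤ u * fourthRoot (N + 1) ^ 2)
          nlinarith [mul_le_mul_of_nonneg_left h3 hu0.le]
        linarith
  refine (key N).trans ?_
  split_ifs with h
  · have h1 := fourthRoot_mono h
    rw [div_le_iff₀ (by positivity)]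
    nlinarith [fourthRoot_nonneg N]
  · have : 0 ≤ 4 * u / fourthRoot N := div_nonneg (by positivity) (fourthRoot_nonneg N)
    linarith

theorem sum_schur_col (N m : ℕ) : ∑ n ∈ Finset.range N, fourthRoot (m + 1) ^ 2 /
    (fourthRoot (n + 1) ^ 3 * max (fourthRoot (n + 1)) (fourthRoot (m + 1)) ^ 3) ≤ 6 := by
  set u := fourthRoot (m + 1) with hu
  have hu0 : 0 < u := fourthRoot_pos m
  -- At N = m+1 both bounds equal 4; the tail adds at most 2.
  have key : ∀ N, ∑ n ∈ Finset.range N, u ^ 2 /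
      (fourthRoot (n + 1) ^ 3 * max (fourthRoot (n + 1)) u ^ 3) ≤
      if N ≤ m + 1 then 4 * fourthRoot N / u else 6 - 2 * u ^ 2 / fourthRoot N ^ 2 := by
    intro N
    induction N with
    | zero => simp [fourthRoot_zero]
    | succ N ih =>
      rw [Finset.sum_range_succ]
      have hv : 0 < fourthRoot (N + 1) := fourthRoot_pos N
      by_cases hN : N + 1 ≤ m + 1
      · rw [if_pos (by omega)] at ih
        rw [if_pos hN, max_eq_right (fourthRoot_mono hN)]
        have h1 := fourthRoot_succ_sub N
        have h2 : u ^ 2 / (fourthRoot (N + 1) ^ 3 * u ^ 3) ≤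
            4 * fourthRoot (N + 1) / u - 4 * fourthRoot N / u := by
          rw [← sub_div, div_le_div_iff₀ (by positivity) (by positivity)]
          nlinarith [mul_le_mul_of_nonneg_left h1 (by positivity : 0 ≤ u ^ 3)]
        linarith
      · have hw : u ≤ fourthRoot N := fourthRoot_mono (by omega)
        have hw0 : 0 < fourthRoot N := hu0.trans_le hw
        have hwv := fourthRoot_mono (Nat.le_succ N)
        rw [if_neg hN, max_eq_left (hw.trans hwv)]
        have ih' : ∑ n ∈ Finset.range N, u ^ 2 /
            (fourthRoot (n + 1) ^ 3 * max (fourthRoot (n + 1)) u ^ 3) ≤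
            6 - 2 * u ^ 2 / fourthRoot N ^ 2 := by
          split_ifs at ih with hN'
          · have : N = m + 1 := by omega
            rw [this, ← hu] at ih ⊢
            refine ih.trans (le_of_eq ?_)
            field_simp
            norm_num
          · exact ih
        have h1 := fourthRoot_succ_sq_sub N
        have h2 : u ^ 2 / (fourthRoot (N + 1) ^ 3 * fourthRoot (N + 1) ^ 3) ≤
            2 * u ^ 2 / fourthRoot N ^ 2 - 2 * u ^ 2 / fourthRoot (N + 1) ^ 2 := by
          rw [div_sub_div _ _ (by positivity) (by positivity),
            div_le_div_iff₀ (by positivity) (by positivity)]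
          have h3 : fourthRoot N ^ 2 ≤ fourthRoot (N + 1) ^ 2 := by gcongr
          have h4 := mul_le_mul_of_nonneg_left h1
            (by positivity : 0 ≤ u ^ 2 * fourthRoot (N + 1) ^ 4)
          nlinarith [mul_le_mul_of_nonneg_left h3
            (by positivity : 0 ≤ u ^ 2 * fourthRoot (N + 1) ^ 2)]
        linarith
  refine (key N).trans ?_
  split_ifs with h
  · have h1 := fourthRoot_mono h
    rw [div_le_iff₀ (by positivity)]
    nlinarith [fourthRoot_nonneg N]
  · have : 0 ≤ 2 * u ^ 2 / fourthRoot N ^ 2 := by positivity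
    linarith

/-- The difference v - u of fourth roots is at most |n - m| / max(u,v)³, and |n - m| cancels the
kernel's singularity. Commuting the weight past the kernel thus leaves a matrix to which an absolute
Schur test applies. -/
theorem abs_weighted_sub_hilbertKernel_le (n m : ℕ) :
    |fourthRoot (m + 1) / fourthRoot (n + 1) * hilbertKernel n m - hilbertKernel n m| ≤
      1 / (fourthRoot (n + 1) * max (fourthRoot (n + 1)) (fourthRoot (m + 1)) ^ 3) := by
  have hu : 0 < fourthRoot (n + 1) := fourthRoot_pos n
  have hv : 0 < fourthRoot (m + 1) := fourthRoot_pos m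
  have h1 := fourthRoot_pow (n + 1)
  have h2 := fourthRoot_pow (m + 1)
  push_cast at h1 h2
  set u := fourthRoot (n + 1)
  set v := fourthRoot (m + 1)
  have h3 : |v - u| * max u v ^ 3 ≤ |(n : ℝ) - m| := by
    have e : (n : ℝ) - m = -(v - u) * ((v + u) * (v ^ 2 + u ^ 2)) := by linear_combination h2 - h1
    rw [e, abs_mul, abs_neg]
    refine mul_le_mul_of_nonneg_left ?_ (abs_nonneg _)
    rw [abs_of_pos (by positivity)]
    rcases max_cases u v with h | h <;> rw [h.1]
    · nlinarith [mul_pos hu hv, pow_pos hu 3, pow_pos hv 3, mul_pos (pow_pos hu 2) hv,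
        mul_pos (pow_pos hv 2) hu]
    · nlinarith [mul_pos hu hv, pow_pos hu 3, pow_pos hv 3, mul_pos (pow_pos hu 2) hv,
        mul_pos (pow_pos hv 2) hu]
  have e2 : v / u * hilbertKernel n m - hilbertKernel n m = (v - u) * hilbertKernel n m / u := by
    field_simp
  have hm : 0 < max u v := lt_max_of_lt_left hu
  rw [e2, abs_div, abs_of_pos hu, abs_mul, div_le_div_iff₀ hu (by positivity)]
  have h4 := abs_sub_mul_hilbertKernel_le n m
  have h5 := mul_le_mul_of_nonneg_right h3 (abs_nonneg (hilbertKernel n m))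
  nlinarith

theorem formBound_weighted_hilbertKernel :
    FormBound (fun n m => fourthRoot (m + 1) / fourthRoot (n + 1) * hilbertKernel n m) 7 := by
  have h : FormBound (fun n m => fourthRoot (m + 1) / fourthRoot (n + 1) * hilbertKernel n m -
      hilbertKernel n m) (3 + 3) := by
    refine formBound_of_split
      (a := fun n m => 2⁻¹ * (fourthRoot (n + 1) /
        (fourthRoot (m + 1) ^ 2 * max (fourthRoot (n + 1)) (fourthRoot (m + 1)) ^ 3)))
      (b := fun n m => 2⁻¹ * (fourthRoot (m + 1) ^ 2 /
        (fourthRoot (n + 1) ^ 3 * max (fourthRoot (n + 1)) (fourthRoot (m + 1)) ^ 3)))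
      (by norm_num) (by norm_num) (fun n m x y => ?_) (fun N n => ?_) (fun N m => ?_)
    · have h1 := abs_weighted_sub_hilbertKernel_le n m
      have hu : 0 < fourthRoot (n + 1) := fourthRoot_pos n
      have hv : 0 < fourthRoot (m + 1) := fourthRoot_pos m
      set u := fourthRoot (n + 1)
      set v := fourthRoot (m + 1)
      set D := v / u * hilbertKernel n m - hilbertKernel n m
      have hm : 0 < max u v := lt_max_of_lt_left hu
      have h2 : D * x * y ≤ 1 / (u * max u v ^ 3) * (|x| * |y|) := by
        rw [mul_assoc]
        refine (le_abs_self _).trans ?_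
        rw [abs_mul, abs_mul]
        exact mul_le_mul_of_nonneg_right h1 (by positivity)
      refine h2.trans ?_
      -- The Schur weights are those of Young's inequality for u/v · |x| and v/u · |y|; their
      -- product restores |x||y|.
      have h3 : 2⁻¹ * (u / (v ^ 2 * max u v ^ 3)) * x ^ 2 +
          2⁻¹ * (v ^ 2 / (u ^ 3 * max u v ^ 3)) * y ^ 2 - 1 / (u * max u v ^ 3) * (|x| * |y|) =
          (2 * u * max u v ^ 3)⁻¹ * (u / v * |x| - v / u * |y|) ^ 2 := by
        rw [← sq_abs x, ← sq_abs y]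
        field_simp
        ring
      have h4 : 0 ≤ (2 * u * max u v ^ 3)⁻¹ * (u / v * |x| - v / u * |y|) ^ 2 := by positivity
      linarith
    · rw [← Finset.mul_sum]
      linarith [sum_schur_row N n]
    · rw [← Finset.mul_sum]
      linarith [sum_schur_col N m]
  -- The constant is 6 from the Schur test plus π/4 from the unweighted inequality.
  have h1 := (h.add formBound_hilbertKernel).mono_const
    (D := 7) (by linarith [Real.pi_lt_d2])
  simpa using h1

theorem fourthRoot_succ (n : ℕ) : fourthRoot (n + 1) = (1 + n : ℝ) ^ (1 / 4 : ℝ) := by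
  rw [fourthRoot, add_comm]; push_cast; rfl

theorem exists_hilbert_clm : ∃ T : Ell2 (-1 / 4) →L[ℝ] Ell2 (-1 / 4),
    ∀ c n, HasSum (fun m => hilbertKernel n m * c m) (T c n) := by
  refine Ell2.exists_clm (C := 7) (by norm_num) ?_
  have h := formBound_weighted_hilbertKernel
  have e : ∀ n : ℕ, (1 + n : ℝ) ^ (-1 / 4 : ℝ) = (fourthRoot (n + 1))⁻¹ := fun n => by
    rw [fourthRoot_succ, ← Real.rpow_neg (by positivity)]; norm_num
  simp_rw [e]
  convert h using 3
  field_simp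

theorem exists_hilbert_transpose_clm : ∃ T : Ell2 (1 / 4) →L[ℝ] Ell2 (1 / 4),
    ∀ c n, HasSum (fun m => hilbertKernel m n * c m) (T c n) := by
  refine Ell2.exists_clm (K := fun n m => hilbertKernel m n) (C := 7) (by norm_num) ?_
  have h := formBound_weighted_hilbertKernel.transpose
  simp_rw [← fourthRoot_succ]
  convert h using 3
  field_simp

/-! ### Sums of `E_n` against the Hilbert kernel -/

/-- Comparison with E_n/(1-2n), the absolutely summable coefficients of √(1-z). -/
theorem summable_coeffE_mul_hilbertKernel (m : ℕ) :
    Summable fun n => coeffE n * hilbertKernel n m := by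
  refine Summable.of_norm_bounded (summable_abs_sqrtCoeff.mul_left (1 + |1 - 2 * (m : ℝ) + 1|))
    fun n => ?_
  have h1 := one_sub_two_mul_ne_zero n
  have e : coeffE n * hilbertKernel n m =
      sqrtCoeff n * (-1 + (1 - 2 * (m : ℝ) + 1) * hilbertKernel n m) := by
    have h2 := hilbertKernel_den_ne_zero n m
    rw [sqrtCoeff, hilbertKernel]
    field_simp
    ring
  rw [e, Real.norm_eq_abs, abs_mul, mul_comm]
  refine mul_le_mul_of_nonneg_right ?_ (abs_nonneg _)
  refine (abs_add_le _ _).trans ?_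
  rw [abs_neg, abs_one, abs_mul]
  have := mul_le_mul_of_nonneg_left (abs_hilbertKernel_le_one n m)
    (abs_nonneg (1 - 2 * (m : ℝ) + 1))
  linarith

/-- Writing s_m = ∑ E_n κ(n,m), a telescoping series gives (2m+1) s_{m+1} = 2m s_m, so s_m = 0 for m
≥ 1. The sum s_0 has positive terms; the factor m hides it and makes the induction start trivially.
-/
theorem hasSum_coeffE_mul_hilbertKernel (m : ℕ) :
    HasSum (fun n => m * (coeffE n * hilbertKernel n m)) 0 := by
  induction m with
  | zero => simp [hasSum_zero]
  | succ m ih =>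
    have hs := summable_coeffE_mul_hilbertKernel (m + 1)
    -- The primitive is chosen so that t 0 = 0, since κ(0, m+1) = -1/(2m+1), while t tends to 0 at
    -- infinity.
    set t : ℕ → ℝ := fun n =>
      coeffE n + (2 * m + 1) * (coeffE n * hilbertKernel n (m + 1)) with ht
    have h1 : ∀ n, t (n + 1) - t n = 2 * (m * (coeffE n * hilbertKernel n m)) -
        (2 * m + 1) * (coeffE n * hilbertKernel n (m + 1)) := fun n => by
      have h2 := hilbertKernel_den_ne_zero n m
      have h3 := hilbertKernel_den_ne_zero n (m + 1)
      have h4 := hilbertKernel_den_ne_zero (n + 1) (m + 1)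
      simp only [ht]
      have e2 : hilbertKernel (n + 1) (m + 1) = hilbertKernel n m := by
        simp only [hilbertKernel]; push_cast; congr 3; ring
      rw [coeffE_succ, e2, hilbertKernel, hilbertKernel]
      push_cast at h3 ⊢
      have h5 : (2 * n + 2 : ℝ) ≠ 0 := by positivity
      have h6 : (2 * (n : ℝ) - 2 * m + 1) ≠ 0 := by convert h2 using 1; ring
      have h7 : (2 * (n : ℝ) - 2 * m - 1) ≠ 0 := by convert h3 using 1; ring
      rw [show 2 * ((n : ℝ) - m) + 1 = 2 * (n : ℝ) - 2 * m + 1 by ring,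
        show 2 * ((n : ℝ) - (m + 1)) + 1 = 2 * (n : ℝ) - 2 * m - 1 by ring]
      field_simp
      ring
    have h2 : HasSum (fun n => t (n + 1) - t n) (0 - (2 * m + 1) *
        ∑' n, coeffE n * hilbertKernel n (m + 1)) := by
      simp_rw [h1]
      simpa using (ih.mul_left 2).sub (hs.hasSum.mul_left (2 * m + 1 : ℝ))
    have h3 : Filter.Tendsto t Filter.atTop (nhds 0) := by
      simpa using tendsto_coeffE.add (hs.tendsto_atTop_zero.const_mul (2 * m + 1 : ℝ))
    have h4 : t 0 = 0 := by
      have h8 := hilbertKernel_den_ne_zero 0 (m + 1)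
      simp only [ht, coeffE_zero, hilbertKernel]
      push_cast at h8 ⊢
      have h5 : (-(2 * m) - 1 : ℝ) ≠ 0 := by convert h8 using 1; ring
      rw [show 2 * ((0 : ℝ) - (m + 1)) + 1 = -(2 * m) - 1 by ring]
      field_simp
      ring
    have h5 := h2.tendsto_sum_nat
    simp_rw [Finset.sum_range_sub t, h4, sub_zero] at h5
    have h6 := tendsto_nhds_unique h5 h3
    have h7 : ∑' n, coeffE n * hilbertKernel n (m + 1) = 0 := by
      have : (2 * m + 1 : ℝ) ≠ 0 := by positivity
      have h8 : (2 * m + 1 : ℝ) * ∑' n, coeffE n * hilbertKernel n (m + 1) = 0 := by linarith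
      exact (mul_eq_zero.1 h8).resolve_left this
    have h8 := hs.hasSum.mul_left (((m + 1 : ℕ) : ℝ))
    rwa [h7, mul_zero] at h8

/-- The antisymmetry κ(j,k) = -κ(k, j+1) turns rows into columns of index j+1 ≥ 1, so there is no
exceptional row. -/
theorem hasSum_coeffE_mul_hilbertKernel_left (j : ℕ) :
    HasSum (fun k => coeffE k * hilbertKernel j k) 0 := by
  have h := (hasSum_coeffE_mul_hilbertKernel (j + 1)).mul_left (-((j + 1 : ℕ) : ℝ)⁻¹)
  rw [mul_zero] at h
  refine h.congr_fun fun k => ?_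
  have h0 : ((j + 1 : ℕ) : ℝ) ≠ 0 := by positivity
  have e : hilbertKernel k (j + 1) = - hilbertKernel j k := by
    rw [hilbertKernel, hilbertKernel, ← div_neg]
    push_cast
    congr 1
    ring
  rw [e]
  field_simp

/-- The rows of the kernel are almost orthogonal with respect to the weight `E_k`. -/
theorem hasSum_coeffE_mul_hilbertKernel_mul {n j : ℕ} (h : n ≠ j) :
    HasSum (fun k => coeffE k * (hilbertKernel j k * hilbertKernel n k)) 0 := by
  -- Partial fractions: κ(j,k) κ(n,k) = (κ(j,k) - κ(n,k)) / (2(n-j)).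
  have h1 := ((hasSum_coeffE_mul_hilbertKernel_left j).sub
    (hasSum_coeffE_mul_hilbertKernel_left n)).mul_left ((2 * ((n : ℝ) - j))⁻¹)
  rw [sub_zero, mul_zero] at h1
  refine h1.congr_fun fun k => ?_
  have h2 := hilbertKernel_den_ne_zero n k
  have h3 := hilbertKernel_den_ne_zero j k
  have h4 : (n : ℝ) - j ≠ 0 := sub_ne_zero.2 (by exact_mod_cast h)
  rw [hilbertKernel, hilbertKernel]
  field_simp
  ring

theorem summable_coeffE_mul_hilbertKernel_sq (j : ℕ) :
    Summable fun k => coeffE k * hilbertKernel j k ^ 2 := by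
  refine Summable.of_norm_bounded (hasSum_coeffE_mul_hilbertKernel_left j).summable.abs fun k => ?_
  rw [pow_two, ← mul_assoc, norm_mul, Real.norm_eq_abs, Real.norm_eq_abs]
  exact mul_le_of_le_one_right (abs_nonneg _) (abs_hilbertKernel_le_one j k)

/-- The columns of the kernel are almost orthogonal with respect to the weight `(2n + 1) E_n`. -/
theorem hasSum_weight_mul_hilbertKernel_mul {k m : ℕ} (h : k ≠ m) :
    HasSum (fun n => (2 * n + 1) * coeffE n * (hilbertKernel n k * hilbertKernel n m)) 0 := by
  -- Partial fractions in the form (2n+1) κ(n,k) κ(n,m) = (k κ(n,k) - m κ(n,m)) / (k-m). The factors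
  -- k and m are those carried by the vanishing sums, so index 0 is allowed.
  have h1 := ((hasSum_coeffE_mul_hilbertKernel k).sub
    (hasSum_coeffE_mul_hilbertKernel m)).mul_left (((k : ℝ) - m)⁻¹)
  rw [sub_zero, mul_zero] at h1
  refine h1.congr_fun fun n => ?_
  have h2 := hilbertKernel_den_ne_zero n k
  have h3 := hilbertKernel_den_ne_zero n m
  have h4 : (k : ℝ) - m ≠ 0 := sub_ne_zero.2 (by exact_mod_cast h)
  rw [hilbertKernel, hilbertKernel]
  field_simp
  ring

/-! ### Diagonal operators -/

theorem Ell2.exists_diagonal {r r' : ℝ} {d : ℕ → ℝ} {B : ℝ}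
    (h : ∀ n : ℕ, (1 + n : ℝ) ^ r' * |d n| ≤ B * (1 + n : ℝ) ^ r) :
    ∃ T : Ell2 r →L[ℝ] Ell2 r', ∀ c n, T c n = d n * c n := by
  have hm : ∀ c : Ell2 r, (fun n => d n * c n) ∈ ell2Submodule r' := fun c => by
    refine mem_ell2Submodule_iff.2 ?_
    refine Summable.of_nonneg_of_le (fun _ => sq_nonneg _) (fun n => ?_)
      (c.summable_sq.mul_left (B ^ 2))
    have h1 := pow_le_pow_left₀ (by positivity) (h n) 2
    calc ((1 + n : ℝ) ^ r' * (d n * c n)) ^ 2 = ((1 + n : ℝ) ^ r' * |d n|) ^ 2 * c n ^ 2 := by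
          rw [mul_pow, mul_pow, mul_pow, sq_abs]; ring
      _ ≤ (B * (1 + n : ℝ) ^ r) ^ 2 * c n ^ 2 := mul_le_mul_of_nonneg_right h1 (sq_nonneg _)
      _ = B ^ 2 * ((1 + n : ℝ) ^ r * c n) ^ 2 := by ring
  let L : Ell2 r →ₗ[ℝ] Ell2 r' :=
    { toFun := fun c => ⟨_, hm c⟩
      map_add' := fun c e => Ell2.ext fun n => mul_add _ _ _
      map_smul' := fun a c => Ell2.ext fun n => mul_left_comm _ _ _ }
  exact ⟨⟨L, Ell2.continuous_of_apply L fun n => (Ell2.continuous_apply n).const_mul (d n)⟩,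
    fun c n => rfl⟩

/-- The coordinate functional. -/
noncomputable def Ell2.coord (r : ℝ) (n : ℕ) : Ell2 r →L[ℝ] ℝ where
  toFun c := c n
  map_add' _ _ := rfl
  map_smul' _ _ := rfl
  cont := Ell2.continuous_apply n

theorem Ell2.coord_apply {r : ℝ} (n : ℕ) (c : Ell2 r) : Ell2.coord r n c = c n := rfl

theorem hasSum_mul_single {r : ℝ} (K : ℕ → ℝ) (j : ℕ) :
    HasSum (fun m => K m * Ell2.single r j m) (K j) := by
  have h := hasSum_ite_eq j (K j)
  refine h.congr_fun fun m => ?_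
  rw [Ell2.single_apply]
  split_ifs with hm
  · rw [hm, mul_one]
  · rw [mul_zero]

theorem summable_one_add_rpow {r : ℝ} (hr : 1 / 2 < r) :
    Summable fun m : ℕ => (1 / (1 + m : ℝ) ^ r) ^ 2 := by
  have h := (summable_nat_add_iff 1).2 (Real.summable_one_div_nat_rpow.2 (by linarith : 1 < 2 * r))
  refine h.congr fun m => ?_
  rw [div_pow, one_pow, ← one_add_rpow_sq]
  push_cast
  rw [add_comm]

theorem Ell2.exists_sum {r : ℝ} (hr : 1 / 2 < r) :
    ∃ T : Ell2 r →L[ℝ] ℝ, ∀ c, HasSum (fun m => c m) (T c) := by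
  obtain ⟨T, hT⟩ := Ell2.exists_functional (ρ := fun _ => 1) (summable_one_add_rpow hr)
  exact ⟨T, fun c => by simpa using hT c⟩

theorem Ell2.summable_abs {r : ℝ} (hr : 1 / 2 < r) (c : Ell2 r) : Summable fun m => |c m| := by
  obtain ⟨T, hT⟩ := Ell2.exists_sum hr
  exact (hT c).summable.abs

/-! ### Inversion of the Hilbert matrix -/

/-- The identity κ(n,m) - κ(n,0) = (2/(2n+1)) κ(n,m) m factors the matrix through ℓ²_{-1/4}, where
the Hilbert matrix is bounded. The subtraction is essential: κ(n,0) is not in ℓ²_{3/4} as a sequence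
in n. -/
theorem exists_reduced_hilbert : ∃ T : Ell2 (3 / 4) →L[ℝ] Ell2 (3 / 4),
    ∀ c n, HasSum (fun m => (hilbertKernel n m - hilbertKernel n 0) * c m) (T c n) := by
  obtain ⟨H, hH⟩ := exists_hilbert_clm
  obtain ⟨D, hD⟩ := Ell2.exists_diagonal (r := 3 / 4) (r' := -1 / 4) (d := fun n => n) (B := 1)
    fun n => by
      have h : (1 + n : ℝ) ^ (3 / 4 : ℝ) = (1 + n : ℝ) ^ (-1 / 4 : ℝ) * (1 + n) := by
        rw [← Real.rpow_add_one (by positivity)]; norm_num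
      rw [h, one_mul, abs_of_nonneg (by positivity)]
      exact mul_le_mul_of_nonneg_left (by linarith) (by positivity)
  obtain ⟨D', hD'⟩ := Ell2.exists_diagonal (r := -1 / 4) (r' := 3 / 4)
    (d := fun n => 2 / (2 * n + 1)) (B := 2) fun n => by
      have h : (1 + n : ℝ) ^ (3 / 4 : ℝ) = (1 + n : ℝ) ^ (-1 / 4 : ℝ) * (1 + n) := by
        rw [← Real.rpow_add_one (by positivity)]; norm_num
      rw [h, abs_of_nonneg (by positivity), mul_assoc, mul_comm]
      refine mul_le_mul_of_nonneg_right ?_ (by positivity)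
      rw [mul_div_assoc', div_le_iff₀ (by positivity)]
      nlinarith [(Nat.cast_nonneg n : (0 : ℝ) ≤ n)]
  refine ⟨D'.comp (H.comp D), fun c n => ?_⟩
  have h1 := (hH (D c) n).mul_left (2 / (2 * n + 1) : ℝ)
  rw [ContinuousLinearMap.comp_apply, ContinuousLinearMap.comp_apply, hD']
  refine h1.congr_fun fun m => ?_
  rw [hD, hilbertKernel, hilbertKernel]
  have h2 := hilbertKernel_den_ne_zero n m
  have h3 : (2 * n + 1 : ℝ) ≠ 0 := by positivity
  simp only [Nat.cast_zero, sub_zero]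
  field_simp
  ring

theorem coeffE_le_inv_sqrt (n : ℕ) : coeffE n ≤ ((1 + n : ℝ) ^ (1 / 2 : ℝ))⁻¹ := by
  have h := coeffE_sq_mul_le n
  rw [← Real.sqrt_eq_rpow, ← Real.sqrt_inv]
  refine Real.le_sqrt_of_sq_le ?_
  rw [← one_div, le_div_iff₀ (by positivity)]
  nlinarith [mul_nonneg (sq_nonneg (coeffE n)) (Nat.cast_nonneg n : (0 : ℝ) ≤ n)]

/-- Candidate for the inverse of the reduced matrix, up to a diagonal factor: the transposed kernel
between orthogonality weights. As E_n has order n^(-1/2), the weights lead from ℓ²_{3/4} to ℓ²_{1/4}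
and back. -/
theorem exists_hilbert_inverse : ∃ T : Ell2 (3 / 4) →L[ℝ] Ell2 (3 / 4),
    ∀ c k, HasSum (fun n => coeffE k * (hilbertKernel n k * ((2 * n + 1) * coeffE n * c n)))
      (T c k) := by
  obtain ⟨H, hH⟩ := exists_hilbert_transpose_clm
  obtain ⟨D, hD⟩ := Ell2.exists_diagonal (r := 3 / 4) (r' := 1 / 4)
    (d := fun n => (2 * n + 1) * coeffE n) (B := 2) fun n => by
      have h : (1 + n : ℝ) ^ (3 / 4 : ℝ) = (1 + n : ℝ) ^ (1 / 4 : ℝ) * (1 + n : ℝ) ^ (1 / 2 : ℝ) := by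
        rw [← Real.rpow_add (by positivity)]; norm_num
      have h' : (1 + n : ℝ) = (1 + n : ℝ) ^ (1 / 2 : ℝ) * (1 + n : ℝ) ^ (1 / 2 : ℝ) := by
        rw [← Real.rpow_add (by positivity)]; norm_num
      have h2 := coeffE_le_inv_sqrt n
      have hp : 0 < (1 + n : ℝ) ^ (1 / 2 : ℝ) := by positivity
      have hnn : 0 ≤ (2 * n + 1) * coeffE n := mul_nonneg (by positivity) (coeffE_pos n).le
      rw [h, abs_of_nonneg hnn, mul_left_comm 2]
      refine mul_le_mul_of_nonneg_left ?_ (by positivity)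
      refine (mul_le_mul_of_nonneg_left h2 (by positivity)).trans ?_
      rw [← div_eq_mul_inv, div_le_iff₀ hp, mul_assoc, ← h']
      linarith
  obtain ⟨D', hD'⟩ := Ell2.exists_diagonal (r := 1 / 4) (r' := 3 / 4)
    (d := coeffE) (B := 1) fun n => by
      have h : (1 + n : ℝ) ^ (3 / 4 : ℝ) = (1 + n : ℝ) ^ (1 / 4 : ℝ) * (1 + n : ℝ) ^ (1 / 2 : ℝ) := by
        rw [← Real.rpow_add (by positivity)]; norm_num
      have h2 := coeffE_le_inv_sqrt n
      have hp : 0 < (1 + n : ℝ) ^ (1 / 2 : ℝ) := by positivity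
      rw [h, abs_of_pos (coeffE_pos n), mul_assoc, one_mul]
      refine mul_le_of_le_one_right (by positivity) ?_
      refine (mul_le_mul_of_nonneg_left h2 hp.le).trans ?_
      rw [mul_inv_cancel₀ hp.ne']
  refine ⟨D'.comp (H.comp D), fun c k => ?_⟩
  rw [ContinuousLinearMap.comp_apply, ContinuousLinearMap.comp_apply, hD']
  refine ((hH (D c) k).mul_left (coeffE k)).congr_fun fun n => ?_
  rw [hD]

/-- The map `g ↦ (∑ g_m, {∑_m g_m (κ(n - m) - κ(n))}_n)` is a bijection of `ℓ²_{3/4}` onto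
`ℝ × ℓ²_{3/4}`; here `κ(n) = 1 / (2n + 1)`. -/
theorem exists_hilbert_equiv : ∃ T : Ell2 (3 / 4) →L[ℝ] ℝ × Ell2 (3 / 4),
    Function.Bijective T ∧ (∀ c, HasSum (fun m => c m) (T c).1) ∧
    ∀ c n, HasSum (fun m => (hilbertKernel n m - hilbertKernel n 0) * c m) ((T c).2 n) := by
  obtain ⟨S, hS⟩ := Ell2.exists_sum (r := 3 / 4) (by norm_num)
  obtain ⟨M, hM⟩ := exists_reduced_hilbert
  obtain ⟨N, hN⟩ := exists_hilbert_inverse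
  -- Squared norm of the j-th row. Its diagonal term already gives τ_j ≥ E_j, so the diagonal
  -- entries (2j+1) E_j τ_j stay above 1/2 and can be inverted boundedly.
  set τ : ℕ → ℝ := fun j => ∑' k, coeffE k * hilbertKernel j k ^ 2 with hτ
  have hτ1 : ∀ j, coeffE j ≤ τ j := fun j => by
    have h := (summable_coeffE_mul_hilbertKernel_sq j).le_tsum j
      fun k _ => mul_nonneg (coeffE_pos k).le (sq_nonneg _)
    have h1 : hilbertKernel j j = 1 := by simp [hilbertKernel]
    rwa [h1, one_pow, mul_one] at h
  have hNe : ∀ j k, N (Ell2.single _ j) k = (2 * j + 1) * coeffE j * (coeffE k * hilbertKernel j k) :=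
    fun j k => by
      have h := hasSum_mul_single (r := 3 / 4)
        (fun n => coeffE k * hilbertKernel n k * ((2 * n + 1) * coeffE n)) j
      refine (hN (Ell2.single _ j) k).unique ?_
      convert h using 1
      · funext n; ring
      · ring
  have hMe : ∀ m n, M (Ell2.single _ m) n = hilbertKernel n m - hilbertKernel n 0 := fun m n =>
    (hM _ n).unique (hasSum_mul_single (fun m => hilbertKernel n m - hilbertKernel n 0) m)
  -- The range of N lies in the sequences of sum zero, by the vanishing row sums.
  have hSN : S.comp N = 0 := Ell2.clm_ext fun j => by
    have h := (hasSum_coeffE_mul_hilbertKernel_left j).mul_left ((2 * j + 1) * coeffE j)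
    rw [mul_zero] at h
    refine (hS (N (Ell2.single _ j))).unique (h.congr_fun fun k => hNe j k)
  obtain ⟨D, hD⟩ := Ell2.exists_diagonal (r := 3 / 4) (r' := 3 / 4)
    (d := fun n => ((2 * n + 1) * coeffE n * τ n)⁻¹) (B := 2) fun n => by
      rw [mul_comm]
      refine mul_le_mul_of_nonneg_right ?_ (by positivity)
      have h1 := one_le_coeffE_sq_mul n
      have h2 := mul_le_mul_of_nonneg_left (hτ1 n) (coeffE_pos n).le
      have h3 : (0 : ℝ) ≤ n := Nat.cast_nonneg n
      have h4 : 1 / 2 ≤ (2 * n + 1) * coeffE n * τ n := by nlinarith [sq_nonneg (coeffE n)]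
      rw [abs_of_pos (by positivity)]
      refine (inv_anti₀ (by norm_num) h4).trans (by norm_num)
  -- Row orthogonality makes M N diagonal, and D inverts that diagonal. The subtracted κ(n,0)
  -- contributes nothing because the row sums vanish.
  have hMND : M.comp (N.comp D) = ContinuousLinearMap.id ℝ _ := Ell2.clm_ext fun j => by
    ext n
    have hcj : (2 * j + 1) * coeffE j * τ j ≠ 0 :=
      (mul_pos (mul_pos (by positivity) (coeffE_pos j)) ((coeffE_pos j).trans_le (hτ1 j))).ne'
    have hDj : D (Ell2.single _ j) = ((2 * j + 1) * coeffE j * τ j)⁻¹ • Ell2.single _ j := by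
      ext m
      rw [hD, Ell2.smul_apply, Ell2.single_apply]
      split_ifs with h
      · rw [h]
      · rw [mul_zero, mul_zero]
    rw [ContinuousLinearMap.comp_apply, ContinuousLinearMap.comp_apply, hDj, map_smul, map_smul,
      ContinuousLinearMap.id_apply, Ell2.smul_apply, Ell2.single_apply]
    have h1 : HasSum (fun k => (hilbertKernel n k - hilbertKernel n 0) * N (Ell2.single _ j) k)
        ((2 * j + 1) * coeffE j * (if n = j then τ j else 0)) := by
      have h2 : HasSum (fun k => coeffE k * (hilbertKernel j k * hilbertKernel n k))
          (if n = j then τ j else 0) := by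
        split_ifs with h
        · rw [h]
          simp_rw [← pow_two]
          exact (summable_coeffE_mul_hilbertKernel_sq j).hasSum
        · exact hasSum_coeffE_mul_hilbertKernel_mul h
      have h3 := (h2.sub ((hasSum_coeffE_mul_hilbertKernel_left j).mul_left
        (hilbertKernel n 0))).mul_left ((2 * j + 1) * coeffE j)
      rw [mul_zero, sub_zero] at h3
      refine h3.congr_fun fun k => ?_
      rw [hNe]
      ring
    rw [(hM _ n).unique h1]
    split_ifs with h
    · exact inv_mul_cancel₀ hcj
    · simp
  -- Column orthogonality makes N M diagonal away from index 0, with entries E_k ∑ (2n+1) E_n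
  -- κ(n,k)² > 0.
  have hNM : ∀ k, k ≠ 0 → ∃ a : ℝ, a ≠ 0 ∧ ∀ c, N (M c) k = a * c k := fun k hk => by
    have e1 : ∀ m, HasSum (fun n => coeffE k * (hilbertKernel n k *
        ((2 * n + 1) * coeffE n * M (Ell2.single _ m) n))) (N (M (Ell2.single _ m)) k) :=
      fun m => hN _ k
    have e2 : ∀ m, m ≠ k → N (M (Ell2.single _ m)) k = 0 := fun m hm => by
      have h2 := (hasSum_weight_mul_hilbertKernel_mul hm.symm).sub
        (hasSum_weight_mul_hilbertKernel_mul hk)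
      have h3 := h2.mul_left (coeffE k)
      rw [sub_zero, mul_zero] at h3
      refine (e1 m).unique (h3.congr_fun fun n => ?_)
      rw [hMe]
      ring
    have e3 : 0 < N (M (Ell2.single _ k)) k := by
      have h2 := (e1 k).mul_left (coeffE k)⁻¹
      have h3 := h2.add (hasSum_weight_mul_hilbertKernel_mul hk)
      rw [add_zero] at h3
      have h4 : HasSum (fun n => (2 * n + 1) * coeffE n * hilbertKernel n k ^ 2)
          ((coeffE k)⁻¹ * N (M (Ell2.single _ k)) k) := by
        refine h3.congr_fun fun n => ?_
        have := (coeffE_pos k).ne'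
        rw [hMe]
        field_simp
        ring
      have h5 : 0 < (coeffE k)⁻¹ * N (M (Ell2.single _ k)) k := by
        have h6 := le_hasSum h4 k fun n _ =>
          mul_nonneg (mul_nonneg (by positivity) (coeffE_pos n).le) (sq_nonneg _)
        refine lt_of_lt_of_le ?_ h6
        exact mul_pos (mul_pos (by positivity) (coeffE_pos k))
          (pow_pos (by simp [hilbertKernel]) 2)
      exact (mul_pos_iff_of_pos_left (inv_pos.2 (coeffE_pos k))).1 h5
    refine ⟨_, e3.ne', fun c => ?_⟩
    have h : (Ell2.coord _ k).comp (N.comp M) =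
        (N (M (Ell2.single _ k))).1 k • Ell2.coord (3 / 4) k := by
      refine Ell2.clm_ext fun m => ?_
      rw [_root_.smul_apply, Ell2.coord_apply, Ell2.single_apply, smul_eq_mul]
      split_ifs with hm
      · rw [hm, mul_one]
        rfl
      · rw [mul_zero]
        exact e2 m (Ne.symm hm)
    exact DFunLike.congr_fun h c
  refine ⟨S.prod M, ⟨(injective_iff_map_eq_zero _).2 fun c hc => ?_, fun p => ?_⟩, hS, hM⟩
  · have h1 : S c = 0 := congrArg Prod.fst hc
    have h2 : M c = 0 := congrArg Prod.snd hc
    -- The kernel of M is spanned by the unit vector at 0, and the sum S detects it.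
    have h3 : ∀ k, k ≠ 0 → c k = 0 := fun k hk => by
      obtain ⟨a, ha, h⟩ := hNM k hk
      have h4 := h c
      rw [h2, map_zero, Ell2.zero_apply] at h4
      exact (mul_eq_zero.1 h4.symm).resolve_left ha
    have h4 : c 0 = 0 := by
      have h5 := hasSum_single 0 (f := fun m => c m) h3
      rw [← h5.unique (hS c)] at h1
      exact h1
    ext k
    rcases eq_or_ne k 0 with rfl | hk
    · exact h4
    · exact h3 k hk
  -- The first summand is invisible to M and the second to S, so the two components are prescribed
  -- independently.
  · refine ⟨p.1 • Ell2.single _ 0 + N (D p.2), Prod.ext ?_ ?_⟩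
    · change S (p.1 • Ell2.single _ 0 + N (D p.2)) = p.1
      have h1 : S (N (D p.2)) = 0 := DFunLike.congr_fun hSN (D p.2)
      have h2 : S (Ell2.single _ 0) = 1 := by
        refine (hS _).unique ?_
        simpa using hasSum_mul_single (r := 3 / 4) (fun _ => 1) 0
      rw [map_add, map_smul, h1, h2]
      simp
    · change M (p.1 • Ell2.single _ 0 + N (D p.2)) = p.2
      have h1 : M (N (D p.2)) = p.2 := DFunLike.congr_fun hMND p.2
      have h2 : M (Ell2.single _ 0) = 0 := by
        ext n
        rw [hMe, sub_self, Ell2.zero_apply]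
      rw [map_add, map_smul, h1, h2, smul_zero, zero_add]

/-! ### Power series with coefficients in `ℓ²_{3/4}` -/

theorem sum_shift_le_tsum {f : ℕ → ℝ} (hf : Summable f) (h0 : ∀ n, 0 ≤ f n) (N n : ℕ) :
    ∑ m ∈ Finset.range N, (if m ≤ n then f (n - m) else 0) ≤ ∑' j, f j := by
  rw [← Finset.sum_filter]
  have hinj : Set.InjOn (fun m => n - m) (Finset.filter (fun m => m ≤ n) (Finset.range N)) := by
    intro a ha b hb hab
    simp only [Finset.coe_filter, mem_ofPred_eq] at ha hb hab
    omega
  rw [← Finset.sum_image (f := f) (g := fun m => n - m) hinj]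
  exact hf.sum_le_tsum _ fun _ _ => h0 _

theorem sum_shift_le_tsum' {f : ℕ → ℝ} (hf : Summable f) (h0 : ∀ n, 0 ≤ f n) (N m : ℕ) :
    ∑ n ∈ Finset.range N, (if m ≤ n then f (n - m) else 0) ≤ ∑' j, f j := by
  rw [← Finset.sum_filter]
  have hinj : Set.InjOn (fun n => n - m) (Finset.filter (fun n => m ≤ n) (Finset.range N)) := by
    intro a ha b hb hab
    simp only [Finset.coe_filter, mem_ofPred_eq] at ha hb hab
    omega
  rw [← Finset.sum_image (f := f) (g := fun n => n - m) hinj]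
  exact hf.sum_le_tsum _ fun _ _ => h0 _

/-- Subadditivity of x^(3/4) splits the weight of a product between its factors; this is why
ℓ²_{3/4} is an algebra. -/
theorem one_add_rpow_le_add {n m : ℕ} (h : m ≤ n) : (1 + n : ℝ) ^ (3 / 4 : ℝ) ≤
    (1 + m : ℝ) ^ (3 / 4 : ℝ) + (1 + (n - m : ℕ) : ℝ) ^ (3 / 4 : ℝ) := by
  refine le_trans ?_ (Real.rpow_add_le_add_rpow (by positivity) (by positivity)
    (by norm_num) (by norm_num))
  refine Real.rpow_le_rpow (by positivity) ?_ (by norm_num)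
  rw [Nat.cast_sub h]
  linarith

/-- Where the weight stays on the second factor, the ℓ¹ norm of `a` suffices; where it falls on `a`,
the norm of `a` in ℓ²_{3/4} pairs with the square summable (1+m)^(-3/4). -/
theorem formBound_convolution (a : Ell2 (3 / 4)) : ∃ C, 0 < C ∧
    FormBound (fun n m => (1 + n : ℝ) ^ (3 / 4 : ℝ) * (if m ≤ n then a (n - m) else 0) /
      (1 + m : ℝ) ^ (3 / 4 : ℝ)) C := by
  have h1 := a.summable_abs (by norm_num)
  have h2 := a.summable_sq
  have h3 := summable_one_add_rpow (r := 3 / 4) (by norm_num)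
  set A := ∑' j, |a j|
  set B := ∑' j : ℕ, ((1 + j : ℝ) ^ (3 / 4 : ℝ) * a j) ^ 2
  set Z := ∑' j : ℕ, (1 / (1 + j : ℝ) ^ (3 / 4 : ℝ)) ^ 2
  have hA : 0 ≤ A := tsum_nonneg fun _ => abs_nonneg _
  have hB : 0 ≤ B := tsum_nonneg fun _ => sq_nonneg _
  have hZ : 0 ≤ Z := tsum_nonneg fun _ => sq_nonneg _
  have hF := formBound_of_split (K := fun n m => (1 + n : ℝ) ^ (3 / 4 : ℝ) *
      (if m ≤ n then a (n - m) else 0) / (1 + m : ℝ) ^ (3 / 4 : ℝ))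
    (a := fun n m => (if m ≤ n then |a (n - m)| else 0) + (1 / (1 + m : ℝ) ^ (3 / 4 : ℝ)) ^ 2)
    (b := fun n m => (if m ≤ n then |a (n - m)| else 0) +
      (if m ≤ n then ((1 + (n - m : ℕ) : ℝ) ^ (3 / 4 : ℝ) * a (n - m)) ^ 2 else 0))
    (A := A + Z) (B := A + B) (by positivity) (by positivity) (fun n m x y => ?_)
    (fun N n => ?_) (fun N m => ?_)
  · exact ⟨_, by linarith, hF.mono_const (le_add_of_nonneg_right zero_le_one)⟩
  · by_cases h : m ≤ n
    · simp only [if_pos h]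
      have hle := one_add_rpow_le_add h
      have hm : 0 < (1 + m : ℝ) ^ (3 / 4 : ℝ) := by positivity
      have hj : 0 < (1 + (n - m : ℕ) : ℝ) ^ (3 / 4 : ℝ) := by positivity
      have hn : 0 < (1 + n : ℝ) ^ (3 / 4 : ℝ) := by positivity
      set u := (1 + n : ℝ) ^ (3 / 4 : ℝ)
      set v := (1 + m : ℝ) ^ (3 / 4 : ℝ)
      set w := (1 + (n - m : ℕ) : ℝ) ^ (3 / 4 : ℝ)
      set s := a (n - m)
      have e1 : u * s / v * x * y ≤ u / v * (|s| * |x| * |y|) := by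
        rw [← abs_mul, ← abs_mul]
        refine le_trans (le_of_eq ?_) (mul_le_mul_of_nonneg_left (le_abs_self _) (by positivity))
        ring
      have e2 : u / v ≤ 1 + w * (1 / v) := by
        rw [div_le_iff₀ hm, add_mul, one_mul, mul_assoc, one_div_mul_cancel hm.ne', mul_one]
        exact hle
      have e3 := mul_le_mul_of_nonneg_right e2 (by positivity : 0 ≤ |s| * |x| * |y|)
      have e4 : |s| * |x| * |y| ≤ |s| * x ^ 2 + |s| * y ^ 2 := by
        rw [← sq_abs x, ← sq_abs y, mul_assoc, ← mul_add]
        refine mul_le_mul_of_nonneg_left ?_ (abs_nonneg s)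
        nlinarith [sq_nonneg (|x| - |y|), sq_nonneg (|x|), sq_nonneg (|y|)]
      have e5 : w * (1 / v) * (|s| * |x| * |y|) ≤ (1 / v) ^ 2 * x ^ 2 + (w * s) ^ 2 * y ^ 2 := by
        rw [← sq_abs x, ← sq_abs y, ← sq_abs (w * s), abs_mul w s, abs_of_pos hj]
        nlinarith [sq_nonneg (1 / v * |x| - w * |s| * |y|), sq_nonneg (1 / v * |x|),
          sq_nonneg (w * |s| * |y|)]
      linarith
    · simp only [if_neg h]
      have := mul_nonneg (sq_nonneg (1 / (1 + m : ℝ) ^ (3 / 4 : ℝ))) (sq_nonneg x)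
      simpa using this
  · rw [Finset.sum_add_distrib]
    exact add_le_add (sum_shift_le_tsum h1 (fun _ => abs_nonneg _) N n)
      (h3.sum_le_tsum _ fun _ _ => sq_nonneg _)
  · rw [Finset.sum_add_distrib]
    exact add_le_add (sum_shift_le_tsum' h1 (fun _ => abs_nonneg _) N m)
      (sum_shift_le_tsum' h2 (fun _ => sq_nonneg _) N m)

section Sobolev

open PowerSeries

/-- The series whose coefficients belong to `ℓ²_{3/4}`. -/
def IsSobolev (P : PowerSeries ℝ) : Prop := (fun n => coeff n P) ∈ ell2Submodule (3 / 4)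

theorem IsSobolev.add {P Q : PowerSeries ℝ} (hP : IsSobolev P) (hQ : IsSobolev Q) :
    IsSobolev (P + Q) := by
  have h := (ell2Submodule (3 / 4)).add_mem hP hQ
  have e : (fun n => coeff n (P + Q)) = (fun n => coeff n P) + fun n => coeff n Q :=
    funext fun n => map_add _ _ _
  rwa [IsSobolev, e]

theorem IsSobolev.neg {P : PowerSeries ℝ} (hP : IsSobolev P) : IsSobolev (-P) := by
  have h := (ell2Submodule (3 / 4)).neg_mem hP
  have e : (fun n => coeff n (-P)) = -fun n => coeff n P := funext fun n => map_neg _ _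
  rwa [IsSobolev, e]

theorem isSobolev_mk (c : Ell2 (3 / 4)) : IsSobolev (mk c.1) := by
  have e : (fun n => coeff n (mk c.1)) = c.1 := funext fun n => coeff_mk _ _
  rw [IsSobolev, e]
  exact c.2

theorem IsSobolev.mul {P Q : PowerSeries ℝ} (hP : IsSobolev P) (hQ : IsSobolev Q) :
    IsSobolev (P * Q) := by
  obtain ⟨C, hC, hF⟩ := formBound_convolution ⟨_, hP⟩
  obtain ⟨T, hT⟩ := Ell2.exists_clm (K := fun n m => if m ≤ n then coeff (n - m) P else 0) hC hF
  have e : (fun n => coeff n (P * Q)) = (T ⟨_, hQ⟩).1 := by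
    funext n
    refine HasSum.unique ?_ (hT ⟨_, hQ⟩ n)
    rw [mul_comm, coeff_mul, Finset.Nat.sum_antidiagonal_eq_sum_range_succ_mk]
    have h : HasSum (fun m => (if m ≤ n then coeff (n - m) P else 0) * coeff m Q)
        (∑ m ∈ Finset.range (n + 1), (if m ≤ n then coeff (n - m) P else 0) * coeff m Q) :=
      hasSum_sum_of_ne_finset_zero fun m hm => by
        have : ¬ m ≤ n := fun h => hm (Finset.mem_range.2 (by omega))
        rw [if_neg this, zero_mul]
    convert h using 1
    refine Finset.sum_congr rfl fun m hm => ?_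
    rw [if_pos (by have := Finset.mem_range.1 hm; omega), mul_comm]
  rw [IsSobolev, e]
  exact (T ⟨_, hQ⟩).2

theorem IsSobolev.of_abs_eq {P Q : PowerSeries ℝ} (hP : IsSobolev P)
    (h : ∀ n, |coeff n Q| = |coeff n P|) : IsSobolev Q := by
  refine mem_ell2Submodule_iff.2 ((mem_ell2Submodule_iff.1 hP).congr fun n => ?_)
  rw [mul_pow, mul_pow, ← sq_abs (coeff n P), ← h n, sq_abs]

/-- The coefficients of √(1-z) have order k^(-3/2), so the weight k^(3/4) leaves the square summable
k^(-3/4). -/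
theorem isSobolev_mk_sqrtCoeff : IsSobolev (mk sqrtCoeff) := by
  refine mem_ell2Submodule_iff.2 ?_
  refine Summable.of_nonneg_of_le (fun _ => sq_nonneg _) (fun k => ?_)
    ((summable_one_add_rpow (r := 3 / 4) (by norm_num)).mul_left (3 ^ 2))
  rw [← mul_pow, coeff_mk]
  refine sq_le_sq.2 ?_
  have hp : 0 < (1 + k : ℝ) ^ (3 / 4 : ℝ) := by positivity
  have h1 : (1 + k : ℝ) ^ (3 / 4 : ℝ) * (1 + k : ℝ) ^ (3 / 4 : ℝ) =
      (1 + k : ℝ) ^ (1 / 2 : ℝ) * (1 + k) := by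
    rw [← Real.rpow_add (by positivity), ← Real.rpow_add_one (by positivity)]; norm_num
  have h2 : (1 + k : ℝ) ≤ 3 * |1 - 2 * (k : ℝ)| := by
    rcases k with _ | k
    · norm_num
    · push_cast
      have : (0 : ℝ) ≤ k := Nat.cast_nonneg k
      rw [abs_of_nonpos (by linarith)]
      linarith
  have h3 : 0 < |(1 - 2 * k : ℝ)| := abs_pos.2 (one_sub_two_mul_ne_zero k)
  have h4 := coeffE_le_inv_sqrt k
  have hq : 0 < (1 + k : ℝ) ^ (1 / 2 : ℝ) := by positivity
  rw [sqrtCoeff, abs_mul, abs_div, abs_of_pos hp, abs_of_pos (coeffE_pos k), abs_mul, abs_div,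
    abs_one, abs_of_pos hp, abs_of_pos (by norm_num : (0 : ℝ) < 3), mul_div_assoc',
    div_le_iff₀ h3, mul_one_div, div_mul_eq_mul_div, le_div_iff₀ hp]
  calc (1 + k : ℝ) ^ (3 / 4 : ℝ) * coeffE k * (1 + k : ℝ) ^ (3 / 4 : ℝ)
      = ((1 + k : ℝ) ^ (1 / 2 : ℝ) * (1 + k)) * coeffE k := by rw [← h1]; ring
    _ ≤ ((1 + k : ℝ) ^ (1 / 2 : ℝ) * (1 + k)) * ((1 + k : ℝ) ^ (1 / 2 : ℝ))⁻¹ :=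
        mul_le_mul_of_nonneg_left h4 (by positivity)
    _ = 1 + k := by field_simp
    _ ≤ 3 * |1 - 2 * (k : ℝ)| := h2

theorem IsSobolev.evalNegHom {P : PowerSeries ℝ} (hP : IsSobolev P) :
    IsSobolev (PowerSeries.evalNegHom P) := by
  refine hP.of_abs_eq fun n => ?_
  rw [PowerSeries.evalNegHom, coeff_rescale, abs_mul, abs_pow, abs_neg, abs_one, one_pow, one_mul]

theorem IsSobolev.oddPart {P : PowerSeries ℝ} (hP : IsSobolev P) : IsSobolev (oddPart P) := by
  refine mem_ell2Submodule_iff.2 ?_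
  have h := (mem_ell2Submodule_iff.1 hP).comp_injective (i := fun m => 2 * m + 1)
    fun a b hab => by simpa using hab
  refine Summable.of_nonneg_of_le (fun _ => sq_nonneg _) (fun m => ?_) h
  rw [HalfLineOscillator.oddPart, coeff_mk, Function.comp_apply, mul_pow, mul_pow]
  refine mul_le_mul_of_nonneg_right ?_ (sq_nonneg _)
  refine pow_le_pow_left₀ (by positivity) (Real.rpow_le_rpow (by positivity) ?_ (by norm_num)) 2
  push_cast
  linarith [(Nat.cast_nonneg m : (0 : ℝ) ≤ m)]

theorem IsSobolev.expandTwo {P : PowerSeries ℝ} (hP : IsSobolev P) : IsSobolev (expandTwo P) := by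
  refine mem_ell2Submodule_iff.2 ?_
  have h := mem_ell2Submodule_iff.1 hP
  have hinj : Function.Injective fun m : ℕ => 2 * m := fun a b hab => by simpa using hab
  refine (hinj.summable_iff fun n hn => ?_).1 ?_
  · obtain ⟨m, rfl | rfl⟩ := n.even_or_odd'
    · exact absurd ⟨m, rfl⟩ hn
    · rw [coeff_odd_expandTwo]; ring
  · refine Summable.of_nonneg_of_le (fun _ => sq_nonneg _) (fun m => ?_) (h.mul_left (2 ^ 2))
    rw [Function.comp_apply, coeff_even_expandTwo, ← mul_pow, ← mul_assoc, mul_pow, mul_pow]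
    refine mul_le_mul_of_nonneg_right ?_ (sq_nonneg _)
    refine pow_le_pow_left₀ (by positivity) ?_ 2
    have h1 : (1 + (2 * m : ℕ) : ℝ) ^ (3 / 4 : ℝ) ≤ (2 * (1 + m)) ^ (3 / 4 : ℝ) := by
      refine Real.rpow_le_rpow (by positivity) ?_ (by norm_num)
      push_cast
      linarith
    refine h1.trans ?_
    rw [Real.mul_rpow (by norm_num) (by positivity)]
    refine mul_le_mul_of_nonneg_right ?_ (by positivity)
    calc (2 : ℝ) ^ (3 / 4 : ℝ) ≤ (2 : ℝ) ^ (1 : ℝ) :=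
          Real.rpow_le_rpow_of_exponent_le (by norm_num) (by norm_num)
      _ = 2 := Real.rpow_one 2

theorem IsSobolev.numSeries {P : PowerSeries ℝ} (hP : IsSobolev P) : IsSobolev (numSeries P) :=
  (isSobolev_mk_sqrtCoeff.evalNegHom.mul hP).oddPart

theorem IsSobolev.dirSeries {P : PowerSeries ℝ} (hP : IsSobolev P) : IsSobolev (dirSeries P) :=
  (isSobolev_mk_sqrtCoeff.mul hP).oddPart.neg

/-- A continuous linear map of `ℓ²_{3/4}` given by a coefficientwise continuous linear map of
power series. -/
noncomputable def sobolevMap (L : PowerSeries ℝ →ₗ[ℝ] PowerSeries ℝ)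
    (hL : ∀ P, IsSobolev P → IsSobolev (L P))
    (hc : ∀ n, Continuous fun c : Ell2 (3 / 4) => coeff n (L (mk c.1))) :
    Ell2 (3 / 4) →L[ℝ] Ell2 (3 / 4) :=
  let T : Ell2 (3 / 4) →ₗ[ℝ] Ell2 (3 / 4) :=
    { toFun := fun c => ⟨fun n => coeff n (L (mk c.1)), hL _ (isSobolev_mk c)⟩
      map_add' := fun c d => Ell2.ext fun n => by
        have h : mk (c + d : Ell2 (3 / 4)).1 = mk c.1 + mk d.1 := by
          ext k; simp only [map_add, coeff_mk]; rfl
        change coeff n (L (mk (c + d : Ell2 (3 / 4)).1)) = _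
        rw [h, map_add, map_add]
        rfl
      map_smul' := fun a c => Ell2.ext fun n => by
        have h : mk (a • c : Ell2 (3 / 4)).1 = a • mk c.1 := by
          ext k; simp only [map_smul, coeff_mk]; rfl
        change coeff n (L (mk (a • c : Ell2 (3 / 4)).1)) = _
        rw [h, map_smul, map_smul]
        rfl }
  ⟨T, Ell2.continuous_of_apply T hc⟩

theorem continuous_coeff_mul (P : PowerSeries ℝ) (n : ℕ) :
    Continuous fun c : Ell2 (3 / 4) => coeff n (P * mk c.1) := by
  simp_rw [coeff_mul, coeff_mk]
  exact continuous_finsetSum _ fun p _ => (Ell2.continuous_apply p.2).const_mul _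

/-- `F ↦ (f, g)`. -/
theorem exists_numSeries_dirSeries_equiv :
    ∃ T : Ell2 (3 / 4) →L[ℝ] Ell2 (3 / 4) × Ell2 (3 / 4), Function.Bijective T ∧
      ∀ c n, (T c).1 n = coeff n (numSeries (mk c.1)) ∧ (T c).2 n = coeff n (dirSeries (mk c.1)) := by
  let L1 : PowerSeries ℝ →ₗ[ℝ] PowerSeries ℝ :=
    { toFun := numSeries
      map_add' := fun P Q => by
        ext n; simp only [numSeries, oddPart, coeff_mk, map_add, mul_add]
      map_smul' := fun a P => by
        ext n; simp only [numSeries, oddPart, coeff_mk, mul_smul_comm, map_smul, RingHom.id_apply] }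
  let L2 : PowerSeries ℝ →ₗ[ℝ] PowerSeries ℝ :=
    { toFun := dirSeries
      map_add' := fun P Q => by
        ext n; simp only [dirSeries, oddPart, coeff_mk, map_add, mul_add, map_neg, neg_add]
      map_smul' := fun a P => by
        ext n; simp only [dirSeries, oddPart, coeff_mk, mul_smul_comm, map_smul, map_neg, smul_neg,
          RingHom.id_apply] }
  let T1 := sobolevMap L1 (fun P hP => hP.numSeries) fun n => by
    change Continuous fun c : Ell2 (3 / 4) => coeff n (numSeries (mk c.1))
    simp only [numSeries, oddPart, coeff_mk]
    exact continuous_coeff_mul _ _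
  let T2 := sobolevMap L2 (fun P hP => hP.dirSeries) fun n => by
    change Continuous fun c : Ell2 (3 / 4) => coeff n (dirSeries (mk c.1))
    simp only [dirSeries, oddPart, coeff_mk, map_neg]
    exact (continuous_coeff_mul _ _).neg
  have h1 : ∀ c, mk (T1 c).1 = numSeries (mk c.1) := fun c => PowerSeries.ext fun n => coeff_mk _ _
  have h2 : ∀ c, mk (T2 c).1 = dirSeries (mk c.1) := fun c => PowerSeries.ext fun n => coeff_mk _ _
  refine ⟨T1.prod T2, ⟨fun c d h => ?_, fun p => ?_⟩, fun c n => ⟨rfl, rfl⟩⟩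
  · have e1 : T1 c = T1 d := congrArg Prod.fst h
    have e2 : T2 c = T2 d := congrArg Prod.snd h
    have e3 : mk c.1 = mk d.1 := by
      rw [eq_of_numSeries_dirSeries (mk c.1), eq_of_numSeries_dirSeries (mk d.1), ← h1, ← h1, ← h2,
        ← h2, e1, e2]
    ext n
    have := congrArg (coeff n) e3
    rwa [coeff_mk, coeff_mk] at this
  · set P := PowerSeries.evalNegHom (mk sqrtCoeff) * expandTwo (mk p.1.1) +
      mk sqrtCoeff * expandTwo (mk p.2.1) with hP
    have hS : IsSobolev P := (isSobolev_mk_sqrtCoeff.evalNegHom.mul (isSobolev_mk p.1).expandTwo).add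
      (isSobolev_mk_sqrtCoeff.mul (isSobolev_mk p.2).expandTwo)
    have h3 := numSeries_dirSeries_of_eq (mk p.1.1) (mk p.2.1)
    have e : mk (fun n => coeff n P) = P := PowerSeries.ext fun n => coeff_mk _ _
    refine ⟨⟨_, hS⟩, Prod.ext (Ell2.ext fun n => ?_) (Ell2.ext fun n => ?_)⟩
    · change coeff n (numSeries (mk fun n => coeff n P)) = _
      rw [e, hP, h3.1, coeff_mk]
    · change coeff n (dirSeries (mk fun n => coeff n P)) = _
      rw [e, hP, h3.2, coeff_mk]

/-! ### The space of spectral data -/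

theorem isNumerator_mk_coeffE_mul (f : Ell2 (3 / 4)) :
    IsNumerator (fun n => coeff n (mk coeffE * mk f.1)) f := by
  intro z hz
  have h := hasSum_powerSeries_mul (summable_norm_coeffE_mul_pow hz)
    (f.summable_pow (by norm_num) hz).norm
  rw [tsum_coeffE_mul_pow hz, ← div_eq_inv_mul] at h
  exact h

theorem IsNumerator.unique_left {h k : ℕ → ℝ} {f : ℕ → ℝ}
    (hf : IsNumerator h f) (hg : IsNumerator k f) : h = k := by
  have h0 : (fun n => h n - k n) = 0 := by
    refine eq_zero_of_hasSum_zero fun z hz => ?_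
    simpa [sub_mul] using (hf z hz).sub (hg z hz)
  exact funext fun n => sub_eq_zero.1 (congrFun h0 n)

/-- The isometry of `ℓ²_{3/4}` onto `ℋ`. -/
theorem exists_spectralSpace_equiv : ∃ T : Ell2 (3 / 4) ≃L[ℝ] SpectralSpace,
    ∀ f n, (T f) n = coeff n (mk coeffE * mk f.1) := by
  let L : Ell2 (3 / 4) →ₗ[ℝ] SpectralSpace :=
    { toFun := fun f => ⟨_, f, isNumerator_mk_coeffE_mul f⟩
      map_add' := fun f g => Subtype.ext <|
        (isNumerator_mk_coeffE_mul (f + g)).unique_left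
          ((isNumerator_mk_coeffE_mul f).add (isNumerator_mk_coeffE_mul g))
      map_smul' := fun a f => Subtype.ext <|
        (isNumerator_mk_coeffE_mul (a • f)).unique_left ((isNumerator_mk_coeffE_mul f).smul a) }
  have hL : ∀ f, numerator (L f) = f := fun f =>
    IsNumerator.unique (h := (L f).1) (Classical.choose_spec (L f).2) (isNumerator_mk_coeffE_mul f)
  let I : Ell2 (3 / 4) →ₗᵢ[ℝ] SpectralSpace :=
    ⟨L, fun f => by
      change ‖numerator (L f)‖ = ‖f‖
      rw [hL]⟩
  have hs : Function.Surjective I := fun h => ⟨numerator h, numerator_injective (hL _)⟩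
  exact ⟨(LinearIsometryEquiv.ofSurjective I hs).toContinuousLinearEquiv, fun f n => rfl⟩

end Sobolev

/-! ### Basic properties of `H₊` -/

theorem _root_.AbsolutelyContinuousOnInterval.congr {f g : ℝ → ℝ} {a b : ℝ}
    (hf : AbsolutelyContinuousOnInterval f a b) (h : EqOn f g (uIcc a b)) :
    AbsolutelyContinuousOnInterval g a b := by
  rw [absolutelyContinuousOnInterval_iff] at hf ⊢
  intro ε hε
  obtain ⟨δ, hδ, H⟩ := hf ε hε
  refine ⟨δ, hδ, fun E hE hlt => ?_⟩
  have h1 := H E hE hlt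
  rwa [Finset.sum_congr rfl fun i hi => by
    rw [h (hE.1 i hi).1, h (hE.1 i hi).2]] at h1

theorem ae_halfLine_of_forall {p : ℝ → Prop} (h : ∀ x, 0 < x → p x) : ∀ᵐ x ∂halfLine, p x := by
  rw [halfLine, ae_restrict_iff' measurableSet_Ioi]
  exact Filter.Eventually.of_forall fun x hx => h x hx

theorem ae_halfLine_iff {p : ℝ → Prop} : (∀ᵐ x ∂halfLine, p x) ↔ ∀ᵐ x : ℝ, 0 < x → p x :=
  ae_restrict_iff' measurableSet_Ioi

theorem setIntegral_halfLine {s : Set ℝ} (hs : MeasurableSet s) (h : s ⊆ Ioi 0) (f : ℝ → ℝ) :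
    ∫ x in s, f x ∂halfLine = ∫ x in s, f x := by
  rw [halfLine, Measure.restrict_restrict hs, inter_eq_left.2 h]

theorem eventuallyEq_max_nhds {f : ℝ → ℝ} {x : ℝ} (hx : 0 < x) :
    (fun y => f (max 0 y)) =ᶠ[nhds x] f := by
  filter_upwards [Ioi_mem_nhds hx] with y hy
  rw [max_eq_right (le_of_lt hy)]

/-- The element of `H₊` given by a function on `ℝ`. -/
noncomputable def HPlus.mk (f : ℝ → ℝ)
    (h1 : ∀ R, 0 ≤ R → AbsolutelyContinuousOnInterval f 0 R) (h2 : MemLp f 2 halfLine)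
    (h3 : MemLp (deriv f) 2 halfLine) (h4 : MemLp (fun x => x * f x) 2 halfLine) : HPlus :=
  ⟨fun x => f x, fun R hR => (h1 R hR).congr fun x hx => by
      rw [uIcc_of_le hR] at hx
      rw [IciExtend_of_mem _ hx.1],
    h2.ae_eq (ae_halfLine_of_forall fun x hx => by rw [IciExtend_of_mem _ hx.le]),
    h3.ae_eq (ae_halfLine_of_forall fun x hx => (eventuallyEq_max_nhds hx).deriv_eq.symm),
    h4.ae_eq (ae_halfLine_of_forall fun x hx => by
      change x * f x = x * IciExtend _ x
      rw [IciExtend_of_mem _ hx.le])⟩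

theorem HPlus.mk_apply {f : ℝ → ℝ} (h1 h2 h3 h4) {x : ℝ} (hx : 0 ≤ x) :
    HPlus.mk f h1 h2 h3 h4 x = f x := IciExtend_of_mem (fun y : Ici (0 : ℝ) => f y) hx

theorem HPlus.deriv_mk {f : ℝ → ℝ} (h1 h2 h3 h4) {x : ℝ} (hx : 0 < x) :
    deriv (HPlus.mk f h1 h2 h3 h4) x = deriv f x := (eventuallyEq_max_nhds hx).deriv_eq

theorem HPlus.add_apply (q p : HPlus) (x : ℝ) : (q + p) x = q x + p x := rfl

theorem HPlus.smul_apply (a : ℝ) (q : HPlus) (x : ℝ) : (a • q) x = a * q x := rfl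

theorem HPlus.ext {q p : HPlus} (h : ∀ x, 0 ≤ x → q x = p x) : q = p := by
  refine Subtype.ext (funext fun x => ?_)
  have h1 := h x x.2
  rwa [IciExtend_of_mem _ x.2, IciExtend_of_mem _ x.2] at h1

theorem HPlus.absolutelyContinuous (q : HPlus) {a b : ℝ} (ha : 0 ≤ a) (hb : 0 ≤ b) :
    AbsolutelyContinuousOnInterval q a b := by
  refine (q.2.1 (max a b) (ha.trans (le_max_left _ _))).mono ?_
  rw [uIcc_of_le (ha.trans (le_max_left _ _)), uIcc]
  exact Icc_subset_Icc (le_min ha hb) le_rfl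

theorem HPlus.memLp (q : HPlus) : MemLp q 2 halfLine := q.2.2.1

theorem HPlus.memLp_deriv (q : HPlus) : MemLp (deriv q) 2 halfLine := q.2.2.2.1

theorem HPlus.memLp_mul (q : HPlus) : MemLp (fun x => x * q x) 2 halfLine := q.2.2.2.2

theorem HPlus.ae_deriv_add (q p : HPlus) :
    deriv (q + p : HPlus) =ᵐ[halfLine] fun x => deriv q x + deriv p x := by
  filter_upwards [ae_differentiableAt_halfLine q.2.1, ae_differentiableAt_halfLine p.2.1]
    with x hq hp
  exact deriv_add hq hp

theorem HPlus.deriv_smul (a : ℝ) (q : HPlus) (x : ℝ) :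
    deriv (a • q : HPlus) x = a * deriv q x := deriv_const_mul_field a

theorem HPlus.inner_def (q p : HPlus) : inner ℝ q p =
    ∫ x, (q x * p x + deriv q x * deriv p x + (x * q x) * (x * p x)) ∂halfLine := rfl

theorem HPlus.continuousOn (q : HPlus) : ContinuousOn q (Ici 0) := by
  intro x hx
  have hx : 0 ≤ x := hx
  have h3 := (q.absolutelyContinuous le_rfl (by linarith : 0 ≤ x + 1)).continuousOn x
    (by rw [uIcc_of_le (by linarith)]; exact ⟨hx, by linarith⟩)
  refine h3.mono_of_mem_nhdsWithin ?_
  rw [uIcc_of_le (by linarith)]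
  exact Filter.mem_of_superset
    (inter_mem_nhdsWithin _ (Iio_mem_nhds (show x < x + 1 by linarith)))
    fun y hy => ⟨hy.1, le_of_lt hy.2⟩

/-- Integration by parts in `H₊`. -/
theorem HPlus.integral_deriv_mul (q p : HPlus) {x : ℝ} (hx : 0 ≤ x) :
    ∫ y in Ioi x, (deriv q y * p y + q y * deriv p y) = -(q x * p x) := by
  have hi : Integrable (fun y => deriv q y * p y + q y * deriv p y) halfLine :=
    (q.memLp_deriv.integrable_mul p.memLp).add (q.memLp.integrable_mul p.memLp_deriv)
  have hi' : IntegrableOn (fun y => deriv q y * p y + q y * deriv p y) (Ioi x) :=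
    IntegrableOn.mono_set hi (Ioi_subset_Ioi hx)
  have h1 := intervalIntegral_tendsto_integral_Ioi x hi' Filter.tendsto_id
  have h2 : Filter.Tendsto (fun R => q R * p R - q x * p x) Filter.atTop
      (nhds (∫ y in Ioi x, (deriv q y * p y + q y * deriv p y))) := by
    refine h1.congr' ?_
    filter_upwards [Filter.eventually_ge_atTop (0 : ℝ)] with R hR
    exact (q.absolutelyContinuous hx hR).integral_deriv_mul_eq_sub (p.absolutelyContinuous hx hR)
  have h3 := h2.add_const (q x * p x)
  simp only [sub_add_cancel] at h3
  have h4 : IntegrableAtFilter (fun R => q R * p R) Filter.atTop volume :=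
    ⟨Ioi 0, Filter.Ioi_mem_atTop 0, q.memLp.integrable_mul p.memLp⟩
  -- The product q p has a limit at infinity and is integrable on the half-line, so the limit is 0.
  have h5 := h4.eq_zero_of_tendsto (fun s hs => ?_) h3
  · linarith
  · obtain ⟨b, hb⟩ := Filter.mem_atTop_sets.1 hs
    rw [← top_le_iff, ← Real.volume_Ici (a := b)]
    exact measure_mono hb

theorem HPlus.norm_sq (q : HPlus) : ‖q‖ ^ 2 =
    ∫ x, (q x * q x + deriv q x * deriv q x + (x * q x) * (x * q x)) ∂halfLine := by
  rw [← real_inner_self_eq_norm_sq, HPlus.inner_def]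

/-- By q(x)² = -2 ∫_x^∞ q q' and 2|q q'| ≤ q² + q'². -/
theorem HPlus.abs_apply_le (q : HPlus) {x : ℝ} (hx : 0 ≤ x) : |q x| ≤ ‖q‖ := by
  refine abs_le_of_sq_le_sq ?_ (norm_nonneg q)
  have h1 := q.integral_deriv_mul q hx
  have hi : Integrable (fun x => q x * q x + deriv q x * deriv q x + (x * q x) * (x * q x))
    halfLine := q.integrable_inner q
  have h2 : ∫ y in Ioi x, (q y * q y + deriv q y * deriv q y + (y * q y) * (y * q y)) ≤ ‖q‖ ^ 2 := by
    rw [q.norm_sq]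
    refine setIntegral_mono_set hi (Filter.Eventually.of_forall fun y => ?_)
      (Filter.Eventually.of_forall (Ioi_subset_Ioi hx))
    simp only [Pi.zero_apply, ← pow_two]
    positivity
  have hi' : IntegrableOn (fun y => deriv q y * q y + q y * deriv q y) (Ioi x) :=
    IntegrableOn.mono_set ((q.memLp_deriv.integrable_mul q.memLp).add
      (q.memLp.integrable_mul q.memLp_deriv)) (Ioi_subset_Ioi hx)
  have h3 : ∫ y in Ioi x, -(deriv q y * q y + q y * deriv q y) ≤
      ∫ y in Ioi x, (q y * q y + deriv q y * deriv q y + (y * q y) * (y * q y)) := by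
    refine integral_mono hi'.neg (IntegrableOn.mono_set hi (Ioi_subset_Ioi hx)) fun y => ?_
    simp only
    nlinarith [sq_nonneg (q y + deriv q y), sq_nonneg (y * q y)]
  rw [integral_neg, h1] at h3
  nlinarith

/-- Evaluation at `x`. -/
noncomputable def HPlus.eval (x : ℝ) (hx : 0 ≤ x) : HPlus →L[ℝ] ℝ :=
  LinearMap.mkContinuous ⟨⟨fun q => q x, fun _ _ => rfl⟩, fun _ _ => rfl⟩ 1 fun q => by
    rw [one_mul]
    exact q.abs_apply_le hx

theorem HPlus.norm_eval_le (x : ℝ) (hx : 0 ≤ x) : ‖HPlus.eval x hx‖ ≤ 1 :=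
  LinearMap.mkContinuous_norm_le _ zero_le_one _

theorem norm_toLp_sq {f : ℝ → ℝ} (hf : MemLp f 2 halfLine) :
    ‖hf.toLp f‖ ^ 2 = ∫ x, f x * f x ∂halfLine := by
  rw [← real_inner_self_eq_norm_sq, L2.inner_def]
  refine integral_congr_ae ?_
  filter_upwards [hf.coeFn_toLp] with x hx
  simp [hx, pow_two]

/-- `q ↦ q` from `H₊` to `L²(ℝ₊)`. -/
noncomputable def HPlus.toL2 : HPlus →ₗ[ℝ] Lp ℝ 2 halfLine where
  toFun q := q.memLp.toLp q
  map_add' q p := (MemLp.toLp_add q.memLp p.memLp).symm ▸ rfl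
  map_smul' a q := (MemLp.toLp_const_smul a q.memLp).symm ▸ rfl

/-- `q ↦ q'` from `H₊` to `L²(ℝ₊)`. -/
noncomputable def HPlus.derivL2 : HPlus →ₗ[ℝ] Lp ℝ 2 halfLine where
  toFun q := q.memLp_deriv.toLp (deriv q)
  map_add' q p := by
    rw [← MemLp.toLp_add q.memLp_deriv p.memLp_deriv]
    exact MemLp.toLp_congr _ _ (q.ae_deriv_add p)
  map_smul' a q := by
    rw [RingHom.id_apply, ← MemLp.toLp_const_smul a q.memLp_deriv]
    exact MemLp.toLp_congr _ _ (Filter.Eventually.of_forall (q.deriv_smul a))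

/-- `q ↦ x q` from `H₊` to `L²(ℝ₊)`. -/
noncomputable def HPlus.mulL2 : HPlus →ₗ[ℝ] Lp ℝ 2 halfLine where
  toFun q := q.memLp_mul.toLp (fun x => x * q x)
  map_add' q p := by
    rw [← MemLp.toLp_add q.memLp_mul p.memLp_mul]
    exact MemLp.toLp_congr _ _ (Filter.Eventually.of_forall fun x => mul_add _ _ _)
  map_smul' a q := by
    rw [RingHom.id_apply, ← MemLp.toLp_const_smul a q.memLp_mul]
    exact MemLp.toLp_congr _ _ (Filter.Eventually.of_forall fun x => mul_left_comm _ _ _)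

theorem HPlus.norm_sq_eq (q : HPlus) :
    ‖q‖ ^ 2 = ‖HPlus.toL2 q‖ ^ 2 + ‖HPlus.derivL2 q‖ ^ 2 + ‖HPlus.mulL2 q‖ ^ 2 := by
  have e1 : ‖HPlus.toL2 q‖ ^ 2 = ∫ x, q x * q x ∂halfLine := norm_toLp_sq q.memLp
  have e2 : ‖HPlus.derivL2 q‖ ^ 2 = ∫ x, deriv q x * deriv q x ∂halfLine :=
    norm_toLp_sq q.memLp_deriv
  have e3 : ‖HPlus.mulL2 q‖ ^ 2 = ∫ x, (x * q x) * (x * q x) ∂halfLine := norm_toLp_sq q.memLp_mul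
  rw [q.norm_sq, e1, e2, e3, ← integral_add, ← integral_add]
  · exact (q.memLp.integrable_mul q.memLp).add (q.memLp_deriv.integrable_mul q.memLp_deriv)
  · exact q.memLp_mul.integrable_mul q.memLp_mul
  · exact q.memLp.integrable_mul q.memLp
  · exact q.memLp_deriv.integrable_mul q.memLp_deriv

theorem HPlus.norm_toL2_le (q : HPlus) : ‖HPlus.toL2 q‖ ≤ ‖q‖ := by
  refine (sq_le_sq₀ (norm_nonneg _) (norm_nonneg _)).1 ?_
  rw [q.norm_sq_eq]
  nlinarith [sq_nonneg ‖HPlus.derivL2 q‖, sq_nonneg ‖HPlus.mulL2 q‖]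

theorem HPlus.norm_derivL2_le (q : HPlus) : ‖HPlus.derivL2 q‖ ≤ ‖q‖ := by
  refine (sq_le_sq₀ (norm_nonneg _) (norm_nonneg _)).1 ?_
  rw [q.norm_sq_eq]
  nlinarith [sq_nonneg ‖HPlus.toL2 q‖, sq_nonneg ‖HPlus.mulL2 q‖]

theorem HPlus.norm_mulL2_le (q : HPlus) : ‖HPlus.mulL2 q‖ ≤ ‖q‖ := by
  refine (sq_le_sq₀ (norm_nonneg _) (norm_nonneg _)).1 ?_
  rw [q.norm_sq_eq]
  nlinarith [sq_nonneg ‖HPlus.toL2 q‖, sq_nonneg ‖HPlus.derivL2 q‖]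

/-! ### Completeness of H₊ -/

theorem intervalIntegrable_of_memLp {r : ℝ → ℝ} (hr : MemLp r 2 halfLine) {R : ℝ} (hR : 0 ≤ R) :
    IntervalIntegrable r volume 0 R := by
  rw [intervalIntegrable_iff_integrableOn_Ioc_of_le hR]
  have h1 : MemLp r 2 (volume.restrict (Ioc 0 R)) :=
    hr.mono_measure (Measure.restrict_mono Ioc_subset_Ioi_self le_rfl)
  exact h1.integrable (by norm_num)

theorem absolutelyContinuous_integral {r : ℝ → ℝ} (hr : MemLp r 2 halfLine) (c : ℝ) {R : ℝ}
    (hR : 0 ≤ R) : AbsolutelyContinuousOnInterval (fun x => c + ∫ y in (0 : ℝ)..x, r y) 0 R :=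
  ((LipschitzWith.const c).lipschitzOnWith.absolutelyContinuousOnInterval (K := 0)).add
    ((intervalIntegrable_of_memLp hr hR).absolutelyContinuousOnInterval_intervalIntegral
      left_mem_uIcc)

theorem ae_deriv_integral {r : ℝ → ℝ} (hr : MemLp r 2 halfLine) (c : ℝ) :
    ∀ᵐ x ∂halfLine, deriv (fun x => c + ∫ y in (0 : ℝ)..x, r y) x = r x := by
  have h : ∀ᵐ x : ℝ, ∀ n : ℕ, x ∈ uIcc (0 : ℝ) n →
      HasDerivAt (fun x => ∫ y in (0 : ℝ)..x, r y) (r x) x :=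
    ae_all_iff.2 fun n => by
      filter_upwards [(intervalIntegrable_of_memLp hr n.cast_nonneg).ae_hasDerivAt_integral]
        with x hx hx'
      exact hx hx' 0 left_mem_uIcc
  rw [halfLine, ae_restrict_iff' measurableSet_Ioi]
  filter_upwards [h] with x hx hx0
  obtain ⟨n, hn⟩ := exists_nat_ge x
  refine ((hx n ?_).const_add c).deriv
  rw [uIcc_of_le n.cast_nonneg]
  exact ⟨le_of_lt hx0, hn⟩

theorem HPlus.apply_eq_integral (q : HPlus) {x : ℝ} (hx : 0 ≤ x) :
    q x = q 0 + ∫ y in (0 : ℝ)..x, deriv q y := by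
  rw [(q.absolutelyContinuous le_rfl hx).integral_deriv_eq_sub]
  ring

theorem ae_eq_of_tendsto_Lp {u : ℕ → Lp ℝ 2 halfLine} {a : Lp ℝ 2 halfLine}
    (h : Filter.Tendsto u Filter.atTop (nhds a)) {v : ℕ → ℝ → ℝ} {w : ℝ → ℝ}
    (hv : ∀ n, u n =ᵐ[halfLine] v n)
    (hw : ∀ x, 0 < x → Filter.Tendsto (fun n => v n x) Filter.atTop (nhds (w x))) :
    a =ᵐ[halfLine] w := by
  obtain ⟨ns, hns, hae⟩ := (tendstoInMeasure_of_tendsto_Lp h).exists_seq_tendsto_ae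
  filter_upwards [hae, ae_all_iff.2 hv, ae_halfLine_of_forall hw] with x h1 h2 h3
  refine tendsto_nhds_unique h1 ?_
  simp_rw [h2]
  exact h3.comp hns.tendsto_atTop

/-- For a Cauchy sequence, q, q' and xq converge in L² and q(0) converges. The limit potential is
rebuilt as the limit of q(0) plus the integral of the limit of q'; pointwise convergence to it
identifies the other two L² limits. -/
instance : CompleteSpace HPlus := by
  refine Metric.complete_of_cauchySeq_tendsto fun u hu => ?_
  have hcau : ∀ (L : HPlus →ₗ[ℝ] Lp ℝ 2 halfLine), (∀ q, ‖L q‖ ≤ ‖q‖) →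
      ∃ a, Filter.Tendsto (fun n => L (u n)) Filter.atTop (nhds a) := fun L hL => by
    have h1 : CauchySeq fun n => L.mkContinuous 1 (by simpa using hL) (u n) :=
      hu.map (ContinuousLinearMap.uniformContinuous _)
    exact cauchySeq_tendsto_of_complete h1
  obtain ⟨a, ha⟩ := hcau _ HPlus.norm_toL2_le
  obtain ⟨b, hb⟩ := hcau _ HPlus.norm_derivL2_le
  obtain ⟨d, hd⟩ := hcau _ HPlus.norm_mulL2_le
  obtain ⟨c, hc⟩ : ∃ c, Filter.Tendsto (fun n => u n 0) Filter.atTop (nhds c) :=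
    cauchySeq_tendsto_of_complete
      (hu.map (ContinuousLinearMap.uniformContinuous (HPlus.eval 0 le_rfl)))
  have hbm : MemLp b 2 halfLine := Lp.memLp b
  set f : ℝ → ℝ := fun x => c + ∫ y in (0 : ℝ)..x, b y with hf
  -- Weak form of the fundamental theorem: L² convergence of the derivatives is paired with the
  -- indicator of (0, x].
  have hpt : ∀ x, 0 < x → Filter.Tendsto (fun n => u n x) Filter.atTop (nhds (f x)) := by
    intro x hx
    have hμ : halfLine (Ioc 0 x) ≠ ⊤ := by
      refine ne_top_of_le_ne_top ?_ (Measure.restrict_apply_le _ _)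
      simp
    have e : ∀ g : Lp ℝ 2 halfLine, inner ℝ (indicatorConstLp 2 measurableSet_Ioc hμ (1 : ℝ)) g =
        ∫ y in (0 : ℝ)..x, g y := fun g => by
      rw [L2.inner_indicatorConstLp_one, intervalIntegral.integral_of_le hx.le,
        setIntegral_halfLine measurableSet_Ioc Ioc_subset_Ioi_self]
    have h1 := (tendsto_const_nhds (x := indicatorConstLp 2 measurableSet_Ioc hμ (1 : ℝ))).inner
      (𝕜 := ℝ) hb
    simp_rw [e] at h1
    refine (hc.add h1).congr fun n => ?_
    rw [(u n).apply_eq_integral hx.le]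
    congr 1
    refine intervalIntegral.integral_congr_ae ?_
    have h2 := ae_halfLine_iff.1 (u n).memLp_deriv.coeFn_toLp
    filter_upwards [h2] with y hy hy'
    rw [uIoc_of_le hx.le] at hy'
    exact hy hy'.1
  have haf : a =ᵐ[halfLine] f := ae_eq_of_tendsto_Lp ha (fun n => (u n).memLp.coeFn_toLp) hpt
  have hdf : d =ᵐ[halfLine] fun x => x * f x :=
    ae_eq_of_tendsto_Lp hd (fun n => (u n).memLp_mul.coeFn_toLp)
      fun x hx => (hpt x hx).const_mul x
  have hbf : b =ᵐ[halfLine] deriv f := by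
    filter_upwards [ae_deriv_integral hbm c] with x hx
    exact hx.symm
  set q : HPlus := HPlus.mk f (fun R hR => absolutelyContinuous_integral hbm c hR)
    ((Lp.memLp a).ae_eq haf) (hbm.ae_eq hbf) ((Lp.memLp d).ae_eq hdf) with hq
  have ea : HPlus.toL2 q = a := by
    refine Lp.ext (q.memLp.coeFn_toLp.trans (Filter.EventuallyEq.trans ?_ haf.symm))
    exact ae_halfLine_of_forall fun x hx => HPlus.mk_apply _ _ _ _ hx.le
  have eb : HPlus.derivL2 q = b := by
    refine Lp.ext (q.memLp_deriv.coeFn_toLp.trans (Filter.EventuallyEq.trans ?_ hbf.symm))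
    exact ae_halfLine_of_forall fun x hx => HPlus.deriv_mk _ _ _ _ hx
  have ed : HPlus.mulL2 q = d := by
    refine Lp.ext (q.memLp_mul.coeFn_toLp.trans (Filter.EventuallyEq.trans ?_ hdf.symm))
    refine ae_halfLine_of_forall fun x hx => ?_
    change x * q x = x * f x
    rw [hq, HPlus.mk_apply _ _ _ _ hx.le]
  refine ⟨q, tendsto_iff_norm_sub_tendsto_zero.2 ?_⟩
  have h0 : Filter.Tendsto (fun n => ‖u n - q‖ ^ 2) Filter.atTop (nhds 0) := by
    simp_rw [HPlus.norm_sq_eq, map_sub, ea, eb, ed]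
    have := (((tendsto_iff_norm_sub_tendsto_zero.1 ha).pow 2).add
      ((tendsto_iff_norm_sub_tendsto_zero.1 hb).pow 2)).add
      ((tendsto_iff_norm_sub_tendsto_zero.1 hd).pow 2)
    simpa using this
  have h1 := (Real.continuous_sqrt.tendsto 0).comp h0
  rw [Real.sqrt_zero] at h1
  exact h1.congr fun n => Real.sqrt_sq (norm_nonneg _)

theorem integrable_halfLine_weight : MemLp (fun x : ℝ => (1 + x)⁻¹) 2 halfLine := by
  have hc : ContinuousOn (fun x : ℝ => (1 + x)⁻¹) (Ioi 0) :=
    ContinuousOn.inv₀ (by fun_prop) fun x hx => by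
      have : (0 : ℝ) < x := hx
      positivity
  refine (memLp_two_iff_integrable_sq (μ := halfLine)
    (hc.aestronglyMeasurable measurableSet_Ioi)).2 ?_
  refine Integrable.mono' (integrable_inv_one_add_sq.mono_measure Measure.restrict_le_self)
    ((hc.pow 2).aestronglyMeasurable measurableSet_Ioi) (ae_halfLine_of_forall fun x hx => ?_)
  rw [Real.norm_eq_abs, abs_of_nonneg (by positivity), inv_pow]
  refine inv_anti₀ (by positivity) ?_
  nlinarith

/-- The factorization q = (1+x)^(-1) · (1+x)q is a product of two L² functions. -/
theorem HPlus.integrable (q : HPlus) : Integrable q halfLine := by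
  have h1 : MemLp (fun x => q x + x * q x) 2 halfLine := q.memLp.add q.memLp_mul
  refine (integrable_halfLine_weight.integrable_mul h1).congr (ae_halfLine_of_forall fun x hx => ?_)
  have : (1 + x) ≠ 0 := by positivity
  simp only [Pi.mul_apply]
  field_simp

/-! ### Hermite polynomials -/

/-- The probabilists' Hermite polynomials as functions on `ℝ`. -/
noncomputable def herm (n : ℕ) (y : ℝ) : ℝ := Polynomial.aeval y (Polynomial.hermite n)

theorem derivative_hermite_succ (n : ℕ) : Polynomial.derivative (Polynomial.hermite (n + 1)) =
    ((n + 1 : ℕ) : Polynomial ℤ) * Polynomial.hermite n := by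
  induction n with
  | zero => simp
  | succ n ih =>
    rw [Polynomial.hermite_succ (n + 1), map_sub, Polynomial.derivative_mul, ih,
      Polynomial.derivative_natCast_mul, Polynomial.hermite_succ n]
    simp
    ring

theorem herm_zero (y : ℝ) : herm 0 y = 1 := by simp [herm]

theorem herm_one (y : ℝ) : herm 1 y = y := by simp [herm]

theorem herm_add_two (n : ℕ) (y : ℝ) : herm (n + 2) y = y * herm (n + 1) y - (n + 1) * herm n y := by
  have h := Polynomial.hermite_succ (n + 1)
  rw [derivative_hermite_succ] at h
  simp only [herm, h]
  simp

theorem hasDerivAt_herm_succ (n : ℕ) (y : ℝ) :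
    HasDerivAt (herm (n + 1)) ((n + 1) * herm n y) y := by
  have h := (Polynomial.hermite (n + 1)).hasDerivAt_aeval y
  rw [derivative_hermite_succ] at h
  have h' : Polynomial.aeval y (((n + 1 : ℕ) : Polynomial ℤ) * Polynomial.hermite n) =
      (n + 1) * herm n y := by
    simp [herm]
  rwa [h'] at h

theorem hasDerivAt_herm (n : ℕ) (y : ℝ) : HasDerivAt (herm n) (y * herm n y - herm (n + 1) y) y := by
  have h := (Polynomial.hermite n).hasDerivAt_aeval y
  have h2 := Polynomial.hermite_succ n
  have h3 : Polynomial.aeval y (Polynomial.derivative (Polynomial.hermite n)) =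
      y * herm n y - herm (n + 1) y := by
    simp only [herm, h2]
    simp
  rwa [h3] at h

theorem herm_odd_zero (k : ℕ) : herm (2 * k + 1) 0 = 0 := by
  induction k with
  | zero => simp [herm_one]
  | succ k ih => rw [show 2 * (k + 1) + 1 = (2 * k + 1) + 2 by ring, herm_add_two, ih]; ring

theorem herm_even_zero (k : ℕ) : herm (2 * k) 0 = (-1) ^ k * coeffE k * (2 ^ k * k !) := by
  induction k with
  | zero => simp [herm_zero, coeffE_zero]
  | succ k ih =>
    rw [show 2 * (k + 1) = 2 * k + 2 by ring, herm_add_two, ih, coeffE_succ, Nat.factorial_succ]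
    have h2 : (2 * k + 2 : ℝ) ≠ 0 := by positivity
    push_cast
    field_simp
    ring

theorem exists_abs_aeval_le (p : Polynomial ℤ) :
    ∃ C, 0 ≤ C ∧ ∀ y : ℝ, |Polynomial.aeval y p| ≤ C * Real.exp |y| := by
  induction p using Polynomial.induction_on' with
  | add p q hp hq =>
    obtain ⟨C, hC, h⟩ := hp
    obtain ⟨D, hD, h'⟩ := hq
    refine ⟨C + D, add_nonneg hC hD, fun y => ?_⟩
    rw [map_add, add_mul]
    exact (abs_add_le _ _).trans (add_le_add (h y) (h' y))
  | monomial n a =>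
    refine ⟨|(a : ℝ)| * n !, by positivity, fun y => ?_⟩
    rw [Polynomial.aeval_monomial, abs_mul, abs_pow, mul_assoc]
    have h := Real.pow_div_factorial_le_exp |y| (abs_nonneg y) n
    rw [div_le_iff₀ (by positivity), mul_comm] at h
    exact mul_le_mul_of_nonneg_left h (abs_nonneg _)

/-! ### Hermite functions -/

theorem psi_eq (n : ℕ) (x : ℝ) : psi n x =
    (√(n ! * √Real.pi))⁻¹ * herm n (√2 * x) * Real.exp (-x ^ 2 / 2) := rfl

/-- The derivative of `ψ_n⁰`. -/
noncomputable def dpsi (n : ℕ) (x : ℝ) : ℝ := x * psi n x - √(2 * (n + 1)) * psi (n + 1) x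

theorem sqrt_factorial_succ (n : ℕ) :
    √((n + 1)! * √Real.pi) = √(n + 1) * √(n ! * √Real.pi) := by
  rw [Nat.factorial_succ, Nat.cast_mul, mul_assoc, Real.sqrt_mul (by positivity)]
  push_cast
  rfl

theorem sqrt_factorial_pos (n : ℕ) : 0 < √(n ! * √Real.pi) := by
  have := Real.pi_pos
  positivity

theorem hasDerivAt_psi (n : ℕ) (x : ℝ) : HasDerivAt (psi n) (dpsi n x) x := by
  have h1 : HasDerivAt (fun x : ℝ => √2 * x) (√2) x := by
    simpa using (hasDerivAt_id x).const_mul (√2)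
  have h2 := (hasDerivAt_herm n (√2 * x)).comp x h1
  have h3 : HasDerivAt (fun x : ℝ => Real.exp (-x ^ 2 / 2)) (Real.exp (-x ^ 2 / 2) * (-x)) x := by
    have h4 : HasDerivAt (fun x : ℝ => -x ^ 2 / 2) (-x) x := by
      have := ((hasDerivAt_pow 2 x).neg).div_const 2
      refine this.congr_deriv ?_
      norm_num
      ring
    exact h4.exp
  refine ((h2.const_mul (√(n ! * √Real.pi))⁻¹).mul h3).congr_deriv ?_
  have e2 : √2 * √2 = (2 : ℝ) := Real.mul_self_sqrt (by norm_num)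
  have e3 : √(2 * (n + 1) : ℝ) = √2 * √(n + 1) := Real.sqrt_mul (by norm_num) _
  have hp := (sqrt_factorial_pos n).ne'
  have hq : √(n + 1 : ℝ) ≠ 0 := by positivity
  rw [dpsi, psi_eq, psi_eq, sqrt_factorial_succ, e3]
  simp only [Function.comp_apply]
  field_simp
  linear_combination (x * herm n (√2 * x)) * e2

theorem psi_succ_mul_sqrt (n : ℕ) (x : ℝ) :
    x * psi (n + 1) x = √(2 * (n + 1)) / 2 * psi n x + √(2 * (n + 2)) / 2 * psi (n + 2) x := by
  have e2 : √2 * √2 = (2 : ℝ) := Real.mul_self_sqrt (by norm_num)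
  have e3 : √(2 * (n + 1) : ℝ) = √2 * √(n + 1) := Real.sqrt_mul (by norm_num) _
  have e4 : √(2 * (n + 2) : ℝ) = √2 * √(n + 2) := Real.sqrt_mul (by norm_num) _
  have e5 : √(n + 1 : ℝ) * √(n + 1) = n + 1 := Real.mul_self_sqrt (by positivity)
  have e6 : √((n + 1 : ℕ) + 1 : ℝ) = √(n + 2) := by push_cast; congr 1; ring
  have hp := (sqrt_factorial_pos n).ne'
  have hq : √(n + 1 : ℝ) ≠ 0 := by positivity
  have hr : √(n + 2 : ℝ) ≠ 0 := by positivity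
  rw [psi_eq, psi_eq, psi_eq, sqrt_factorial_succ (n + 1), sqrt_factorial_succ, e3, e4, e6,
    herm_add_two]
  generalize herm n (√2 * x) = u
  rw [mul_left_comm x]
  generalize herm (n + 1) (√2 * x) = v
  field_simp
  linear_combination (-u * √2) * e5 - (v * x) * e2

theorem psi_zero_mul (x : ℝ) : x * psi 0 x = √2 / 2 * psi 1 x := by
  have e2 : √2 * √2 = (2 : ℝ) := Real.mul_self_sqrt (by norm_num)
  rw [psi_eq, psi_eq, herm_zero, herm_one]
  simp
  field_simp
  linear_combination (-x) * e2

/-- `ψ' = -x ψ + √(2(n+1)) ψ_n` for `ψ = ψ_(n+1)`. -/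
theorem dpsi_succ (n : ℕ) (x : ℝ) :
    dpsi (n + 1) x = -(x * psi (n + 1) x) + √(2 * (n + 1)) * psi n x := by
  have e6 : √(2 * ((n + 1 : ℕ) + 1) : ℝ) = √(2 * (n + 2)) := by push_cast; congr 1; ring
  rw [dpsi, e6]
  linear_combination 2 * psi_succ_mul_sqrt n x

theorem hasDerivAt_dpsi (n : ℕ) (x : ℝ) :
    HasDerivAt (dpsi n) ((x ^ 2 - (2 * n + 1)) * psi n x) x := by
  have h1 := ((hasDerivAt_id x).mul (hasDerivAt_psi n x)).sub
    ((hasDerivAt_psi (n + 1) x).const_mul (√(2 * (n + 1))))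
  refine h1.congr_deriv ?_
  have e : √(2 * (n + 1) : ℝ) * √(2 * (n + 1)) = 2 * (n + 1) := Real.mul_self_sqrt (by positivity)
  rw [dpsi_succ, dpsi]
  simp only [id_eq]
  linear_combination (-psi n x) * e

theorem continuous_psi (n : ℕ) : Continuous (psi n) :=
  continuous_iff_continuousAt.2 fun x => (hasDerivAt_psi n x).continuousAt

theorem continuous_dpsi (n : ℕ) : Continuous (dpsi n) :=
  continuous_iff_continuousAt.2 fun x => (hasDerivAt_dpsi n x).continuousAt

theorem exists_abs_psi_le (n : ℕ) : ∃ C, 0 ≤ C ∧ ∀ x, |psi n x| ≤ C * Real.exp (-(x ^ 2 / 4)) := by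
  obtain ⟨C, hC, h⟩ := exists_abs_aeval_le (Polynomial.hermite n)
  have hp := sqrt_factorial_pos n
  refine ⟨(√(n ! * √Real.pi))⁻¹ * C * Real.exp 2, by positivity, fun x => ?_⟩
  rw [psi_eq, abs_mul, abs_mul, abs_of_pos (inv_pos.2 hp), Real.abs_exp, mul_assoc, mul_assoc,
    mul_assoc]
  refine mul_le_mul_of_nonneg_left ?_ (inv_pos.2 hp).le
  refine (mul_le_mul_of_nonneg_right (h (√2 * x)) (Real.exp_pos _).le).trans ?_
  rw [mul_assoc, ← Real.exp_add, ← Real.exp_add]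
  refine mul_le_mul_of_nonneg_left (Real.exp_le_exp.2 ?_) hC
  have e2 : √2 ^ 2 = (2 : ℝ) := Real.sq_sqrt (by norm_num)
  rw [abs_mul, abs_of_nonneg (Real.sqrt_nonneg 2), ← sq_abs x]
  -- Half of the Gaussian exponent absorbs the exponential bounding the polynomial: √2|x| - x²/2 ≤ 2
  -- - x²/4.
  nlinarith [sq_nonneg (|x| / 2 - √2)]

theorem mul_exp_neg_le (x : ℝ) : |x| * Real.exp (-(x ^ 2 / 4)) ≤ 4 * Real.exp (-(x ^ 2 / 8)) := by
  have h1 : |x| ≤ 4 * Real.exp (x ^ 2 / 8) := by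
    have := Real.add_one_le_exp (x ^ 2 / 8)
    rw [← sq_abs x] at this ⊢
    nlinarith [sq_nonneg (|x| - 2)]
  have h2 := mul_le_mul_of_nonneg_right h1 (Real.exp_pos (-(x ^ 2 / 4))).le
  rwa [mul_assoc, ← Real.exp_add, show x ^ 2 / 8 + -(x ^ 2 / 4) = -(x ^ 2 / 8) by ring] at h2

theorem exp_neg_sq_le (x : ℝ) : Real.exp (-(x ^ 2 / 4)) ≤ Real.exp (-(x ^ 2 / 8)) := by
  refine Real.exp_le_exp.2 ?_
  nlinarith [sq_nonneg x]

/-! ### Hermite functions as elements of H₊ -/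

theorem memLp_gaussian : MemLp (fun x : ℝ => Real.exp (-(x ^ 2 / 8))) 2 halfLine := by
  have hc : Continuous fun x : ℝ => Real.exp (-(x ^ 2 / 8)) := by fun_prop
  refine (memLp_two_iff_integrable_sq (μ := halfLine) hc.aestronglyMeasurable).2 ?_
  refine ((integrable_exp_neg_mul_sq (b := 1 / 4) (by norm_num)).mono_measure
    Measure.restrict_le_self).congr (Filter.Eventually.of_forall fun x => ?_)
  simp only
  rw [← Real.exp_nat_mul]
  congr 1
  push_cast
  ring

theorem memLp_of_bound {f : ℝ → ℝ} (hf : AEStronglyMeasurable f halfLine) {C : ℝ}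
    (h : ∀ᵐ x ∂halfLine, |f x| ≤ C * Real.exp (-(x ^ 2 / 8))) : MemLp f 2 halfLine := by
  refine (memLp_gaussian.const_mul C).mono hf ?_
  filter_upwards [h] with x hx
  rw [Real.norm_eq_abs]
  exact hx.trans (le_abs_self _)

/-- An element of `H₊` given by a locally Lipschitz function with Gaussian decay. -/
noncomputable def HPlus.ofBound (f : ℝ → ℝ)
    (h1 : ∀ R, 0 ≤ R → AbsolutelyContinuousOnInterval f 0 R) (C : ℝ)
    (h2 : ∀ x, 0 < x → |f x| ≤ C * Real.exp (-(x ^ 2 / 4)))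
    (h3 : ∀ᵐ x ∂halfLine, |deriv f x| ≤ C * Real.exp (-(x ^ 2 / 8))) : HPlus :=
  have hm : AEStronglyMeasurable f halfLine := by
    refine ContinuousOn.aestronglyMeasurable (fun x hx => ?_) measurableSet_Ioi
    have hx : 0 < x := hx
    refine ((h1 (x + 1) (by linarith)).continuousOn.continuousAt ?_).continuousWithinAt
    rw [uIcc_of_le (by linarith)]
    exact Icc_mem_nhds hx (by linarith)
  have hC : 0 ≤ C := by
    have := (abs_nonneg _).trans (h2 1 one_pos)
    exact nonneg_of_mul_nonneg_left this (Real.exp_pos _)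
  HPlus.mk f h1
    (memLp_of_bound hm (ae_halfLine_of_forall fun x hx =>
      (h2 x hx).trans (mul_le_mul_of_nonneg_left (exp_neg_sq_le x) hC)))
    (memLp_of_bound (stronglyMeasurable_deriv f).aestronglyMeasurable h3)
    (memLp_of_bound (C := C * 4)
      (continuous_id.aestronglyMeasurable.mul hm) (ae_halfLine_of_forall fun x hx => by
        rw [abs_mul]
        have e1 := mul_le_mul_of_nonneg_left (h2 x hx) (abs_nonneg x)
        have e2 := mul_le_mul_of_nonneg_left (mul_exp_neg_le x) hC
        linarith))

theorem HPlus.ofBound_apply {f : ℝ → ℝ} (h1) {C : ℝ} (h2 h3) {x : ℝ} (hx : 0 ≤ x) :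
    HPlus.ofBound f h1 C h2 h3 x = f x := by
  unfold HPlus.ofBound
  exact HPlus.mk_apply _ _ _ _ hx

theorem HPlus.deriv_ofBound {f : ℝ → ℝ} (h1) {C : ℝ} (h2 h3) {x : ℝ} (hx : 0 < x) :
    deriv (HPlus.ofBound f h1 C h2 h3) x = deriv f x := by
  unfold HPlus.ofBound
  exact HPlus.deriv_mk _ _ _ _ hx

theorem absolutelyContinuous_of_hasDerivAt {f f' : ℝ → ℝ} (h : ∀ x, HasDerivAt f (f' x) x)
    (hc : Continuous f') (a b : ℝ) : AbsolutelyContinuousOnInterval f a b := by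
  refine ContDiffOn.absolutelyContinuousOnInterval (ContDiff.contDiffOn ?_)
  refine contDiff_one_iff_deriv.2 ⟨fun x => (h x).differentiableAt, ?_⟩
  have : deriv f = f' := funext fun x => (h x).deriv
  rwa [this]

theorem exists_abs_dpsi_le (n : ℕ) :
    ∃ C, 0 ≤ C ∧ ∀ x, |dpsi n x| ≤ C * Real.exp (-(x ^ 2 / 8)) := by
  obtain ⟨C, hC, h⟩ := exists_abs_psi_le n
  obtain ⟨D, hD, h'⟩ := exists_abs_psi_le (n + 1)
  refine ⟨C * 4 + √(2 * (n + 1)) * D, by positivity, fun x => ?_⟩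
  rw [dpsi]
  refine (abs_sub _ _).trans ?_
  rw [abs_mul, abs_mul, abs_of_nonneg (Real.sqrt_nonneg _), add_mul]
  refine add_le_add ?_ ?_
  · have e1 := mul_le_mul_of_nonneg_left (h x) (abs_nonneg x)
    have e2 := mul_le_mul_of_nonneg_left (mul_exp_neg_le x) hC
    linarith
  · rw [mul_assoc]
    refine mul_le_mul_of_nonneg_left ?_ (Real.sqrt_nonneg _)
    exact (h' x).trans (mul_le_mul_of_nonneg_left (exp_neg_sq_le x) hD)

theorem exists_psiH (n : ℕ) : ∃ p : HPlus, (∀ x, 0 ≤ x → p x = psi n x) ∧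
    ∀ x, 0 < x → deriv p x = dpsi n x := by
  obtain ⟨C, hC, h⟩ := exists_abs_psi_le n
  obtain ⟨D, hD, h'⟩ := exists_abs_dpsi_le n
  refine ⟨HPlus.ofBound (psi n)
    (fun R _ => absolutelyContinuous_of_hasDerivAt (hasDerivAt_psi n) (continuous_dpsi n) 0 R)
    (C + D) (fun x _ => (h x).trans ?_) (ae_halfLine_of_forall fun x _ => ?_), fun x hx => ?_,
    fun x hx => ?_⟩
  · exact mul_le_mul_of_nonneg_right (by linarith) (Real.exp_pos _).le
  · rw [(hasDerivAt_psi n x).deriv]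
    exact (h' x).trans (mul_le_mul_of_nonneg_right (by linarith) (Real.exp_pos _).le)
  · exact HPlus.ofBound_apply _ _ _ hx
  · exact (HPlus.deriv_ofBound _ _ _ hx).trans (hasDerivAt_psi n x).deriv

/-- `ψ_n⁰` as an element of `H₊`. -/
noncomputable def psiH (n : ℕ) : HPlus := (exists_psiH n).choose

theorem psiH_apply (n : ℕ) {x : ℝ} (hx : 0 ≤ x) : psiH n x = psi n x :=
  (exists_psiH n).choose_spec.1 x hx

theorem deriv_psiH (n : ℕ) {x : ℝ} (hx : 0 < x) : deriv (psiH n) x = dpsi n x :=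
  (exists_psiH n).choose_spec.2 x hx

theorem psi_odd_zero (k : ℕ) : psi (2 * k + 1) 0 = 0 := by
  rw [psi_eq, mul_zero, herm_odd_zero]; ring

theorem dpsi_even_zero (k : ℕ) : dpsi (2 * k) 0 = 0 := by
  rw [dpsi, psi_odd_zero]; ring

/-- By the ladder relations ψ_{2k}' is a combination of neighbouring ψ_j, hence lies in H₊ and may
enter the integration by parts. -/
theorem exists_dpsiH (k : ℕ) : ∃ p : HPlus, (∀ x, 0 ≤ x → p x = dpsi (2 * k) x) ∧
    ∀ x, 0 < x → deriv p x = (x ^ 2 - (4 * k + 1)) * psi (2 * k) x := by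
  have key : ∃ p : HPlus, ∀ x, 0 ≤ x → p x = dpsi (2 * k) x := by
    rcases k with _ | k
    · refine ⟨(-(√2 / 2)) • psiH 1, fun x hx => ?_⟩
      rw [HPlus.smul_apply, psiH_apply 1 hx, dpsi, mul_zero, psi_zero_mul]
      norm_num
      ring
    · refine ⟨(√(2 * ((2 * k + 1 : ℕ) + 1)) / 2) • psiH (2 * k + 1) +
        (-(√(2 * ((2 * k + 1 : ℕ) + 2)) / 2)) • psiH (2 * k + 3), fun x hx => ?_⟩
      rw [HPlus.add_apply, HPlus.smul_apply, HPlus.smul_apply, psiH_apply _ hx, psiH_apply _ hx,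
        show 2 * (k + 1) = (2 * k + 1) + 1 by ring, dpsi_succ, psi_succ_mul_sqrt]
      ring
  obtain ⟨p, hp⟩ := key
  refine ⟨p, hp, fun x hx => ?_⟩
  have h : (p : ℝ → ℝ) =ᶠ[nhds x] dpsi (2 * k) := by
    filter_upwards [Ioi_mem_nhds hx] with y hy
    exact hp y (le_of_lt hy)
  rw [h.deriv_eq, (hasDerivAt_dpsi _ x).deriv]
  push_cast
  ring

theorem integrable_mul_psi (q : HPlus) (n : ℕ) : Integrable (fun x => q x * psi n x) halfLine :=
  (q.memLp.integrable_mul (psiH n).memLp).congr (ae_halfLine_of_forall fun x hx => by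
    rw [Pi.mul_apply, psiH_apply n hx.le])

/-- The inner product is the form of -d²/dx² + x² + 1, and ψ_{2k} satisfies the natural Neumann
condition at 0. The factor is the eigenvalue 4k+1 plus 1. -/
theorem inner_psiH (q : HPlus) (k : ℕ) :
    inner ℝ q (psiH (2 * k)) = (4 * k + 2) * ∫ x, q x * psi (2 * k) x ∂halfLine := by
  obtain ⟨p, hp, hp'⟩ := exists_dpsiH k
  have h1 := q.integral_deriv_mul p le_rfl
  rw [hp 0 le_rfl, dpsi_even_zero, mul_zero, neg_zero] at h1
  have h2 : inner ℝ q (psiH (2 * k)) =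
      ∫ x, ((4 * k + 2) * (q x * psi (2 * k) x) + (deriv q x * p x + q x * deriv p x)) ∂halfLine := by
    rw [HPlus.inner_def]
    refine integral_congr_ae (ae_halfLine_of_forall fun x hx => ?_)
    simp only
    rw [psiH_apply _ hx.le, deriv_psiH _ hx, hp x hx.le, hp' x hx]
    ring
  have hi : Integrable (fun x => deriv q x * p x + q x * deriv p x) halfLine :=
    (q.memLp_deriv.integrable_mul p.memLp).add (q.memLp.integrable_mul p.memLp_deriv)
  rw [h2, integral_add ((integrable_mul_psi q _).const_mul _) hi, integral_const_mul]
  have h3 : ∫ x, (deriv q x * p x + q x * deriv p x) ∂halfLine = 0 := h1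
  rw [h3, add_zero]

/-- Symmetry of the inner product of H₊ against two distinct eigenvalues. -/
theorem integral_psi_mul_psi_of_ne {j k : ℕ} (h : j ≠ k) :
    ∫ x, psi (2 * j) x * psi (2 * k) x ∂halfLine = 0 := by
  have h1 := inner_psiH (psiH (2 * j)) k
  have h2 := inner_psiH (psiH (2 * k)) j
  have e1 : ∫ x, psiH (2 * j) x * psi (2 * k) x ∂halfLine =
      ∫ x, psi (2 * j) x * psi (2 * k) x ∂halfLine :=
    integral_congr_ae (ae_halfLine_of_forall fun x hx => by
      simp only
      rw [psiH_apply _ hx.le])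
  have e2 : ∫ x, psiH (2 * k) x * psi (2 * j) x ∂halfLine =
      ∫ x, psi (2 * j) x * psi (2 * k) x ∂halfLine :=
    integral_congr_ae (ae_halfLine_of_forall fun x hx => by
      simp only
      rw [psiH_apply _ hx.le, mul_comm])
  rw [e1] at h1
  rw [e2, real_inner_comm, h1] at h2
  have h3 : (k : ℝ) - j ≠ 0 := sub_ne_zero.2 (by exact_mod_cast h.symm)
  have h4 : ((k : ℝ) - j) * ∫ x, psi (2 * j) x * psi (2 * k) x ∂halfLine = 0 := by linarith
  exact (mul_eq_zero.1 h4).resolve_left h3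

/-- The ladder relations give (ψ_n ψ_{n+1})' = √(2(n+1)) (ψ_n² - ψ_{n+1}²). The boundary value at 0
vanishes because one of the two functions is odd, so all the norms equal the Gaussian one. -/
theorem integral_psi_sq (n : ℕ) : ∫ x, psi n x * psi n x ∂halfLine = 1 / 2 := by
  induction n with
  | zero =>
    have h : ∀ x, psi 0 x * psi 0 x = (√Real.pi)⁻¹ * Real.exp (-1 * x ^ 2) := fun x => by
      rw [psi_eq, herm_zero]
      have e : √(√Real.pi) * √(√Real.pi) = √Real.pi := Real.mul_self_sqrt (Real.sqrt_nonneg _)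
      have e2 : Real.exp (-1 * x ^ 2) = Real.exp (-x ^ 2 / 2) * Real.exp (-x ^ 2 / 2) := by
        rw [← Real.exp_add]; congr 1; ring
      have e3 : √(√Real.pi) ≠ 0 := by
        have := Real.pi_pos
        positivity
      have e4 : (√Real.pi)⁻¹ = (√(√Real.pi))⁻¹ * (√(√Real.pi))⁻¹ := by rw [← mul_inv, e]
      rw [e2, e4]
      simp only [Nat.factorial_zero, Nat.cast_one, one_mul]
      ring
    simp_rw [h]
    rw [integral_const_mul, halfLine, integral_gaussian_Ioi]
    have := Real.sqrt_pos.2 Real.pi_pos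
    simp
    field_simp
  | succ n ih =>
    rw [← ih]
    have h1 := (psiH n).integral_deriv_mul (psiH (n + 1)) le_rfl
    have h0 : psi n 0 * psi (n + 1) 0 = 0 := by
      obtain ⟨m, rfl | rfl⟩ := n.even_or_odd'
      · rw [psi_odd_zero, mul_zero]
      · rw [psi_odd_zero, zero_mul]
    rw [psiH_apply _ le_rfl, psiH_apply _ le_rfl, h0, neg_zero] at h1
    have h2 : ∫ x in Ioi 0, (deriv (psiH n) x * psiH (n + 1) x + psiH n x * deriv (psiH (n + 1)) x) =
        ∫ x, √(2 * (n + 1)) * (psi n x * psi n x - psi (n + 1) x * psi (n + 1) x) ∂halfLine := by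
      refine integral_congr_ae (ae_halfLine_of_forall fun x hx => ?_)
      simp only
      rw [psiH_apply _ hx.le, psiH_apply _ hx.le, deriv_psiH _ hx, deriv_psiH _ hx, dpsi_succ, dpsi]
      ring
    have hi : ∀ m, Integrable (fun x => psi m x * psi m x) halfLine := fun m =>
      (integrable_mul_psi (psiH m) m).congr (ae_halfLine_of_forall fun x hx => by
        simp only
        rw [psiH_apply _ hx.le])
    rw [h2, integral_const_mul, integral_sub (hi _) (hi _)] at h1
    have h3 : √(2 * (n + 1) : ℝ) ≠ 0 := by positivity
    have := (mul_eq_zero.1 h1).resolve_left h3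
    linarith

/-! ### Completeness of the even Hermite functions -/

theorem HPlus.integrable_pow_mul_psi (q : HPlus) (j n : ℕ) :
    Integrable (fun x => x ^ j * q x * psi n x) halfLine := by
  obtain ⟨C, hC, h⟩ := exists_abs_psi_le n
  have hm : MemLp (fun x => x ^ j * psi n x) 2 halfLine := by
    refine memLp_of_bound (C := j ! * (C * Real.exp 2))
      ((continuous_pow j).mul (continuous_psi n)).aestronglyMeasurable
      (Filter.Eventually.of_forall fun x => ?_)
    have h1 := Real.pow_div_factorial_le_exp |x| (abs_nonneg x) j
    rw [div_le_iff₀ (by positivity), mul_comm] at h1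
    rw [abs_mul, abs_pow]
    refine (mul_le_mul h1 (h x) (abs_nonneg _) (by positivity)).trans ?_
    rw [mul_mul_mul_comm, mul_assoc, mul_assoc, mul_assoc, ← Real.exp_add, ← Real.exp_add]
    have h2 : |x| + -(x ^ 2 / 4) ≤ 2 + -(x ^ 2 / 8) := by
      rw [← sq_abs x]
      nlinarith [sq_nonneg (|x| - 4)]
    gcongr
  refine (q.memLp.integrable_mul hm).congr (Filter.Eventually.of_forall fun x => ?_)
  simp only [Pi.mul_apply]
  ring

/-- The three-term recurrence trades a power of x for neighbouring indices and preserves the parity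
of n + j. The case n = 0 supplies the even moments of q e^(-x²/2). -/
theorem HPlus.integral_pow_mul_psi (q : HPlus) (h : ∀ k, ∫ x, q x * psi (2 * k) x ∂halfLine = 0)
    (j : ℕ) : ∀ n, Even (n + j) → ∫ x, x ^ j * q x * psi n x ∂halfLine = 0 := by
  induction j with
  | zero =>
    intro n hn
    obtain ⟨k, rfl⟩ := even_iff_two_dvd.1 (by simpa using hn)
    simpa using h k
  | succ j ih =>
    intro n hn
    rcases n with _ | n
    · have e : ∀ x, x ^ (j + 1) * q x * psi 0 x = √2 / 2 * (x ^ j * q x * psi 1 x) := fun x => by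
        linear_combination (x ^ j * q x) * psi_zero_mul x
      simp_rw [e]
      rw [integral_const_mul, ih 1 (by rwa [add_comm, ← zero_add (j + 1)]), mul_zero]
    · have e : ∀ x, x ^ (j + 1) * q x * psi (n + 1) x = √(2 * (n + 1)) / 2 * (x ^ j * q x * psi n x) +
          √(2 * (n + 2)) / 2 * (x ^ j * q x * psi (n + 2) x) := fun x => by
        linear_combination (x ^ j * q x) * psi_succ_mul_sqrt n x
      have hn1 : Even (n + j) := by
        rw [show n + 1 + (j + 1) = n + j + 2 by ring] at hn
        exact (Nat.even_add.1 hn).2 even_two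
      simp_rw [e]
      rw [integral_add ((q.integrable_pow_mul_psi j n).const_mul _)
        ((q.integrable_pow_mul_psi j (n + 2)).const_mul _), integral_const_mul,
        integral_const_mul, ih n hn1, ih (n + 2) (by rw [add_right_comm]; exact hn1.add even_two)]
      simp

/-- A continuous function with Gaussian decay all of whose moments vanish is zero. -/
theorem eq_zero_of_moments {w : ℝ → ℝ} (hc : Continuous w) {C : ℝ}
    (hb : ∀ x, |w x| ≤ C * Real.exp (-(x ^ 2 / 2)))
    (hm : ∀ j : ℕ, ∫ x, x ^ j * w x = 0) : w = 0 := by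
  have hC : 0 ≤ C := nonneg_of_mul_nonneg_left ((abs_nonneg _).trans (hb 0)) (Real.exp_pos _)
  -- Gaussian decay beats every exponential; this dominates the power series of the Fourier kernel.
  have hexp : ∀ c : ℝ, Integrable fun x => Real.exp |c * x| * |w x| := fun c => by
    refine Integrable.mono' ((integrable_exp_neg_mul_sq (b := 1 / 4) (by norm_num)).const_mul
      (C * Real.exp (c ^ 2))) (by fun_prop) (Filter.Eventually.of_forall fun x => ?_)
    rw [Real.norm_eq_abs, abs_of_nonneg (by positivity)]
    refine (mul_le_mul_of_nonneg_left (hb x) (Real.exp_pos _).le).trans ?_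
    rw [mul_left_comm, ← Real.exp_add, mul_assoc, ← Real.exp_add]
    refine mul_le_mul_of_nonneg_left (Real.exp_le_exp.2 ?_) hC
    rw [abs_mul, ← sq_abs x, ← sq_abs c]
    nlinarith [sq_nonneg (|c| - |x| / 2)]
  have hi : Integrable fun x => (w x : ℂ) := by
    have h0 := hexp 0
    simp only [zero_mul, abs_zero, Real.exp_zero, one_mul] at h0
    exact ((integrable_norm_iff hc.aestronglyMeasurable).1 h0).ofReal
  have hF : FourierTransform.fourier (fun x => (w x : ℂ)) = fun _ : ℝ => (0 : ℂ) := by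
    funext ξ
    rw [Real.fourier_real_eq_integral_exp_smul]
    -- Expanding the exponential termwise turns the Fourier transform into a series of moments, all
    -- zero; Fourier inversion then finishes.
    have hs := hasSum_integral_of_dominated_convergence (μ := volume) (ι := ℕ)
      (F := fun n (x : ℝ) => ((↑(-2 * Real.pi * x * ξ) * Complex.I) ^ n / n !) * (w x : ℂ))
      (f := fun x : ℝ => Complex.exp (↑(-2 * Real.pi * x * ξ) * Complex.I) • (w x : ℂ))
      (fun n x => |(-2 * Real.pi * ξ) * x| ^ n / n ! * |w x|)
      (fun n => by fun_prop)
      (fun n => Filter.Eventually.of_forall fun x => by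
        rw [norm_mul, norm_div, norm_pow, norm_mul, Complex.norm_I, mul_one, Complex.norm_natCast,
          Complex.norm_real, Complex.norm_real, Real.norm_eq_abs, Real.norm_eq_abs,
          mul_right_comm (-2 * Real.pi)])
      (Filter.Eventually.of_forall fun x =>
        (Real.summable_pow_div_factorial _).mul_right _)
      (by
        refine (hexp (-2 * Real.pi * ξ)).congr (Filter.Eventually.of_forall fun x => ?_)
        simp only
        rw [tsum_mul_right, Real.exp_eq_exp_ℝ, NormedSpace.exp_eq_tsum_div])
      (Filter.Eventually.of_forall fun x => by
        rw [smul_eq_mul]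
        refine HasSum.mul_right _ ?_
        rw [Complex.exp_eq_exp_ℂ]
        exact NormedSpace.expSeries_div_hasSum_exp _)
    refine hs.unique ?_
    have hz : ∀ n : ℕ, ∫ x : ℝ, ((↑(-2 * Real.pi * x * ξ) * Complex.I) ^ n / n !) * (w x : ℂ) = 0 := by
      intro n
      have e : ∀ x : ℝ, ((↑(-2 * Real.pi * x * ξ) * Complex.I) ^ n / n !) * (w x : ℂ) =
          (((-2 * Real.pi * ξ : ℝ) * Complex.I) ^ n / n !) * ((x ^ n * w x : ℝ) : ℂ) := fun x => by
        push_cast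
        rw [show (-2 * (Real.pi : ℂ) * x * ξ) * Complex.I = (-2 * Real.pi * ξ * Complex.I) * x by ring,
          mul_pow]
        ring
      simp_rw [e]
      have e2 : ∫ x : ℝ, ((x ^ n * w x : ℝ) : ℂ) = ((∫ x, x ^ n * w x : ℝ) : ℂ) := integral_ofReal
      rw [integral_const_mul, e2, hm n, Complex.ofReal_zero, mul_zero]
    simp_rw [hz]
    exact hasSum_zero
  have hinv := (Complex.continuous_ofReal.comp hc).fourierInv_fourier_eq hi (by
    change Integrable (FourierTransform.fourier (fun x => (w x : ℂ)))
    rw [hF]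
    exact integrable_zero _ _ _)
  change FourierTransformInv.fourierInv (FourierTransform.fourier (fun x => (w x : ℂ))) = _ at hinv
  rw [hF] at hinv
  funext x
  have h1 := congrFun hinv x
  rw [Real.fourierInv_eq] at h1
  simpa using h1.symm

theorem integral_even_pow_mul {j : ℕ} (hj : Even j) (g : ℝ → ℝ) :
    ∫ x, x ^ j * (g |x| * Real.exp (-x ^ 2 / 2)) =
      2 * ∫ x, x ^ j * (g x * Real.exp (-x ^ 2 / 2)) ∂halfLine := by
  rw [halfLine, ← integral_comp_abs (f := fun x => x ^ j * (g x * Real.exp (-x ^ 2 / 2)))]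
  simp only [sq_abs, hj.pow_abs]

theorem integral_odd_pow_mul {j : ℕ} (hj : Odd j) (g : ℝ → ℝ) :
    ∫ x, x ^ j * (g |x| * Real.exp (-x ^ 2 / 2)) = 0 := by
  have h1 := integral_neg_eq_self (fun x : ℝ => x ^ j * (g |x| * Real.exp (-x ^ 2 / 2))) volume
  have e : ∀ x : ℝ, (-x) ^ j * (g |-x| * Real.exp (-(-x) ^ 2 / 2)) =
      -(x ^ j * (g |x| * Real.exp (-x ^ 2 / 2))) := fun x => by
    rw [hj.neg_pow, abs_neg, neg_sq, neg_mul]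
  simp_rw [e] at h1
  rw [integral_neg] at h1
  linarith

/-- Applied to the even extension q(|x|) e^(-x²/2): its even moments vanish by hypothesis, its odd
ones by symmetry. -/
theorem HPlus.eq_zero_of_integral_mul_psi (q : HPlus)
    (h : ∀ k, ∫ x, q x * psi (2 * k) x ∂halfLine = 0) : q = 0 := by
  have hw : (fun x => q |x| * Real.exp (-x ^ 2 / 2)) = 0 := by
    refine eq_zero_of_moments (C := ‖q‖) ?_ (fun x => ?_) fun j => ?_
    · exact (q.continuousOn.comp_continuous continuous_abs fun x => abs_nonneg x).mul (by fun_prop)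
    · rw [abs_mul, Real.abs_exp, neg_div]
      exact mul_le_mul_of_nonneg_right (q.abs_apply_le (abs_nonneg x)) (Real.exp_pos _).le
    · rcases Nat.even_or_odd j with hj | hj
      · rw [integral_even_pow_mul hj]
        have h1 := q.integral_pow_mul_psi h j 0 (by simpa using hj)
        have e2 : ∀ x, x ^ j * q x * psi 0 x = (√((0 : ℕ)! * √Real.pi))⁻¹ *
            (x ^ j * (q x * Real.exp (-x ^ 2 / 2))) := fun x => by
          rw [psi_eq, herm_zero]; ring
        simp_rw [e2] at h1
        rw [integral_const_mul] at h1
        have h2 := (mul_eq_zero.1 h1).resolve_left (inv_ne_zero (sqrt_factorial_pos 0).ne')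
        rw [h2, mul_zero]
      · exact integral_odd_pow_mul hj q
  refine HPlus.ext fun x hx => ?_
  have h1 := congrFun hw x
  simp only [abs_of_nonneg hx, Pi.zero_apply] at h1
  exact (mul_eq_zero.1 h1).resolve_right (Real.exp_pos _).ne'

/-! ### The Hilbert basis of even Hermite functions -/

theorem inner_psiH_psiH (j k : ℕ) :
    inner ℝ (psiH (2 * j)) (psiH (2 * k)) = if j = k then (2 * k + 1 : ℝ) else 0 := by
  have e1 : ∫ x, psiH (2 * j) x * psi (2 * k) x ∂halfLine =
      ∫ x, psi (2 * j) x * psi (2 * k) x ∂halfLine :=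
    integral_congr_ae (ae_halfLine_of_forall fun x hx => by
      simp only
      rw [psiH_apply _ hx.le])
  rw [inner_psiH, e1]
  split_ifs with h
  · subst h
    rw [integral_psi_sq]
    ring
  · rw [integral_psi_mul_psi_of_ne h, mul_zero]

theorem orthonormal_psiH : Orthonormal ℝ fun k : ℕ => (√(2 * k + 1))⁻¹ • psiH (2 * k) := by
  rw [orthonormal_iff_ite]
  intro j k
  rw [real_inner_smul_left, real_inner_smul_right, inner_psiH_psiH]
  split_ifs with h
  · subst h
    have h1 : √(2 * (j : ℝ) + 1) * √(2 * j + 1) = 2 * j + 1 := Real.mul_self_sqrt (by positivity)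
    have h2 : √(2 * (j : ℝ) + 1) ≠ 0 := by positivity
    generalize √(2 * (j : ℝ) + 1) = s at h1 h2
    rw [← h1]
    field_simp
  · ring

/-- The orthonormal basis `ψ_{2k} / √(2k+1)` of `H₊`. -/
noncomputable def psiBasis : HilbertBasis ℕ ℝ HPlus :=
  HilbertBasis.mkOfOrthogonalEqBot orthonormal_psiH (by
    rw [Submodule.eq_bot_iff]
    intro q hq
    refine q.eq_zero_of_integral_mul_psi fun k => ?_
    have h1 : inner ℝ q ((√(2 * (k : ℝ) + 1))⁻¹ • psiH (2 * k)) = 0 :=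
      Submodule.inner_left_of_mem_orthogonal (Submodule.subset_span (mem_range_self k)) hq
    rw [real_inner_smul_right, inner_psiH] at h1
    have h2 : (√(2 * (k : ℝ) + 1))⁻¹ ≠ 0 := by positivity
    have h3 : (4 * (k : ℝ) + 2) ≠ 0 := by positivity
    exact (mul_eq_zero.1 ((mul_eq_zero.1 h1).resolve_left h2)).resolve_left h3)

theorem psiBasis_apply (k : ℕ) : psiBasis k = (√(2 * k + 1))⁻¹ • psiH (2 * k) := by
  rw [psiBasis, HilbertBasis.coe_mkOfOrthogonalEqBot]

theorem psiBasis_repr (q : HPlus) (k : ℕ) :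
    psiBasis.repr q k = 2 * √(2 * k + 1) * ∫ x, q x * psi (2 * k) x ∂halfLine := by
  rw [HilbertBasis.repr_apply_apply, psiBasis_apply, real_inner_smul_left, real_inner_comm,
    inner_psiH]
  have h1 : √(2 * (k : ℝ) + 1) * √(2 * k + 1) = 2 * k + 1 := Real.mul_self_sqrt (by positivity)
  have h2 : √(2 * (k : ℝ) + 1) ≠ 0 := by positivity
  rw [show (4 * k + 2 : ℝ) = 2 * (√(2 * k + 1) * √(2 * k + 1)) by rw [h1]; ring]
  field_simp

/-- The expansion of `q ∈ H₊` in even Hermite functions. -/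
theorem HPlus.hasSum_psi (q : HPlus) {x : ℝ} (hx : 0 ≤ x) :
    HasSum (fun k => 2 * (∫ y, q y * psi (2 * k) y ∂halfLine) * psi (2 * k) x) (q x) := by
  -- The series converges in H₊, where evaluation is continuous, hence pointwise up to x = 0.
  have h := (psiBasis.hasSum_repr q).mapL (HPlus.eval x hx)
  refine h.congr_fun fun k => ?_
  have e : HPlus.eval x hx (psiBasis.repr q k • psiBasis k) =
      psiBasis.repr q k * ((√(2 * k + 1))⁻¹ * psiH (2 * k) x) := by
    rw [psiBasis_apply, map_smul, map_smul]
    rfl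
  rw [e, psiBasis_repr, psiH_apply _ hx]
  have h2 : √(2 * (k : ℝ) + 1) ≠ 0 := by positivity
  field_simp

theorem HPlus.hasSum_sq (q : HPlus) :
    HasSum (fun k : ℕ => 4 * (2 * k + 1) * (∫ y, q y * psi (2 * k) y ∂halfLine) ^ 2) (‖q‖ ^ 2) := by
  have h := psiBasis.hasSum_inner_mul_inner q q
  rw [real_inner_self_eq_norm_sq] at h
  refine h.congr_fun fun k => ?_
  rw [real_inner_comm (psiBasis k) q, ← HilbertBasis.repr_apply_apply, psiBasis_repr]
  have h1 : √(2 * (k : ℝ) + 1) * √(2 * k + 1) = 2 * k + 1 := Real.mul_self_sqrt (by positivity)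
  linear_combination (-(4 : ℝ) * (∫ y, q y * psi (2 * k) y ∂halfLine) ^ 2) * h1

theorem HPlus.exists_integral_mul_psi {α : ℕ → ℝ} (h : Summable fun k : ℕ => (2 * k + 1) * α k ^ 2) :
    ∃ q : HPlus, ∀ k, ∫ y, q y * psi (2 * k) y ∂halfLine = α k := by
  have hm : Memℓp (fun k : ℕ => 2 * √(2 * k + 1) * α k) 2 := by
    refine memℓp_gen ((h.mul_left 4).congr fun k => ?_)
    have h1 : √(2 * (k : ℝ) + 1) ^ 2 = 2 * k + 1 := Real.sq_sqrt (by positivity)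
    simp only [ENNReal.toReal_ofNat, Real.rpow_ofNat, Real.norm_eq_abs, sq_abs]
    rw [mul_pow, mul_pow, h1]
    ring
  refine ⟨psiBasis.repr.symm ⟨_, hm⟩, fun k => ?_⟩
  have h1 := psiBasis_repr (psiBasis.repr.symm ⟨_, hm⟩) k
  rw [LinearIsometryEquiv.apply_symm_apply] at h1
  have h2 : √(2 * (k : ℝ) + 1) ≠ 0 := by positivity
  exact (mul_left_cancel₀ (mul_ne_zero two_ne_zero h2) h1).symm

/-- Evaluation at a point has norm at most one on `H₊`. -/
theorem exists_hasSum_psi_sq {x : ℝ} (hx : 0 ≤ x) :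
    ∃ s ≤ 1, HasSum (fun m : ℕ => psi (2 * m) x ^ 2 / (2 * m + 1)) s := by
  -- Parseval for the Riesz representer of evaluation at x.
  set r := (InnerProductSpace.toDual ℝ HPlus).symm (HPlus.eval x hx) with hr
  have h := psiBasis.hasSum_inner_mul_inner r r
  rw [real_inner_self_eq_norm_sq] at h
  have hn : ‖r‖ ≤ 1 := by
    rw [hr, LinearIsometryEquiv.norm_map]
    exact HPlus.norm_eval_le x hx
  refine ⟨‖r‖ ^ 2, pow_le_one₀ (norm_nonneg _) hn, h.congr_fun fun m => ?_⟩
  have e : inner ℝ r (psiBasis m) = (√(2 * (m : ℝ) + 1))⁻¹ * psi (2 * m) x := by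
    rw [hr, InnerProductSpace.toDual_symm_apply, psiBasis_apply, map_smul, ← psiH_apply _ hx]
    rfl
  rw [real_inner_comm r, e]
  have h1 : √(2 * (m : ℝ) + 1) * √(2 * m + 1) = 2 * m + 1 := Real.mul_self_sqrt (by positivity)
  have h2 : √(2 * (m : ℝ) + 1) ≠ 0 := by positivity
  generalize √(2 * (m : ℝ) + 1) = s at h1 h2
  rw [← h1]
  field_simp

/-! ### Dilations -/

theorem memLp_comp_mul {f : ℝ → ℝ} {a : ℝ} (ha : 0 < a) (hf : MemLp f 2 halfLine)
    (hm : AEStronglyMeasurable (fun x => f (a * x)) halfLine) :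
    MemLp (fun x => f (a * x)) 2 halfLine := by
  refine (memLp_two_iff_integrable_sq hm).2 ?_
  have h1 := (memLp_two_iff_integrable_sq hf.1).1 hf
  have h2 := integrableOn_Ioi_comp_mul_left_iff (fun x => f x ^ 2) 0 ha
  rw [mul_zero] at h2
  exact h2.2 h1

theorem HPlus.exists_dilate (q : HPlus) {a : ℝ} (ha : 0 < a) :
    ∃ p : HPlus, ∀ x, 0 ≤ x → p x = q (a * x) := by
  have hd : deriv (fun x => q (a * x)) = fun x => a * deriv q (a * x) :=
    funext fun x => deriv_comp_mul_left a q x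
  have hm : AEStronglyMeasurable (fun x => q (a * x)) halfLine := by
    refine ContinuousOn.aestronglyMeasurable ?_ measurableSet_Ioi
    refine q.continuousOn.comp (by fun_prop) fun x hx => ?_
    have hx : 0 < x := hx
    exact (mul_pos ha hx).le
  have hr : MemLp (fun x => a * deriv q (a * x)) 2 halfLine := by
    refine (memLp_comp_mul ha q.memLp_deriv ?_).const_mul a
    exact ((stronglyMeasurable_deriv q).comp_measurable
      (measurable_const_mul a)).aestronglyMeasurable
  refine ⟨HPlus.mk (fun x => q (a * x)) (fun R hR => ?_) (memLp_comp_mul ha q.memLp hm)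
    (by rwa [hd]) ?_, fun x hx => HPlus.mk_apply _ _ _ _ hx⟩
  · refine (absolutelyContinuous_integral hr (q 0) hR).congr fun x hx => ?_
    rw [uIcc_of_le hR] at hx
    have h0 := q.apply_eq_integral (mul_nonneg ha.le hx.1)
    simp only
    rw [h0, intervalIntegral.integral_const_mul, intervalIntegral.mul_integral_comp_mul_left,
      mul_zero]
  · have hx : AEStronglyMeasurable (fun x => (a * x) * q (a * x)) halfLine :=
      AEStronglyMeasurable.mul (by fun_prop) hm
    refine ((memLp_comp_mul (f := fun x => x * q x) ha q.memLp_mul hx).const_mul a⁻¹).ae_eq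
      (Filter.Eventually.of_forall fun x => ?_)
    simp only
    field_simp

/-! ### The coefficients of `F q` -/

/-- The Taylor coefficients of `F q`. -/
noncomputable def coefF (q : HPlus) (k : ℕ) : ℝ :=
  (2 * Real.pi) ^ (-(1 / 4) : ℝ) * √(coeffE k) * ∫ x, q x * psiTilde (2 * k) x ∂halfLine

theorem integral_mul_psiTilde {q p : HPlus} (h : ∀ x, 0 ≤ x → q x = p (√2 * x)) (n : ℕ) :
    ∫ x, q x * psiTilde n x ∂halfLine =
      (2 : ℝ) ^ (-(1 / 4) : ℝ) * ∫ x, p x * psi n x ∂halfLine := by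
  have h1 := integral_comp_mul_left_Ioi (fun x => p x * psi n x) 0
    (Real.sqrt_pos.2 (zero_lt_two' ℝ))
  have h2 : ∫ x, q x * psiTilde n x ∂halfLine =
      ∫ x, (2 : ℝ) ^ (1 / 4 : ℝ) * (p (√2 * x) * psi n (√2 * x)) ∂halfLine :=
    integral_congr_ae (ae_halfLine_of_forall fun x hx => by
      simp only
      rw [h x hx.le, psiTilde]
      ring)
  rw [mul_zero] at h1
  have h3 : ∫ x, p (√2 * x) * psi n (√2 * x) ∂halfLine =
      (√2)⁻¹ * ∫ x, p x * psi n x ∂halfLine := h1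
  rw [h2, integral_const_mul, h3, ← mul_assoc, Real.sqrt_eq_rpow, ← Real.rpow_neg zero_le_two,
    ← Real.rpow_add zero_lt_two]
  norm_num

theorem coefF_eq {q p : HPlus} (h : ∀ x, 0 ≤ x → q x = p (√2 * x)) (k : ℕ) :
    coefF q k = (2 * Real.pi) ^ (-(1 / 4) : ℝ) * (2 : ℝ) ^ (-(1 / 4) : ℝ) * √(coeffE k) *
      ∫ x, p x * psi (2 * k) x ∂halfLine := by
  rw [coefF, integral_mul_psiTilde h]
  ring

theorem HPlus.exists_undilate (q : HPlus) : ∃ p : HPlus, ∀ x, 0 ≤ x → q x = p (√2 * x) := by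
  have h2 : 0 < √(2 : ℝ) := Real.sqrt_pos.2 (zero_lt_two' ℝ)
  obtain ⟨p, hp⟩ := q.exists_dilate (inv_pos.2 h2)
  refine ⟨p, fun x hx => ?_⟩
  rw [hp _ (mul_nonneg h2.le hx), inv_mul_cancel_left₀ h2.ne']

/-- Together with `weight_mul_coeffE_le`, this makes the ℓ²_{3/4} weight times E_k comparable to the
H₊ weight 2k+1. -/
theorem half_le_weight_mul_coeffE (k : ℕ) : (1 + k : ℝ) / 2 ≤ (1 + k : ℝ) ^ (2 * (3 / 4) : ℝ) * coeffE k := by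
  have h0 : (0 : ℝ) < 1 + k := by positivity
  have hE := coeffE_pos k
  rw [show (2 * (3 / 4) : ℝ) = 1 + 1 / 2 by norm_num, Real.rpow_add h0, Real.rpow_one,
    ← Real.sqrt_eq_rpow, mul_assoc, div_eq_mul_inv]
  refine mul_le_mul_of_nonneg_left ?_ h0.le
  refine (abs_le_of_sq_le_sq' ?_ (by positivity)).2
  rw [mul_pow, Real.sq_sqrt h0.le]
  nlinarith [one_le_coeffE_sq_mul k, sq_nonneg (coeffE k)]

theorem weight_mul_coeffE_le (k : ℕ) : (1 + k : ℝ) ^ (2 * (3 / 4) : ℝ) * coeffE k ≤ 1 + k := by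
  have h0 : (0 : ℝ) < 1 + k := by positivity
  have hE := coeffE_pos k
  rw [show (2 * (3 / 4) : ℝ) = 1 + 1 / 2 by norm_num, Real.rpow_add h0, Real.rpow_one,
    ← Real.sqrt_eq_rpow, mul_assoc]
  refine mul_le_of_le_one_right h0.le ?_
  refine (abs_le_of_sq_le_sq' ?_ zero_le_one).2
  rw [mul_pow, Real.sq_sqrt h0.le]
  have : (0 : ℝ) ≤ coeffE k ^ 2 * k := by positivity
  nlinarith [coeffE_sq_mul_le k]

theorem coefF_mem (q : HPlus) : coefF q ∈ ell2Submodule (3 / 4) := by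
  obtain ⟨p, hp⟩ := q.exists_undilate
  set c : ℝ := (2 * Real.pi) ^ (-(1 / 4) : ℝ) * (2 : ℝ) ^ (-(1 / 4) : ℝ) with hc
  refine Summable.of_nonneg_of_le (fun k => by positivity) (fun k => ?_)
    (p.hasSum_sq.summable.mul_left (c ^ 2))
  rw [coefF_eq hp, ← hc, mul_pow, mul_pow, Real.sq_sqrt (coeffE_pos k).le]
  set I := (∫ x, p x * psi (2 * k) x ∂halfLine) ^ 2
  have h1 : (1 + k : ℝ) ^ (2 * (3 / 4) : ℝ) * (c ^ 2 * coeffE k * I) =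
    c ^ 2 * (((1 + k : ℝ) ^ (2 * (3 / 4) : ℝ) * coeffE k) * I) := by ring
  rw [h1]
  refine mul_le_mul_of_nonneg_left (mul_le_mul_of_nonneg_right ?_ (sq_nonneg _)) (sq_nonneg _)
  have := weight_mul_coeffE_le k
  have h2 : (0 : ℝ) ≤ k := k.cast_nonneg
  linarith

theorem integrable_psiTilde (n : ℕ) : Integrable (psiTilde n) halfLine := by
  obtain ⟨p, hp⟩ := (psiH n).exists_dilate (Real.sqrt_pos.2 (zero_lt_two' ℝ))
  refine (p.integrable.const_mul ((2 : ℝ) ^ (1 / 4 : ℝ))).congr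
    (ae_halfLine_of_forall fun x hx => ?_)
  simp only
  rw [hp x hx.le, psiH_apply n (by positivity), psiTilde]

theorem integrable_mul_psiTilde (q : HPlus) (n : ℕ) :
    Integrable (fun x => q x * psiTilde n x) halfLine :=
  (integrable_psiTilde n).bdd_mul q.memLp.1 (c := ‖q‖)
    (ae_halfLine_of_forall fun _ hx => q.abs_apply_le hx.le)

/-- `q ↦ F q`, as a linear map to sequences of Taylor coefficients. -/
noncomputable def coefFLinear : HPlus →ₗ[ℝ] Ell2 (3 / 4) where
  toFun q := ⟨coefF q, coefF_mem q⟩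
  map_add' q p := Subtype.ext (funext fun k => by
    change coefF (q + p) k = coefF q k + coefF p k
    rw [coefF, coefF, coefF, ← mul_add,
      ← integral_add (integrable_mul_psiTilde q _) (integrable_mul_psiTilde p _)]
    refine congrArg (fun t => _ * t)
      (integral_congr_ae (Filter.Eventually.of_forall fun x => ?_))
    simp only [HPlus.add_apply]
    ring)
  map_smul' a q := Subtype.ext (funext fun k => by
    change coefF (a • q) k = a * coefF q k
    rw [coefF, coefF, mul_left_comm, ← integral_const_mul a]
    refine congrArg (fun t => _ * t)
      (integral_congr_ae (Filter.Eventually.of_forall fun x => ?_))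
    simp only [HPlus.smul_apply]
    ring)

theorem continuous_coefF (k : ℕ) : Continuous fun q => coefF q k := by
  set L : HPlus →ₗ[ℝ] ℝ := (Ell2.coord (3 / 4) k).toLinearMap ∘ₗ coefFLinear
  have hb : ∀ q, ‖L q‖ ≤ (|(2 * Real.pi) ^ (-(1 / 4) : ℝ) * √(coeffE k)| *
      ∫ x, |psiTilde (2 * k) x| ∂halfLine) * ‖q‖ := fun q => by
    change |coefF q k| ≤ _
    rw [coefF, abs_mul, mul_assoc |_|]
    refine mul_le_mul_of_nonneg_left ?_ (abs_nonneg _)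
    rw [← integral_mul_const]
    refine (abs_integral_le_integral_abs).trans (integral_mono_ae
      (integrable_mul_psiTilde q _).abs ((integrable_psiTilde _).abs.mul_const _)
      (ae_halfLine_of_forall fun x hx => ?_))
    simp only
    rw [abs_mul, mul_comm]
    exact mul_le_mul_of_nonneg_left (q.abs_apply_le hx.le) (abs_nonneg _)
  exact (L.mkContinuous _ hb).continuous

/-- A dilation by √2 replaces ψ̃ by ψ. The orthogonal basis of H₊ then gives injectivity and
surjectivity, the factor √E_k being absorbed by the comparison of weights. -/
theorem exists_coefF_equiv : ∃ T : HPlus →L[ℝ] Ell2 (3 / 4), Function.Bijective T ∧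
    ∀ q, (T q).1 = coefF q := by
  refine ⟨⟨coefFLinear, Ell2.continuous_of_apply _ continuous_coefF⟩, ⟨?_, fun c => ?_⟩,
    fun q => rfl⟩
  · refine (injective_iff_map_eq_zero _).2 fun q hq => ?_
    obtain ⟨p, hp⟩ := q.exists_undilate
    have h0 : p = 0 := p.eq_zero_of_integral_mul_psi fun k => by
      have h1 : coefF q k = 0 := congrFun (congrArg Subtype.val hq) k
      rw [coefF_eq hp] at h1
      refine (mul_eq_zero.1 h1).resolve_left ?_
      have := coeffE_pos k
      have := Real.pi_pos
      positivity
    refine HPlus.ext fun x hx => ?_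
    rw [hp x hx, h0]
    rfl
  · set a : ℝ := (2 * Real.pi) ^ (-(1 / 4) : ℝ) * (2 : ℝ) ^ (-(1 / 4) : ℝ) with ha
    have ha0 : a ≠ 0 := by
      have := Real.pi_pos
      positivity
    have hs : Summable fun k : ℕ => (2 * k + 1) * (c k / (a * √(coeffE k))) ^ 2 := by
      refine Summable.of_nonneg_of_le (fun k => by positivity) (fun k => ?_)
        (c.2.mul_left (4 * a⁻¹ ^ 2))
      have hE := coeffE_pos k
      rw [div_pow, mul_pow, Real.sq_sqrt hE.le]
      have h1 : (2 * k + 1 : ℝ) ≤ 4 * ((1 + k : ℝ) ^ (2 * (3 / 4) : ℝ) * coeffE k) := by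
        have := half_le_weight_mul_coeffE k
        linarith
      have h2 : (2 * k + 1 : ℝ) * (c k ^ 2 / (a ^ 2 * coeffE k)) ≤
          4 * ((1 + k : ℝ) ^ (2 * (3 / 4) : ℝ) * coeffE k) * (c k ^ 2 / (a ^ 2 * coeffE k)) :=
        mul_le_mul_of_nonneg_right h1 (by positivity)
      refine h2.trans (le_of_eq ?_)
      field_simp
    obtain ⟨p, hp⟩ := HPlus.exists_integral_mul_psi hs
    obtain ⟨q, hq⟩ := p.exists_dilate (Real.sqrt_pos.2 (zero_lt_two' ℝ))
    refine ⟨q, Subtype.ext (funext fun k => ?_)⟩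
    change coefF q k = c k
    have hE : √(coeffE k) ≠ 0 := (Real.sqrt_pos.2 (coeffE_pos k)).ne'
    rw [coefF_eq hq, hp, ← ha]
    field_simp

/-! ### The boundary value q(0) as F(-1) -/

theorem psi_even_zero (k : ℕ) :
    psi (2 * k) 0 = (-1) ^ k * √(coeffE k) * Real.pi ^ (-(1 / 4) : ℝ) := by
  have hpi := Real.pi_pos
  have hE := coeffE_pos k
  have hf : ((2 * k)! : ℝ) = coeffE k * (2 ^ k * k !) ^ 2 := by
    rw [coeffE]
    field_simp
    ring
  have h1 : √((2 * k)! * √Real.pi : ℝ) = √(coeffE k) * (2 ^ k * k !) * Real.pi ^ (1 / 4 : ℝ) := by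
    rw [hf, Real.sqrt_mul (by positivity), Real.sqrt_mul hE.le, Real.sqrt_sq (by positivity),
      Real.sqrt_eq_rpow, Real.sqrt_eq_rpow, Real.sqrt_eq_rpow, ← Real.rpow_mul hpi.le]
    norm_num
  have h2 : √(coeffE k) * √(coeffE k) = coeffE k := Real.mul_self_sqrt hE.le
  have h3 : √(coeffE k) ≠ 0 := (Real.sqrt_pos.2 hE).ne'
  rw [psi_eq, h1, mul_zero, herm_even_zero, Real.rpow_neg hpi.le]
  have h4 : Real.pi ^ (1 / 4 : ℝ) ≠ 0 := by positivity
  have h5 : (2 : ℝ) ^ k * k ! ≠ 0 := by positivity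
  generalize √(coeffE k) = s at h2 h3
  rw [← h2, show -(0 : ℝ) ^ 2 / 2 = 0 by norm_num, Real.exp_zero]
  field_simp

/-- This is the Hermite expansion at x = 0, where ψ_{2k}(0) supplies exactly the factor (-1)^k √E_k.
-/
theorem hasSum_coefF_neg_one_pow (q : HPlus) :
    HasSum (fun k => (-1) ^ k * coefF q k) (q 0 / (2 * √2)) := by
  obtain ⟨p, hp⟩ := q.exists_undilate
  have h0 : p 0 = q 0 := by rw [hp 0 le_rfl, mul_zero]
  have h1 := (p.hasSum_psi le_rfl).div_const (2 * √2)
  rw [h0] at h1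
  refine h1.congr_fun fun k => ?_
  have hpi := Real.pi_pos
  have e1 : (2 * Real.pi) ^ (-(1 / 4) : ℝ) = (2 : ℝ) ^ (-(1 / 4) : ℝ) * Real.pi ^ (-(1 / 4) : ℝ) :=
    Real.mul_rpow zero_le_two hpi.le
  have e2 : (2 : ℝ) ^ (-(1 / 4) : ℝ) * (2 : ℝ) ^ (-(1 / 4) : ℝ) = (√2)⁻¹ := by
    rw [← Real.rpow_add zero_lt_two, Real.sqrt_eq_rpow, ← Real.rpow_neg zero_le_two]
    norm_num
  rw [coefF_eq hp, psi_even_zero, e1, mul_right_comm _ _ ((2 : ℝ) ^ (-(1 / 4) : ℝ)), e2]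
  field_simp

/-! ### The coefficients of `G_D q` -/

/-- The Taylor coefficients of `G_D q`. -/
noncomputable def coefG (q : HPlus) (m : ℕ) : ℝ :=
  PowerSeries.coeff m (dirSeries (PowerSeries.mk (coefF q)))

theorem summable_abs_coefF (q : HPlus) : Summable fun k => |coefF q k| :=
  Ell2.summable_abs (by norm_num) ⟨coefF q, coefF_mem q⟩

theorem coefG_mem (q : HPlus) : coefG q ∈ ell2Submodule (3 / 4) :=
  (isSobolev_mk ⟨coefF q, coefF_mem q⟩).dirSeries

theorem summable_abs_coefG (q : HPlus) : Summable fun k => |coefG q k| :=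
  Ell2.summable_abs (by norm_num) ⟨coefG q, coefG_mem q⟩

theorem summable_norm_mul_pow {c : ℕ → ℝ} (hc : Summable fun k => |c k|) {z : ℂ} (hz : ‖z‖ ≤ 1) :
    Summable fun k => ‖(c k : ℂ) * z ^ k‖ := by
  refine Summable.of_nonneg_of_le (fun k => norm_nonneg _) (fun k => ?_) hc
  rw [norm_mul, norm_pow, Complex.norm_real, Real.norm_eq_abs]
  exact mul_le_of_le_one_right (abs_nonneg _) (pow_le_one₀ (norm_nonneg _) hz)

theorem hasSum_sqrt_mul_funF (q : HPlus) {z : ℂ} (hz : ‖z‖ ≤ 1) :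
    HasSum (fun n => ((PowerSeries.coeff n (PowerSeries.mk sqrtCoeff *
      PowerSeries.mk (coefF q)) : ℝ) : ℂ) * z ^ n) ((1 - z) ^ (1 / 2 : ℂ) * funF q z) := by
  have h := hasSum_powerSeries_mul (summable_norm_sqrtCoeff_mul_pow hz)
    (summable_norm_mul_pow (summable_abs_coefF q) hz)
  rwa [tsum_sqrtCoeff_mul_pow hz] at h

/-- Antisymmetrizing √(1-z) F(z) cancels the even powers; absolute convergence makes this valid on
the closed disc. -/
theorem hasSum_coefG_mul_sq (q : HPlus) {z : ℂ} (hz : ‖z‖ ≤ 1) :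
    HasSum (fun m => (coefG q m : ℂ) * (z ^ 2) ^ m * z)
      ((funF q (-z) * (1 + z) ^ (1 / 2 : ℂ) - funF q z * (1 - z) ^ (1 / 2 : ℂ)) / 2) := by
  have h1 := hasSum_sqrt_mul_funF q hz
  have h2 := hasSum_sqrt_mul_funF q (z := -z) (by rwa [norm_neg])
  set a : ℕ → ℝ := fun n =>
    PowerSeries.coeff n (PowerSeries.mk sqrtCoeff * PowerSeries.mk (coefF q)) with ha
  have h3 := (h2.sub h1).div_const 2
  rw [sub_neg_eq_add, mul_comm _ (funF q (-z)), mul_comm _ (funF q z)] at h3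
  have h4 : Function.Injective fun m : ℕ => 2 * m + 1 := fun i j hij => by
    simp only at hij
    omega
  refine ((h4.hasSum_iff ?_).2 h3).congr_fun fun m => ?_
  · intro n hn
    have he : Even n := by
      by_contra ho
      obtain ⟨m, rfl⟩ := Nat.not_even_iff_odd.1 ho
      exact hn ⟨m, rfl⟩
    rw [he.neg_pow]
    ring
  · have e : coefG q m = - a (2 * m + 1) := by
      simp [coefG, dirSeries, oddPart, ha]
    rw [e]
    simp only [Function.comp_apply]
    have ho : Odd (2 * m + 1) := ⟨m, rfl⟩
    rw [ho.neg_pow]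
    push_cast
    ring

/-- At z = 1 the term with √(1-z) vanishes and G(1) = F(-1) √2 / 2. -/
theorem hasSum_coefG (q : HPlus) : HasSum (fun m => coefG q m) (q 0 / 4) := by
  have h1 := hasSum_coefG_mul_sq q (z := 1) (by simp)
  have h2 : funF q (-1) = ((q 0 / (2 * √2) : ℝ) : ℂ) := by
    rw [← (Complex.hasSum_ofReal.2 (hasSum_coefF_neg_one_pow q)).tsum_eq]
    refine tsum_congr fun k => ?_
    rw [← coefF]
    push_cast
    ring
  have h3 : ((1 : ℂ) + 1) ^ (1 / 2 : ℂ) = ((√2 : ℝ) : ℂ) := by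
    rw [Real.sqrt_eq_rpow, Complex.ofReal_cpow zero_le_two]
    norm_num
  rw [h2, h3, sub_self, Complex.zero_cpow (by norm_num), mul_zero, sub_zero] at h1
  simp only [one_pow, mul_one] at h1
  rw [← Complex.ofReal_mul, ← Complex.ofReal_ofNat, ← Complex.ofReal_div,
    Complex.hasSum_ofReal] at h1
  convert h1 using 1
  have : √(2 : ℝ) ≠ 0 := by positivity
  field_simp
  norm_num

/-! ### Squares of Hermite functions -/

/-- `He_{2k}(√2 y) / (2^k k!)`. -/
noncomputable def hermEven (k : ℕ) (y : ℝ) : ℝ := herm (2 * k) (√2 * y) / (2 ^ k * k !)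

/-- The derivative of `hermEven k`. -/
noncomputable def dhermEven (k : ℕ) (y : ℝ) : ℝ :=
  √2 * (√2 * y * herm (2 * k) (√2 * y) - herm (2 * k + 1) (√2 * y)) / (2 ^ k * k !)

theorem hasDerivAt_hermEven (k : ℕ) (y : ℝ) : HasDerivAt (hermEven k) (dhermEven k y) y := by
  have h1 : HasDerivAt (fun x : ℝ => √2 * x) (√2) y := by
    simpa using (hasDerivAt_id y).const_mul (√2)
  refine (((hasDerivAt_herm (2 * k) (√2 * y)).comp y h1).div_const _).congr_deriv ?_
  rw [dhermEven]
  ring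

theorem dhermEven_zero (y : ℝ) : dhermEven 0 y = 0 := by
  simp [dhermEven, herm_zero, herm_one]

/-- Three-term recurrence in derivative form; convolved with E it gives the recursion
`dhermConv_succ`, which drives the linearization of squares. -/
theorem dhermEven_succ_add (k : ℕ) (y : ℝ) :
    dhermEven (k + 1) y + dhermEven k y = 2 * y * hermEven k y := by
  have h2 : √2 * √2 = (2 : ℝ) := Real.mul_self_sqrt (by norm_num)
  have e1 := herm_add_two (2 * k + 1) (√2 * y)
  have e2 : herm (2 * (k + 1)) (√2 * y) = herm (2 * k + 1 + 1) (√2 * y) := rfl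
  have e3 : herm (2 * (k + 1) + 1) (√2 * y) = herm (2 * k + 1 + 2) (√2 * y) := rfl
  rw [dhermEven, dhermEven, hermEven, e2, e3, e1, Nat.factorial_succ]
  generalize herm (2 * k + 1 + 1) (√2 * y) = a
  generalize herm (2 * k + 1) (√2 * y) = b
  generalize herm (2 * k) (√2 * y) = c
  push_cast
  field_simp
  linear_combination (c * y * 2 ^ k * 2 * (k + 1)) * h2

/-- `∑_{k ≤ n} E_{n-k} He_{2k}(√2 y) / (2^k k!)`. -/
noncomputable def hermConv (n : ℕ) (y : ℝ) : ℝ :=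
  ∑ k ∈ Finset.range (n + 1), coeffE (n - k) * hermEven k y

/-- The derivative of `hermConv n`. -/
noncomputable def dhermConv (n : ℕ) (y : ℝ) : ℝ :=
  ∑ k ∈ Finset.range (n + 1), coeffE (n - k) * dhermEven k y

theorem hasDerivAt_hermConv (n : ℕ) (y : ℝ) : HasDerivAt (hermConv n) (dhermConv n y) y :=
  HasDerivAt.fun_sum fun k _ => (hasDerivAt_hermEven k y).const_mul _

theorem dhermConv_succ (n : ℕ) (y : ℝ) :
    dhermConv (n + 1) y = 2 * y * hermConv n y - dhermConv n y := by
  rw [dhermConv, Finset.sum_range_succ', dhermEven_zero, mul_zero, add_zero, hermConv, dhermConv,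
    Finset.mul_sum, ← Finset.sum_sub_distrib]
  refine Finset.sum_congr rfl fun k _ => ?_
  rw [Nat.succ_sub_succ]
  linear_combination coeffE (n - k) * dhermEven_succ_add k y

/-- At the origin the convolution has generating function (1+z)^(-1/2) (1-z)^(-1/2) = (1-z²)^(-1/2).
-/
theorem hermConv_apply_zero (n : ℕ) : hermConv n 0 = herm n 0 ^ 2 / n ! := by
  have h1 : hermConv n 0 =
      PowerSeries.coeff n (PowerSeries.evalNegHom (PowerSeries.mk coeffE) * PowerSeries.mk coeffE) := by
    rw [PowerSeries.coeff_mul, Finset.Nat.sum_antidiagonal_eq_sum_range_succ (fun i j =>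
      PowerSeries.coeff i (PowerSeries.evalNegHom (PowerSeries.mk coeffE)) *
        PowerSeries.coeff j (PowerSeries.mk coeffE)), hermConv]
    refine Finset.sum_congr rfl fun k _ => ?_
    rw [hermEven, mul_zero, herm_even_zero, PowerSeries.evalNegHom, PowerSeries.coeff_rescale,
      PowerSeries.coeff_mk, PowerSeries.coeff_mk]
    field_simp
  rw [h1, mul_comm, mk_coeffE_mul_evalNegHom]
  obtain ⟨j, rfl | rfl⟩ := n.even_or_odd'
  · rw [coeff_even_expandTwo, PowerSeries.coeff_mk, herm_even_zero]
    have hf : ((2 * j)! : ℝ) = coeffE j * (2 ^ j * j !) ^ 2 := by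
      rw [coeffE]
      field_simp
      ring
    have hE := (coeffE_pos j).ne'
    rw [hf, mul_pow, mul_pow, ← pow_mul, mul_comm j 2, pow_mul]
    norm_num
    field_simp
  · rw [coeff_odd_expandTwo, herm_odd_zero]
    simp

/-- The linearization of squares of Hermite polynomials. -/
theorem herm_sq (n : ℕ) (y : ℝ) : herm n y ^ 2 / n ! = hermConv n y := by
  induction n generalizing y with
  | zero => simp [hermConv, hermEven, herm_zero, coeffE_zero]
  | succ n ih =>
    have h1 : ∀ m y, HasDerivAt (fun y => herm m y ^ 2 / m !)
        (2 * herm m y * (y * herm m y - herm (m + 1) y) / m !) y := fun m y => by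
      refine (((hasDerivAt_herm m y).pow 2).div_const _).congr_deriv ?_
      simp
    have h2 : ∀ y, dhermConv n y = 2 * herm n y * (y * herm n y - herm (n + 1) y) / n ! := fun y => by
      refine (hasDerivAt_hermConv n y).unique ?_
      rw [show hermConv n = fun y => herm n y ^ 2 / n ! from funext fun y => (ih y).symm]
      exact h1 n y
    -- Both sides obey C_{n+1}' = 2y C_n - C_n', so they differ by a constant, which vanishes at y =
    -- 0.
    have h3 : ∀ y, HasDerivAt (fun y => herm (n + 1) y ^ 2 / (n + 1)! - hermConv (n + 1) y) 0 y :=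
      fun y => by
        refine ((((hasDerivAt_herm_succ n y).pow 2).div_const _).sub
          (hasDerivAt_hermConv (n + 1) y)).congr_deriv ?_
        rw [dhermConv_succ, h2, ← ih, Nat.factorial_succ]
        push_cast
        field_simp
        ring
    have h4 := is_const_of_deriv_eq_zero (fun y => (h3 y).differentiableAt) (fun y => (h3 y).deriv)
      y 0
    simp only [hermConv_apply_zero (n + 1), sub_self] at h4
    linarith

theorem two_pi_rpow_mul_psiTilde (k : ℕ) (x : ℝ) :
    (2 * Real.pi) ^ (-(1 / 4) : ℝ) * √(coeffE k) * psiTilde (2 * k) x =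
      (√Real.pi)⁻¹ * hermEven k (√2 * x) * Real.exp (-x ^ 2) := by
  have hpi := Real.pi_pos
  have hE := coeffE_pos k
  have hf : ((2 * k)! : ℝ) = coeffE k * (2 ^ k * k !) ^ 2 := by
    rw [coeffE]
    field_simp
    ring
  have h1 : √((2 * k)! * √Real.pi : ℝ) = √(coeffE k) * (2 ^ k * k !) * Real.pi ^ (1 / 4 : ℝ) := by
    rw [hf, Real.sqrt_mul (by positivity), Real.sqrt_mul hE.le, Real.sqrt_sq (by positivity),
      Real.sqrt_eq_rpow, Real.sqrt_eq_rpow, Real.sqrt_eq_rpow, ← Real.rpow_mul hpi.le]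
    norm_num
  have h2 : √Real.pi = Real.pi ^ (1 / 4 : ℝ) * Real.pi ^ (1 / 4 : ℝ) := by
    rw [← Real.rpow_add hpi, Real.sqrt_eq_rpow]
    norm_num
  have h3 : √(coeffE k) ≠ 0 := (Real.sqrt_pos.2 hE).ne'
  have h4 : Real.pi ^ (1 / 4 : ℝ) ≠ 0 := by positivity
  have h5 : (2 : ℝ) ^ (1 / 4 : ℝ) ≠ 0 := by positivity
  have h6 : -(√2 * x) ^ 2 / 2 = -x ^ 2 := by
    rw [mul_pow, Real.sq_sqrt zero_le_two]
    ring
  rw [psiTilde, psi_eq, h1, h2, h6, hermEven, Real.rpow_neg (by positivity),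
    Real.mul_rpow zero_le_two hpi.le]
  field_simp

theorem psi_sq (n : ℕ) (x : ℝ) : psi n x ^ 2 = ∑ k ∈ Finset.range (n + 1),
    coeffE (n - k) * ((2 * Real.pi) ^ (-(1 / 4) : ℝ) * √(coeffE k) * psiTilde (2 * k) x) := by
  have hpi := Real.pi_pos
  have h1 : (√(n ! * √Real.pi)) ^ 2 = n ! * √Real.pi := Real.sq_sqrt (by positivity)
  have h2 : Real.exp (-x ^ 2 / 2) ^ 2 = Real.exp (-x ^ 2) := by
    rw [← Real.exp_nat_mul]
    congr 1
    push_cast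
    ring
  have h3 : psi n x ^ 2 = (√Real.pi)⁻¹ * Real.exp (-x ^ 2) * (herm n (√2 * x) ^ 2 / n !) := by
    rw [psi_eq, mul_pow, mul_pow, inv_pow, h1, h2]
    field_simp
  rw [h3, herm_sq, hermConv, Finset.mul_sum]
  refine Finset.sum_congr rfl fun k _ => ?_
  rw [two_pi_rpow_mul_psiTilde]
  ring

/-- Linearizing ψ_n² turns q̂ into the convolution of E with the coefficients of F, that is, into
the coefficients of F(z)/√(1-z). -/
theorem qHat_eq (q : HPlus) (n : ℕ) :
    qHat q n = PowerSeries.coeff n (PowerSeries.mk coeffE * PowerSeries.mk (coefF q)) := by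
  rw [mul_comm, PowerSeries.coeff_mul, Finset.Nat.sum_antidiagonal_eq_sum_range_succ (fun i j =>
    PowerSeries.coeff i (PowerSeries.mk (coefF q)) * PowerSeries.coeff j (PowerSeries.mk coeffE)),
    qHat]
  have h1 : ∀ x, q x * psi n x ^ 2 = ∑ k ∈ Finset.range (n + 1),
      coeffE (n - k) * ((2 * Real.pi) ^ (-(1 / 4) : ℝ) * √(coeffE k)) *
        (q x * psiTilde (2 * k) x) := fun x => by
    rw [psi_sq, Finset.mul_sum]
    exact Finset.sum_congr rfl fun k _ => by ring
  simp_rw [h1]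
  rw [integral_finsetSum _ fun k _ => (integrable_mul_psiTilde q _).const_mul _]
  refine Finset.sum_congr rfl fun k _ => ?_
  rw [integral_const_mul, PowerSeries.coeff_mk, PowerSeries.coeff_mk, coefF]
  ring

theorem coefG_eq (q : HPlus) (m : ℕ) : coefG q m = qHat q (2 * m) - qHat q (2 * m + 1) := by
  rw [coefG, coeff_dirSeries, qHat_eq, qHat_eq]

/-! ### Gaussian cosine and sine transforms -/

/-- `∫₀^∞ t^k cos(y t) e^(-t²/2) dt`. -/
noncomputable def gaussCos (k : ℕ) (y : ℝ) : ℝ :=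
  ∫ t, t ^ k * Real.exp (-t ^ 2 / 2) * Real.cos (y * t) ∂halfLine

/-- `∫₀^∞ t^k sin(y t) e^(-t²/2) dt`. -/
noncomputable def gaussSin (k : ℕ) (y : ℝ) : ℝ :=
  ∫ t, t ^ k * Real.exp (-t ^ 2 / 2) * Real.sin (y * t) ∂halfLine

theorem integrable_pow_mul_gauss (k : ℕ) :
    Integrable (fun t : ℝ => t ^ k * Real.exp (-t ^ 2 / 2)) halfLine := by
  have h := integrable_rpow_mul_exp_neg_mul_sq (b := 1 / 2) (by norm_num) (s := k)
    (by linarith [k.cast_nonneg (α := ℝ)])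
  refine (h.mono_measure Measure.restrict_le_self).congr (Filter.Eventually.of_forall fun t => ?_)
  simp only [Real.rpow_natCast]
  congr 2
  ring

theorem integrable_pow_mul_gauss_mul (k : ℕ) {f : ℝ → ℝ} (hf : Continuous f)
    (hb : ∀ t, |f t| ≤ 1) :
    Integrable (fun t : ℝ => t ^ k * Real.exp (-t ^ 2 / 2) * f t) halfLine :=
  (integrable_pow_mul_gauss k).mul_bdd (c := 1) hf.aestronglyMeasurable
    (Filter.Eventually.of_forall hb)

theorem integrable_gaussCos (k : ℕ) (y : ℝ) :
    Integrable (fun t : ℝ => t ^ k * Real.exp (-t ^ 2 / 2) * Real.cos (y * t)) halfLine :=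
  integrable_pow_mul_gauss_mul k (by fun_prop) fun _ => Real.abs_cos_le_one _

theorem integrable_gaussSin (k : ℕ) (y : ℝ) :
    Integrable (fun t : ℝ => t ^ k * Real.exp (-t ^ 2 / 2) * Real.sin (y * t)) halfLine :=
  integrable_pow_mul_gauss_mul k (by fun_prop) fun _ => Real.abs_sin_le_one _

theorem hasDerivAt_gaussCos (k : ℕ) (y : ℝ) : HasDerivAt (gaussCos k) (-gaussSin (k + 1) y) y := by
  have h := hasDerivAt_integral_of_dominated_loc_of_deriv_le (μ := halfLine) (x₀ := y)
    (s := univ) (bound := fun t => t ^ (k + 1) * Real.exp (-t ^ 2 / 2))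
    (F := fun y t => t ^ k * Real.exp (-t ^ 2 / 2) * Real.cos (y * t))
    (F' := fun y t => -(t ^ (k + 1) * Real.exp (-t ^ 2 / 2) * Real.sin (y * t)))
    Filter.univ_mem (Filter.Eventually.of_forall fun x => (integrable_gaussCos k x).1)
    (integrable_gaussCos k y) (integrable_gaussSin (k + 1) y).neg.1
    (ae_halfLine_of_forall fun t ht x _ => by
      rw [norm_neg, norm_mul, Real.norm_eq_abs, Real.norm_eq_abs, abs_of_nonneg (by positivity)]
      exact mul_le_of_le_one_right (by positivity) (Real.abs_sin_le_one _))
    (integrable_pow_mul_gauss (k + 1))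
    (Filter.Eventually.of_forall fun t x _ => by
      have h1 : HasDerivAt (fun x : ℝ => x * t) t x := by
        simpa using (hasDerivAt_id x).mul_const t
      refine (h1.cos.const_mul (t ^ k * Real.exp (-t ^ 2 / 2))).congr_deriv ?_
      ring)
  refine h.2.congr_deriv ?_
  rw [integral_neg, gaussSin]

theorem hasDerivAt_gaussSin (k : ℕ) (y : ℝ) : HasDerivAt (gaussSin k) (gaussCos (k + 1) y) y := by
  have h := hasDerivAt_integral_of_dominated_loc_of_deriv_le (μ := halfLine) (x₀ := y)
    (s := univ) (bound := fun t => t ^ (k + 1) * Real.exp (-t ^ 2 / 2))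
    (F := fun y t => t ^ k * Real.exp (-t ^ 2 / 2) * Real.sin (y * t))
    (F' := fun y t => t ^ (k + 1) * Real.exp (-t ^ 2 / 2) * Real.cos (y * t))
    Filter.univ_mem (Filter.Eventually.of_forall fun x => (integrable_gaussSin k x).1)
    (integrable_gaussSin k y) (integrable_gaussCos (k + 1) y).1
    (ae_halfLine_of_forall fun t ht x _ => by
      rw [norm_mul, Real.norm_eq_abs, Real.norm_eq_abs, abs_of_nonneg (by positivity)]
      exact mul_le_of_le_one_right (by positivity) (Real.abs_cos_le_one _))
    (integrable_pow_mul_gauss (k + 1))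
    (Filter.Eventually.of_forall fun t x _ => by
      have h1 : HasDerivAt (fun x : ℝ => x * t) t x := by
        simpa using (hasDerivAt_id x).mul_const t
      refine (h1.sin.const_mul (t ^ k * Real.exp (-t ^ 2 / 2))).congr_deriv ?_
      ring)
  exact h.2

theorem hasDerivAt_gauss (t : ℝ) :
    HasDerivAt (fun t : ℝ => Real.exp (-t ^ 2 / 2)) (-(t * Real.exp (-t ^ 2 / 2))) t := by
  have h4 : HasDerivAt (fun x : ℝ => -x ^ 2 / 2) (-t) t := by
    have := ((hasDerivAt_pow 2 t).neg).div_const 2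
    refine this.congr_deriv ?_
    norm_num
    ring
  exact h4.exp.congr_deriv (by ring)

/-- Integral of the derivative of t^(k+1) e^(-t²/2) cos(yt), whose boundary terms vanish. This is
the relation behind the differential equation of χ. -/
theorem gaussCos_add_two (k : ℕ) (y : ℝ) :
    gaussCos (k + 2) y = (k + 1) * gaussCos k y - y * gaussSin (k + 1) y := by
  have hd : ∀ t, HasDerivAt (fun t : ℝ => t ^ (k + 1) * Real.exp (-t ^ 2 / 2) * Real.cos (y * t))
      ((k + 1) * (t ^ k * Real.exp (-t ^ 2 / 2) * Real.cos (y * t)) -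
        y * (t ^ (k + 1) * Real.exp (-t ^ 2 / 2) * Real.sin (y * t)) -
        t ^ (k + 2) * Real.exp (-t ^ 2 / 2) * Real.cos (y * t)) t := fun t => by
    have h1 : HasDerivAt (fun t : ℝ => y * t) y t := by
      simpa using (hasDerivAt_id t).const_mul y
    refine (((hasDerivAt_pow (k + 1) t).mul (hasDerivAt_gauss t)).mul h1.cos).congr_deriv ?_
    simp only [Nat.add_sub_cancel, Pi.mul_apply]
    push_cast
    ring
  have hi1 := (integrable_gaussCos k y).const_mul (k + 1 : ℝ)
  have hi2 := (integrable_gaussSin (k + 1) y).const_mul y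
  have hi3 := integrable_gaussCos (k + 2) y
  have hi12 : Integrable (fun t => (k + 1) * (t ^ k * Real.exp (-t ^ 2 / 2) * Real.cos (y * t)) -
    y * (t ^ (k + 1) * Real.exp (-t ^ 2 / 2) * Real.sin (y * t))) halfLine := hi1.sub hi2
  have h0 := tendsto_zero_of_hasDerivAt_of_integrableOn_Ioi (fun t (_ : t ∈ Ioi (0 : ℝ)) => hd t)
    (hi12.sub hi3) (integrable_gaussCos (k + 1) y)
  have h := integral_Ioi_of_hasDerivAt_of_tendsto' (fun t (_ : t ∈ Ici (0 : ℝ)) => hd t)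
    (hi12.sub hi3) h0
  have e : ∫ t, ((k + 1) * (t ^ k * Real.exp (-t ^ 2 / 2) * Real.cos (y * t)) -
        y * (t ^ (k + 1) * Real.exp (-t ^ 2 / 2) * Real.sin (y * t)) -
        t ^ (k + 2) * Real.exp (-t ^ 2 / 2) * Real.cos (y * t)) ∂halfLine =
      (k + 1) * gaussCos k y - y * gaussSin (k + 1) y - gaussCos (k + 2) y := by
    rw [integral_sub hi12 hi3, integral_sub hi1 hi2, integral_const_mul,
      integral_const_mul, gaussCos, gaussCos, gaussSin]
  rw [halfLine] at e
  rw [e] at h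
  simp only [zero_pow (Nat.succ_ne_zero k), zero_mul, sub_zero] at h
  linarith

theorem gaussCos_odd_zero (n : ℕ) : gaussCos (2 * n + 1) 0 = 2 ^ n * n ! := by
  induction n with
  | zero =>
    have hd : ∀ t, HasDerivAt (fun t : ℝ => -Real.exp (-t ^ 2 / 2)) (t * Real.exp (-t ^ 2 / 2)) t :=
      fun t => (hasDerivAt_gauss t).neg.congr_deriv (neg_neg _)
    have hi : ∀ k, IntegrableOn (fun t : ℝ => t ^ k * Real.exp (-t ^ 2 / 2)) (Ioi 0) :=
      integrable_pow_mul_gauss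
    have hi1 := hi 1
    have hi0 := hi 0
    simp only [pow_one] at hi1
    simp only [pow_zero, one_mul] at hi0
    have h := integral_Ioi_of_hasDerivAt_of_tendsto' (fun t (_ : t ∈ Ici (0 : ℝ)) => hd t) hi1
      (tendsto_zero_of_hasDerivAt_of_integrableOn_Ioi (fun t (_ : t ∈ Ioi (0 : ℝ)) => hd t)
        hi1 hi0.neg)
    simp only [gaussCos, halfLine, mul_zero, zero_add, pow_one, zero_mul, Real.cos_zero, mul_one]
    rw [h]
    simp
  | succ n ih =>
    rw [show 2 * (n + 1) + 1 = (2 * n + 1) + 2 by ring, gaussCos_add_two, ih, Nat.factorial_succ]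
    push_cast
    ring

theorem gaussSin_zero (k : ℕ) : gaussSin k 0 = 0 := by
  simp [gaussSin]

/-! ### The second solutions -/

theorem re_weberD (k : ℕ) (y : ℝ) :
    (weberD k (Complex.I * y)).re = Real.exp (y ^ 2 / 4) / k ! * gaussCos k y := by
  have h1 : Complex.exp (-(Complex.I * y) ^ 2 / 4) / k ! = ((Real.exp (y ^ 2 / 4) / k ! : ℝ) : ℂ) := by
    push_cast
    rw [mul_pow, Complex.I_sq]
    congr 2
    ring
  have h2 : ∀ t : ℝ, (t : ℂ) ^ k * Complex.exp (-(Complex.I * y) * t - (t : ℂ) ^ 2 / 2) =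
      ((t ^ k * Real.exp (-t ^ 2 / 2) : ℝ) : ℂ) * Complex.exp ((-(y * t) : ℝ) * Complex.I) :=
    fun t => by
      push_cast
      rw [mul_assoc, ← Complex.exp_add]
      congr 2
      ring
  have h3 : ∀ t : ℝ, (((t ^ k * Real.exp (-t ^ 2 / 2) : ℝ) : ℂ) *
      Complex.exp ((-(y * t) : ℝ) * Complex.I)).re =
      t ^ k * Real.exp (-t ^ 2 / 2) * Real.cos (y * t) := fun t => by
    rw [Complex.re_ofReal_mul, Complex.exp_ofReal_mul_I_re, Real.cos_neg]
  have hi : Integrable (fun t : ℝ => ((t ^ k * Real.exp (-t ^ 2 / 2) : ℝ) : ℂ) *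
      Complex.exp ((-(y * t) : ℝ) * Complex.I)) halfLine := by
    refine ((integrable_pow_mul_gauss k).ofReal (𝕜 := ℂ)).mul_bdd (c := 1)
      (Continuous.aestronglyMeasurable (by fun_prop)) (Filter.Eventually.of_forall fun t => ?_)
    rw [Complex.norm_exp_ofReal_mul_I]
  rw [weberD, h1, Complex.re_ofReal_mul]
  congr 1
  simp_rw [h2]
  rw [gaussCos, halfLine]
  rw [halfLine] at hi
  have h4 := integral_re hi
  simp only [RCLike.re_to_complex] at h4
  rw [← h4]
  exact integral_congr_ae (Filter.Eventually.of_forall fun t => h3 t)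

/-- The constant in the real form of `χ_{2n+1}⁰`. -/
noncomputable def chiConst (n : ℕ) : ℝ :=
  √((2 * n + 1)! * √Real.pi / 2) * (-1) ^ n / (2 * n + 1)!

theorem chi_eq (n : ℕ) (x : ℝ) : chi (2 * n + 1) x =
    chiConst n * (Real.exp (x ^ 2 / 2) * gaussCos (2 * n + 1) (√2 * x)) := by
  have h : ¬ Even (2 * n + 1) := Nat.not_even_iff_odd.2 ⟨n, rfl⟩
  have e : (√2 * x) ^ 2 / 4 = x ^ 2 / 2 := by
    rw [mul_pow, Real.sq_sqrt zero_le_two]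
    ring
  rw [chi, if_neg h, re_weberD, e, chiConst]
  simp only [Nat.add_sub_cancel, Nat.mul_div_cancel_left n two_pos]
  ring

/-- The derivative of `χ_{2n+1}⁰`. -/
noncomputable def dchi (n : ℕ) (x : ℝ) : ℝ := chiConst n * (Real.exp (x ^ 2 / 2) *
  (x * gaussCos (2 * n + 1) (√2 * x) - √2 * gaussSin (2 * n + 2) (√2 * x)))

theorem hasDerivAt_exp_sq (x : ℝ) :
    HasDerivAt (fun x : ℝ => Real.exp (x ^ 2 / 2)) (x * Real.exp (x ^ 2 / 2)) x := by
  have h4 : HasDerivAt (fun x : ℝ => x ^ 2 / 2) x x := by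
    have := (hasDerivAt_pow 2 x).div_const 2
    refine this.congr_deriv ?_
    norm_num
  exact h4.exp.congr_deriv (by ring)

theorem hasDerivAt_chi (n : ℕ) (x : ℝ) : HasDerivAt (chi (2 * n + 1)) (dchi n x) x := by
  have h1 : HasDerivAt (fun x : ℝ => √2 * x) (√2) x := by
    simpa using (hasDerivAt_id x).const_mul (√2)
  rw [show chi (2 * n + 1) = _ from funext (chi_eq n)]
  refine (((hasDerivAt_exp_sq x).mul
    ((hasDerivAt_gaussCos (2 * n + 1) (√2 * x)).comp x h1)).const_mul (chiConst n)).congr_deriv ?_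
  simp only [Function.comp_apply, dchi]
  ring

theorem hasDerivAt_dchi (n : ℕ) (x : ℝ) :
    HasDerivAt (dchi n) ((x ^ 2 - (4 * n + 3)) * chi (2 * n + 1) x) x := by
  have h1 : HasDerivAt (fun x : ℝ => √2 * x) (√2) x := by
    simpa using (hasDerivAt_id x).const_mul (√2)
  have h2 : √2 * √2 = (2 : ℝ) := Real.mul_self_sqrt (by norm_num)
  have hc := (hasDerivAt_gaussCos (2 * n + 1) (√2 * x)).comp x h1
  have hs := (hasDerivAt_gaussSin (2 * n + 2) (√2 * x)).comp x h1
  refine (((hasDerivAt_exp_sq x).mul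
    (((hasDerivAt_id x).mul hc).sub (hs.const_mul (√2)))).const_mul (chiConst n)).congr_deriv ?_
  have h3 := gaussCos_add_two (2 * n + 1) (√2 * x)
  simp only [Function.comp_apply, id_eq, Pi.mul_apply, Pi.sub_apply]
  rw [chi_eq, show 2 * n + 2 + 1 = 2 * n + 1 + 2 by ring, h3]
  push_cast
  generalize gaussCos (2 * n + 1) (√2 * x) = c
  have e : 2 * n + 1 + 1 = 2 * n + 2 := rfl
  rw [e]
  generalize gaussSin (2 * n + 2) (√2 * x) = s
  linear_combination (-chiConst n * Real.exp (x ^ 2 / 2) * ((2 * n + 2) * c - √2 * x * s)) * h2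

theorem dchi_zero (n : ℕ) : dchi n 0 = 0 := by
  rw [dchi, mul_zero, gaussSin_zero]
  ring

/-- The two functions solve the same equation, so the Wronskian is constant. At 0 both χ' and
ψ_{2n+1} vanish, leaving a product of explicit values. -/
theorem wronskian_chi_psi (n : ℕ) (x : ℝ) :
    chi (2 * n + 1) x * dpsi (2 * n + 1) x - dchi n x * psi (2 * n + 1) x = 1 := by
  have h1 : ∀ x, HasDerivAt
      (fun x => chi (2 * n + 1) x * dpsi (2 * n + 1) x - dchi n x * psi (2 * n + 1) x) 0 x :=
    fun x => by
      refine (((hasDerivAt_chi n x).mul (hasDerivAt_dpsi (2 * n + 1) x)).sub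
        ((hasDerivAt_dchi n x).mul (hasDerivAt_psi (2 * n + 1) x))).congr_deriv ?_
      push_cast
      ring
  have h2 := is_const_of_deriv_eq_zero (fun y => (h1 y).differentiableAt) (fun y => (h1 y).deriv) x 0
  rw [h2, dchi_zero, chi_eq, dpsi_succ, psi_odd_zero, psi_eq]
  simp only [mul_zero, neg_zero, zero_add, sub_zero]
  rw [gaussCos_odd_zero, herm_even_zero, chiConst]
  have hpi : 0 < √Real.pi := Real.sqrt_pos.2 Real.pi_pos
  have hf : ((2 * n)! : ℝ) = coeffE n * (2 ^ n * n !) ^ 2 := by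
    rw [coeffE]
    field_simp
    ring
  have e1 : √((2 * n + 1)! * √Real.pi / 2) * √(2 * ((2 * n : ℕ) + 1)) =
      (2 * n + 1) * √((2 * n)! * √Real.pi) := by
    rw [← Real.sqrt_mul (by positivity), Nat.factorial_succ]
    have e2 : (((2 * n + 1) * (2 * n)! : ℕ) : ℝ) * √Real.pi / 2 * (2 * ((2 * n : ℕ) + 1)) =
        (2 * n + 1) ^ 2 * ((2 * n)! * √Real.pi) := by
      push_cast
      ring
    rw [e2, Real.sqrt_mul (by positivity), Real.sqrt_sq (by positivity)]
  have e3 := (sqrt_factorial_pos (2 * n)).ne'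
  have e4 : ((-1 : ℝ) ^ n) * (-1) ^ n = 1 := by
    rw [← mul_pow]
    norm_num
  have e5 : Real.exp (0 ^ 2 / 2) = 1 := by norm_num
  have e6 : Real.exp (-0 ^ 2 / 2) = 1 := by norm_num
  have e7 : ((2 * n + 1)! : ℝ) = (2 * n + 1) * (coeffE n * (2 ^ n * n !) ^ 2) := by
    rw [Nat.factorial_succ, ← hf]
    push_cast
    ring
  have hE := (coeffE_pos n).ne'
  rw [e5, e6]
  have e8 : ∀ a b c d e f s : ℝ, a * c / b * (1 * d) * (s * (e⁻¹ * (c * f) * 1)) =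
      (a * s) * (c * c) / b * d * e⁻¹ * f := fun a b c d e f s => by ring
  have e9 : (-1 : ℝ) ^ n * coeffE n * (2 ^ n * n !) = (-1) ^ n * (coeffE n * (2 ^ n * n !)) := by ring
  rw [e9, e8, e1, e4, e7]
  field_simp

/-! ### The Green function -/

theorem exists_lipschitzOnWith_of_hasDerivAt {f f' : ℝ → ℝ} (h : ∀ x, HasDerivAt f (f' x) x)
    (hc : Continuous f') (a b : ℝ) : ∃ K, LipschitzOnWith K f (Icc a b) := by
  have h1 : ContDiff ℝ 1 f := by
    refine contDiff_one_iff_deriv.2 ⟨fun x => (h x).differentiableAt, ?_⟩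
    have : deriv f = f' := funext fun x => (h x).deriv
    rwa [this]
  exact h1.contDiffOn.exists_lipschitzOnWith one_ne_zero (convex_Icc a b) isCompact_Icc

theorem continuous_dchi (n : ℕ) : Continuous (dchi n) :=
  continuous_iff_continuousAt.2 fun x => (hasDerivAt_dchi n x).continuousAt

/-- Green function at energy 4n+3, up to normalization: χ satisfies the Neumann condition at 0 and ψ
decays at infinity. It is locally Lipschitz with Gaussian decay in y, so its Hermite expansion
converges pointwise. -/
theorem exists_green (n : ℕ) {x : ℝ} (hx : 0 ≤ x) : ∃ u : HPlus, ∀ y, 0 ≤ y →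
    u y = chi (2 * n + 1) (min x y) * psi (2 * n + 1) (max x y) := by
  obtain ⟨C, hC, h⟩ := exists_abs_psi_le (2 * n + 1)
  obtain ⟨D, hD, h'⟩ := exists_abs_dpsi_le (2 * n + 1)
  have hcc : Continuous (chi (2 * n + 1)) :=
    continuous_iff_continuousAt.2 fun x => (hasDerivAt_chi n x).continuousAt
  obtain ⟨A, hA⟩ := isCompact_Icc.exists_bound_of_continuousOn (s := Icc 0 x) hcc.continuousOn
  obtain ⟨B, hB⟩ := isCompact_Icc.exists_bound_of_continuousOn (s := Icc 0 x)
    (continuous_dchi n).continuousOn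
  have hA0 : 0 ≤ A := (norm_nonneg _).trans (hA 0 ⟨le_rfl, hx⟩)
  have hB0 : 0 ≤ B := (norm_nonneg _).trans (hB 0 ⟨le_rfl, hx⟩)
  set f : ℝ → ℝ := fun y => chi (2 * n + 1) (min x y) * psi (2 * n + 1) (max x y) with hf
  have hac : ∀ R, 0 ≤ R → AbsolutelyContinuousOnInterval f 0 R := fun R hR => by
    obtain ⟨K, hK⟩ := exists_lipschitzOnWith_of_hasDerivAt (hasDerivAt_chi n) (continuous_dchi n)
      0 (x + R)
    obtain ⟨L, hL⟩ := exists_lipschitzOnWith_of_hasDerivAt (hasDerivAt_psi (2 * n + 1))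
      (continuous_dpsi (2 * n + 1)) 0 (x + R)
    have h1 := hK.comp ((LipschitzWith.id.const_min x).lipschitzOnWith (s := uIcc 0 R))
      fun y hy => by
        rw [uIcc_of_le hR] at hy
        exact ⟨le_min hx hy.1, (min_le_left _ _).trans (by linarith)⟩
    have h2 := hL.comp ((LipschitzWith.id.const_max x).lipschitzOnWith (s := uIcc 0 R))
      fun y hy => by
        rw [uIcc_of_le hR] at hy
        exact ⟨hx.trans (le_max_left _ _), max_le (by linarith) (hy.2.trans (by linarith))⟩
    exact h1.absolutelyContinuousOnInterval.mul h2.absolutelyContinuousOnInterval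
  have hb1 : ∀ y, 0 < y → |f y| ≤ (A * C) * Real.exp (-(y ^ 2 / 4)) := fun y hy => by
    rw [hf, abs_mul, mul_assoc]
    refine mul_le_mul (hA _ ⟨le_min hx hy.le, min_le_left _ _⟩) ((h _).trans ?_)
      (abs_nonneg _) hA0
    refine mul_le_mul_of_nonneg_left (Real.exp_le_exp.2 ?_) hC
    have : y ^ 2 ≤ max x y ^ 2 := pow_le_pow_left₀ hy.le (le_max_right _ _) 2
    linarith
  have hb2 : ∀ᵐ y ∂halfLine, |deriv f y| ≤ (A * D + B * C) * Real.exp (-(y ^ 2 / 8)) := by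
    -- The derivative jumps only at the kink y = x, a null set.
    have hne : ∀ᵐ y : ℝ, y ≠ x := by
      simp [ae_iff]
    rw [ae_halfLine_iff]
    filter_upwards [hne] with y hy hy0
    rw [add_mul]
    rcases lt_or_gt_of_ne hy with hlt | hgt
    · have e : f =ᶠ[nhds y] fun z => chi (2 * n + 1) z * psi (2 * n + 1) x := by
        filter_upwards [Iio_mem_nhds hlt] with z hz
        simp only [hf]
        rw [min_eq_right (le_of_lt hz), max_eq_left (le_of_lt hz)]
      rw [e.deriv_eq, ((hasDerivAt_chi n y).mul_const _).deriv, abs_mul]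
      have e1 : |dchi n y| * |psi (2 * n + 1) x| ≤ B * C * Real.exp (-(y ^ 2 / 8)) := by
        rw [mul_assoc]
        refine mul_le_mul (hB y ⟨hy0.le, hlt.le⟩) ((h x).trans ?_) (abs_nonneg _) hB0
        refine mul_le_mul_of_nonneg_left (Real.exp_le_exp.2 ?_) hC
        have : y ^ 2 ≤ x ^ 2 := pow_le_pow_left₀ hy0.le hlt.le 2
        nlinarith [sq_nonneg x]
      have e2 : 0 ≤ A * D * Real.exp (-(y ^ 2 / 8)) := by positivity
      linarith
    · have e : f =ᶠ[nhds y] fun z => chi (2 * n + 1) x * psi (2 * n + 1) z := by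
        filter_upwards [Ioi_mem_nhds hgt] with z hz
        simp only [hf]
        rw [min_eq_left (le_of_lt hz), max_eq_right (le_of_lt hz)]
      rw [e.deriv_eq, ((hasDerivAt_psi (2 * n + 1) y).const_mul _).deriv, abs_mul]
      have e1 : |chi (2 * n + 1) x| * |dpsi (2 * n + 1) y| ≤ A * D * Real.exp (-(y ^ 2 / 8)) := by
        rw [mul_assoc]
        exact mul_le_mul (hA x ⟨hx, le_rfl⟩) (h' y) (abs_nonneg _) hA0
      have e2 : 0 ≤ B * C * Real.exp (-(y ^ 2 / 8)) := by positivity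
      linarith
  refine ⟨HPlus.ofBound f hac (A * C + (A * D + B * C)) (fun y hy => (hb1 y hy).trans ?_) ?_,
    fun y hy => HPlus.ofBound_apply _ _ _ hy⟩
  · refine mul_le_mul_of_nonneg_right ?_ (Real.exp_pos _).le
    have : 0 ≤ A * D + B * C := by positivity
    linarith
  · filter_upwards [hb2] with y hy
    refine hy.trans (mul_le_mul_of_nonneg_right ?_ (Real.exp_pos _).le)
    have : 0 ≤ A * C := by positivity
    linarith

theorem memLp_psi (n : ℕ) : MemLp (psi n) 2 halfLine :=
  (psiH n).memLp.ae_eq (ae_halfLine_of_forall fun _ hx => psiH_apply n hx.le)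

theorem memLp_dpsi (n : ℕ) : MemLp (dpsi n) 2 halfLine := by
  obtain ⟨C, _, h⟩ := exists_abs_dpsi_le n
  exact memLp_of_bound (continuous_dpsi n).aestronglyMeasurable (Filter.Eventually.of_forall h)

/-- Lagrange's identity: the factor is the difference of the energies 4n+3 and 4m+1. At 0 both
derivatives vanish, so only the endpoint x contributes. -/
theorem integral_chi_mul_psi (n m : ℕ) (x : ℝ) :
    2 * (2 * ((n : ℝ) - m) + 1) * ∫ y in (0 : ℝ)..x, chi (2 * n + 1) y * psi (2 * m) y =
      chi (2 * n + 1) x * dpsi (2 * m) x - dchi n x * psi (2 * m) x := by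
  have hd : ∀ y, HasDerivAt
      (fun y => chi (2 * n + 1) y * dpsi (2 * m) y - dchi n y * psi (2 * m) y)
      (2 * (2 * ((n : ℝ) - m) + 1) * (chi (2 * n + 1) y * psi (2 * m) y)) y := fun y => by
    refine (((hasDerivAt_chi n y).mul (hasDerivAt_dpsi (2 * m) y)).sub
      ((hasDerivAt_dchi n y).mul (hasDerivAt_psi (2 * m) y))).congr_deriv ?_
    push_cast
    ring
  have hcc : Continuous (chi (2 * n + 1)) :=
    continuous_iff_continuousAt.2 fun x => (hasDerivAt_chi n x).continuousAt
  rw [← intervalIntegral.integral_const_mul, intervalIntegral.integral_eq_sub_of_hasDerivAt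
    (fun y _ => hd y) ((hcc.mul (continuous_psi (2 * m))).const_mul _ |>.intervalIntegrable _ _),
    dpsi_even_zero, dchi_zero]
  ring

theorem integral_psi_mul_psi_Ioi (n m : ℕ) {x : ℝ} (hx : 0 ≤ x) :
    2 * (2 * ((n : ℝ) - m) + 1) * ∫ y in Ioi x, psi (2 * n + 1) y * psi (2 * m) y =
      -(psi (2 * n + 1) x * dpsi (2 * m) x - dpsi (2 * n + 1) x * psi (2 * m) x) := by
  have hd : ∀ y, HasDerivAt
      (fun y => psi (2 * n + 1) y * dpsi (2 * m) y - dpsi (2 * n + 1) y * psi (2 * m) y)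
      (2 * (2 * ((n : ℝ) - m) + 1) * (psi (2 * n + 1) y * psi (2 * m) y)) y := fun y => by
    refine (((hasDerivAt_psi (2 * n + 1) y).mul (hasDerivAt_dpsi (2 * m) y)).sub
      ((hasDerivAt_dpsi (2 * n + 1) y).mul (hasDerivAt_psi (2 * m) y))).congr_deriv ?_
    push_cast
    ring
  have hi : ∀ {f : ℝ → ℝ}, Integrable f halfLine → IntegrableOn f (Ioi x) := fun hf =>
    IntegrableOn.mono_set hf (Ioi_subset_Ioi hx)
  have h1 : IntegrableOn (fun y => 2 * (2 * ((n : ℝ) - m) + 1) *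
      (psi (2 * n + 1) y * psi (2 * m) y)) (Ioi x) :=
    hi (((memLp_psi (2 * n + 1)).integrable_mul (memLp_psi (2 * m))).const_mul _)
  have h2 : IntegrableOn (fun y => psi (2 * n + 1) y * dpsi (2 * m) y -
      dpsi (2 * n + 1) y * psi (2 * m) y) (Ioi x) :=
    hi (((memLp_psi (2 * n + 1)).integrable_mul (memLp_dpsi (2 * m))).sub
      ((memLp_dpsi (2 * n + 1)).integrable_mul (memLp_psi (2 * m))))
  rw [← integral_const_mul, integral_Ioi_of_hasDerivAt_of_tendsto' (fun y _ => hd y) h1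
    (tendsto_zero_of_hasDerivAt_of_integrableOn_Ioi (fun y _ => hd y) h1 h2), zero_sub]

/-- The eigenfunction expansion of the diagonal of the Green function. -/
theorem hasSum_psi_mul_chi (n : ℕ) {x : ℝ} (hx : 0 ≤ x) :
    HasSum (fun m => hilbertKernel n m * psi (2 * m) x ^ 2)
      (psi (2 * n + 1) x * chi (2 * n + 1) x) := by
  obtain ⟨u, hu⟩ := exists_green n hx
  have h1 := u.hasSum_psi hx
  rw [hu x hx, min_self, max_self, mul_comm] at h1
  refine h1.congr_fun fun m => ?_
  have hi := integrable_mul_psi u (2 * m)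
  have h2 : ∫ y, u y * psi (2 * m) y ∂halfLine =
      psi (2 * n + 1) x * (∫ y in (0 : ℝ)..x, chi (2 * n + 1) y * psi (2 * m) y) +
      chi (2 * n + 1) x * ∫ y in Ioi x, psi (2 * n + 1) y * psi (2 * m) y := by
    have hU : Ioc 0 x ∪ Ioi x = Ioi 0 := Ioc_union_Ioi_eq_Ioi hx
    have hi1 : IntegrableOn (fun y => u y * psi (2 * m) y) (Ioc 0 x) :=
      IntegrableOn.mono_set hi Ioc_subset_Ioi_self
    have hi2 : IntegrableOn (fun y => u y * psi (2 * m) y) (Ioi x) :=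
      IntegrableOn.mono_set hi (Ioi_subset_Ioi hx)
    rw [halfLine, ← hU, setIntegral_union (Ioc_disjoint_Ioi le_rfl) measurableSet_Ioi hi1 hi2,
      intervalIntegral.integral_of_le hx, ← integral_const_mul, ← integral_const_mul]
    congr 1
    · refine setIntegral_congr_fun measurableSet_Ioc fun y hy => ?_
      have e := hu y hy.1.le
      rw [min_eq_right hy.2, max_eq_left hy.2] at e
      change u y * psi (2 * m) y = psi (2 * n + 1) x * (chi (2 * n + 1) y * psi (2 * m) y)
      rw [e]
      ring
    · refine setIntegral_congr_fun measurableSet_Ioi fun y hy => ?_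
      have hy : x < y := hy
      have e := hu y (hx.trans hy.le)
      rw [min_eq_left hy.le, max_eq_right hy.le] at e
      change u y * psi (2 * m) y = chi (2 * n + 1) x * (psi (2 * n + 1) y * psi (2 * m) y)
      rw [e]
      ring
  -- The two Lagrange boundary terms at x combine into ψ_{2m}(x) times the Wronskian, which is 1.
  have h3 : 2 * (2 * ((n : ℝ) - m) + 1) * ∫ y, u y * psi (2 * m) y ∂halfLine = psi (2 * m) x := by
    rw [h2]
    linear_combination psi (2 * n + 1) x * integral_chi_mul_psi n m x +
      chi (2 * n + 1) x * integral_psi_mul_psi_Ioi n m hx +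
      psi (2 * m) x * wronskian_chi_psi n x
  have h4 := hilbertKernel_den_ne_zero n m
  rw [hilbertKernel]
  field_simp
  linear_combination (-psi (2 * m) x) * h3

/-- Decay in m at the rate of the weights 1/(2m+1), which matches the evaluation bound in
`exists_hasSum_psi_sq`. -/
theorem abs_hilbertKernel_le (n m : ℕ) : |hilbertKernel n m| ≤ (2 * n + 3) / (2 * m + 1) := by
  have h1 := one_le_abs_hilbertKernel_den n m
  rw [hilbertKernel, abs_div, abs_one, div_le_div_iff₀ (by linarith) (by positivity), one_mul]
  have h2 := neg_abs_le (2 * ((n : ℝ) - m) + 1)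
  have h3 : (0 : ℝ) ≤ n := n.cast_nonneg
  nlinarith

theorem integrable_mul_psi_sq (q : HPlus) (n : ℕ) :
    Integrable (fun x => q x * psi n x ^ 2) halfLine := by
  obtain ⟨C, hC, h⟩ := exists_abs_psi_le n
  refine ((integrable_mul_psi q n).mul_bdd (c := C) (continuous_psi n).aestronglyMeasurable
    (Filter.Eventually.of_forall fun x => (h x).trans ?_)).congr
    (Filter.Eventually.of_forall fun x => ?_)
  · refine mul_le_of_le_one_right hC (Real.exp_le_one_iff.2 ?_)
    nlinarith [sq_nonneg x]
  · simp only
    ring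

/-- Termwise integration of the diagonal Green expansion. The terms are dominated by (2n+3)|q|
because evaluation has norm at most 1 on H₊, and q is integrable. -/
theorem hasSum_qCheck (q : HPlus) (n : ℕ) :
    HasSum (fun m => hilbertKernel n m * qHat q (2 * m)) (qCheck q (2 * n + 1)) := by
  have hF : ∀ m, Integrable (fun x => hilbertKernel n m * (q x * psi (2 * m) x ^ 2)) halfLine :=
    fun m => (integrable_mul_psi_sq q (2 * m)).const_mul _
  have hs : Summable fun m => ∫ x, ‖hilbertKernel n m * (q x * psi (2 * m) x ^ 2)‖ ∂halfLine := by
    refine summable_of_sum_le (c := ∫ x, (2 * n + 3) * |q x| ∂halfLine)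
      (fun m => integral_nonneg fun x => norm_nonneg _) fun s => ?_
    rw [← integral_finsetSum _ fun m _ => (hF m).norm]
    refine integral_mono_ae (integrable_finsetSum _ fun m _ => (hF m).norm)
      (q.integrable.abs.const_mul _) (ae_halfLine_of_forall fun x hx => ?_)
    obtain ⟨t, ht, hsum⟩ := exists_hasSum_psi_sq hx.le
    simp only
    calc ∑ m ∈ s, ‖hilbertKernel n m * (q x * psi (2 * m) x ^ 2)‖
        ≤ ∑ m ∈ s, (2 * n + 3) * |q x| * (psi (2 * m) x ^ 2 / (2 * m + 1)) := by
          refine Finset.sum_le_sum fun m _ => ?_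
          rw [Real.norm_eq_abs, abs_mul, abs_mul, abs_of_nonneg (sq_nonneg (psi (2 * m) x))]
          refine (mul_le_mul_of_nonneg_right (abs_hilbertKernel_le n m)
            (by positivity)).trans (le_of_eq ?_)
          ring
      _ = (2 * n + 3) * |q x| * ∑ m ∈ s, psi (2 * m) x ^ 2 / (2 * m + 1) := by rw [Finset.mul_sum]
      _ ≤ (2 * n + 3) * |q x| * 1 := by
          refine mul_le_mul_of_nonneg_left (le_trans ?_ ht) (by positivity)
          exact sum_le_hasSum s (fun m _ => by positivity) hsum
      _ = (2 * n + 3) * |q x| := mul_one _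
  have h := hasSum_integral_of_summable_integral_norm hF hs
  have e : ∫ x, ∑' m, hilbertKernel n m * (q x * psi (2 * m) x ^ 2) ∂halfLine =
      qCheck q (2 * n + 1) := by
    rw [qCheck]
    refine integral_congr_ae (ae_halfLine_of_forall fun x hx => ?_)
    simp only
    refine (((hasSum_psi_mul_chi n hx.le).mul_left (q x)).congr_fun fun m => ?_).tsum_eq
    ring
  rw [e] at h
  refine h.congr_fun fun m => ?_
  rw [integral_const_mul, qHat]

/-! ### The Cauchy integral defining `q̃` -/

theorem cpow_half_sq (w : ℂ) : (w ^ (1 / 2 : ℂ)) ^ 2 = w := by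
  rw [one_div]
  exact_mod_cast Complex.cpow_nat_inv_pow w two_ne_zero

theorem hasSum_funGD (q : HPlus) {ζ : ℂ} (hζ : ‖ζ‖ = 1) :
    HasSum (fun m => (coefG q m : ℂ) * ζ ^ m) (funGD q ζ) := by
  set w := ζ ^ (1 / 2 : ℂ) with hw
  have hw2 : w ^ 2 = ζ := cpow_half_sq ζ
  have hwn : ‖w‖ ^ 2 = 1 := by rw [← norm_pow, hw2, hζ]
  have hwn1 : ‖w‖ = 1 := (pow_eq_one_iff_of_nonneg (norm_nonneg _) two_ne_zero).1 hwn
  have hw0 : w ≠ 0 := by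
    rw [← norm_ne_zero_iff, hwn1]
    exact one_ne_zero
  have h := (hasSum_coefG_mul_sq q hwn1.le).div_const w
  rw [funGD, ← hw, dslope_of_ne _ hw0, slope_def_field]
  simp only [neg_zero, add_zero, sub_zero, sub_self, zero_div]
  refine h.congr_fun fun m => ?_
  rw [hw2, mul_div_cancel_right₀ _ hw0]

/-- For θ in (0, 2π) the argument θ - π is principal. The branch cut meets the circle only at ζ = 1.
-/
theorem neg_exp_cpow_half {θ : ℝ} (h0 : 0 < θ) (h1 : θ < 2 * Real.pi) :
    ((-Complex.exp (θ * Complex.I)) ^ (1 / 2 : ℂ))⁻¹ =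
      Complex.I * Complex.exp (-(θ / 2) * Complex.I) := by
  have e : -Complex.exp (θ * Complex.I) = Complex.exp ((θ - Real.pi : ℝ) * Complex.I) := by
    push_cast
    rw [sub_mul, Complex.exp_sub, Complex.exp_pi_mul_I, div_neg, div_one]
  have e2 : Complex.log (Complex.exp ((θ - Real.pi : ℝ) * Complex.I)) =
      (θ - Real.pi : ℝ) * Complex.I := by
    refine Complex.log_exp ?_ ?_
    · rw [Complex.mul_I_im, Complex.ofReal_re]
      linarith
    · rw [Complex.mul_I_im, Complex.ofReal_re]
      linarith
  rw [e, Complex.cpow_def_of_ne_zero (Complex.exp_ne_zero _), e2, ← Complex.exp_neg]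
  have e3 : -(((θ - Real.pi : ℝ) : ℂ) * Complex.I * (1 / 2)) =
      Real.pi / 2 * Complex.I + -(θ / 2) * Complex.I := by
    push_cast
    ring
  rw [e3, Complex.exp_add, Complex.exp_pi_div_two_mul_I]

/-- The integrand of `tildeGen`. -/
noncomputable def tildeIntegrand (q : HPlus) (ζ : ℂ) : ℂ :=
  ((-ζ) ^ (1 / 2 : ℂ))⁻¹ * (funGD q ζ - funGD q 1)

theorem hasSum_tildeIntegrand (q : HPlus) {θ : ℝ} (h0 : 0 < θ) (h1 : θ < 2 * Real.pi) :
    HasSum (fun m : ℕ => Complex.I * Complex.exp (-(θ / 2) * Complex.I) *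
      ((coefG q m : ℂ) * (Complex.exp (θ * Complex.I) ^ m - 1)))
      (tildeIntegrand q (circleMap 0 1 θ)) := by
  have e : circleMap 0 1 θ = Complex.exp (θ * Complex.I) := by simp [circleMap]
  rw [tildeIntegrand, e, neg_exp_cpow_half h0 h1]
  refine HasSum.mul_left _ ?_
  refine ((hasSum_funGD q (Complex.norm_exp_ofReal_mul_I θ)).sub
    (hasSum_funGD q norm_one)).congr_fun fun m => ?_
  rw [one_pow]
  ring

theorem summable_norm_coefG (q : HPlus) : Summable fun m => ‖(coefG q m : ℂ)‖ := by
  simpa only [Complex.norm_real, Real.norm_eq_abs] using summable_abs_coefG q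

theorem norm_coefG_mul_le (q : HPlus) (m : ℕ) (θ : ℝ) {a : ℂ} (ha : ‖a‖ ≤ 1) :
    ‖a * ((coefG q m : ℂ) * (Complex.exp (θ * Complex.I) ^ m - 1))‖ ≤ ‖(coefG q m : ℂ)‖ * 2 := by
  have h1 : ‖Complex.exp (θ * Complex.I) ^ m - 1‖ ≤ 2 := by
    refine (norm_sub_le _ _).trans ?_
    rw [norm_pow, Complex.norm_exp_ofReal_mul_I, one_pow, norm_one]
    norm_num
  rw [norm_mul, norm_mul]
  refine (mul_le_of_le_one_left (by positivity) ha).trans ?_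
  exact mul_le_mul_of_nonneg_left h1 (norm_nonneg _)

theorem norm_I_mul_exp (θ : ℝ) : ‖Complex.I * Complex.exp (-(θ / 2) * Complex.I)‖ = 1 := by
  have := Complex.norm_exp_ofReal_mul_I (-(θ / 2))
  push_cast at this
  rw [norm_mul, Complex.norm_I, this, mul_one]

/-- On the open interval the integrand agrees with a uniformly convergent series of continuous
functions; the endpoints do not matter. -/
theorem circleIntegrable_tildeIntegrand (q : HPlus) : CircleIntegrable (tildeIntegrand q) 0 1 := by
  have hc : Continuous fun θ : ℝ => ∑' m : ℕ, Complex.I * Complex.exp (-(θ / 2) * Complex.I) *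
      ((coefG q m : ℂ) * (Complex.exp (θ * Complex.I) ^ m - 1)) :=
    continuous_tsum (fun m => by fun_prop) ((summable_norm_coefG q).mul_right 2)
      fun m θ => norm_coefG_mul_le q m θ (norm_I_mul_exp θ).le
  refine (intervalIntegrable_congr_uIoo fun θ hθ => ?_).1 (hc.intervalIntegrable 0 (2 * Real.pi))
  rw [uIoo_of_le Real.two_pi_pos.le] at hθ
  exact (hasSum_tildeIntegrand q hθ.1 hθ.2).tsum_eq

/-- The half-integer frequency, produced by √(-ζ), is the source of the Hilbert kernel. -/
theorem integral_exp_half (n m : ℕ) :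
    ∫ θ in (0 : ℝ)..(2 * Real.pi), Complex.exp ((((m : ℂ) - n - 1 / 2) * Complex.I) * θ) =
      -4 * Complex.I * hilbertKernel n m := by
  have hd : ((2 * ((n : ℝ) - m) + 1 : ℝ) : ℂ) ≠ 0 := by
    exact_mod_cast hilbertKernel_den_ne_zero n m
  have ha : ((m : ℂ) - n - 1 / 2) = -((2 * ((n : ℝ) - m) + 1 : ℝ) : ℂ) / 2 := by
    push_cast
    ring
  have ha0 : (((m : ℂ) - n - 1 / 2) * Complex.I) ≠ 0 := by
    rw [ha]
    exact mul_ne_zero (div_ne_zero (neg_ne_zero.2 hd) two_ne_zero) Complex.I_ne_zero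
  have he : Complex.exp ((((m : ℂ) - n - 1 / 2) * Complex.I) * (2 * Real.pi : ℝ)) = -1 := by
    have e1 : (((m : ℂ) - n - 1 / 2) * Complex.I) * (2 * Real.pi : ℝ) =
        ((m - n - 1 : ℤ) : ℂ) * (2 * Real.pi * Complex.I) + Real.pi * Complex.I := by
      push_cast
      ring
    rw [e1, Complex.exp_add, Complex.exp_int_mul_two_pi_mul_I, Complex.exp_pi_mul_I, one_mul]
  rw [integral_exp_mul_complex ha0, he, hilbertKernel, Complex.ofReal_zero, mul_zero,
    Complex.exp_zero, ha]
  push_cast at hd ⊢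
  have hI := Complex.I_ne_zero
  field_simp
  rw [Complex.I_sq]
  ring

/-- The Taylor coefficients of `tildeGen q`. -/
noncomputable def coefTilde (q : HPlus) (n : ℕ) : ℝ :=
  ∑' m, (hilbertKernel n m - hilbertKernel n 0) * coefG q m

theorem summable_coefTilde (q : HPlus) (n : ℕ) :
    Summable fun m => (hilbertKernel n m - hilbertKernel n 0) * coefG q m := by
  refine Summable.of_norm_bounded ((summable_abs_coefG q).mul_left 2) fun m => ?_
  rw [Real.norm_eq_abs, abs_mul]
  refine mul_le_mul_of_nonneg_right ((abs_sub _ _).trans ?_) (abs_nonneg _)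
  linarith [abs_hilbertKernel_le_one n m, abs_hilbertKernel_le_one n 0]

/-- Termwise integration of the absolutely summable series of G; subtracting G(1) produces the
column κ(n,0). -/
theorem circleIntegral_tildeIntegrand (q : HPlus) (n : ℕ) :
    (∮ z in C(0, 1), (z⁻¹) ^ n • z⁻¹ • tildeIntegrand q z) = 4 * Complex.I * coefTilde q n := by
  have hF : ∀ m (θ : ℝ), -(Complex.exp (-((n : ℂ) + 1 / 2) * θ * Complex.I) *
      ((coefG q m : ℂ) * (Complex.exp (θ * Complex.I) ^ m - 1))) =
      (-(coefG q m : ℂ)) * (Complex.exp ((((m : ℂ) - n - 1 / 2) * Complex.I) * θ) -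
        Complex.exp (((((0 : ℕ) : ℂ) - n - 1 / 2) * Complex.I) * θ)) := fun m θ => by
    have e1 : Complex.exp ((((m : ℂ) - n - 1 / 2) * Complex.I) * θ) =
        Complex.exp (-((n : ℂ) + 1 / 2) * θ * Complex.I) * Complex.exp (θ * Complex.I) ^ m := by
      rw [← Complex.exp_nat_mul, ← Complex.exp_add]
      congr 1
      ring
    have e2 : Complex.exp (((((0 : ℕ) : ℂ) - n - 1 / 2) * Complex.I) * θ) =
        Complex.exp (-((n : ℂ) + 1 / 2) * θ * Complex.I) := by
      congr 1
      push_cast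
      ring
    rw [e1, e2]
    ring
  have hn : ∀ θ : ℝ, ‖Complex.exp (-((n : ℂ) + 1 / 2) * θ * Complex.I)‖ = 1 := fun θ => by
    have := Complex.norm_exp_ofReal_mul_I (-((n : ℝ) + 1 / 2) * θ)
    push_cast at this
    exact this
  have h := intervalIntegral.hasSum_integral_of_dominated_convergence (μ := volume)
    (a := 0) (b := 2 * Real.pi) (ι := ℕ)
    (F := fun m θ => -(Complex.exp (-((n : ℂ) + 1 / 2) * θ * Complex.I) *
      ((coefG q m : ℂ) * (Complex.exp (θ * Complex.I) ^ m - 1))))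
    (f := fun θ => deriv (circleMap 0 1) θ •
      ((circleMap 0 1 θ)⁻¹ ^ n • (circleMap 0 1 θ)⁻¹ • tildeIntegrand q (circleMap 0 1 θ)))
    (fun m _ => ‖(coefG q m : ℂ)‖ * 2)
    (fun m => Continuous.aestronglyMeasurable (by fun_prop))
    (fun m => Filter.Eventually.of_forall fun θ _ => by
      rw [norm_neg]
      exact norm_coefG_mul_le q m θ (hn θ).le)
    (Filter.Eventually.of_forall fun θ _ => (summable_norm_coefG q).mul_right 2)
    intervalIntegrable_const
    (by
      have hne : ∀ᵐ θ : ℝ, θ ≠ 2 * Real.pi := by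
        simp [ae_iff]
      filter_upwards [hne] with θ hθ hθ'
      rw [uIoc_of_le Real.two_pi_pos.le] at hθ'
      have h1 := hasSum_tildeIntegrand q hθ'.1 (lt_of_le_of_ne hθ'.2 hθ)
      have e : circleMap 0 1 θ = Complex.exp (θ * Complex.I) := by simp [circleMap]
      have h2 := ((h1.mul_left (circleMap 0 1 θ)⁻¹).mul_left ((circleMap 0 1 θ)⁻¹ ^ n)).mul_left
        (deriv (circleMap 0 1) θ)
      refine h2.congr_fun fun m => ?_
      rw [deriv_circleMap, e, ← Complex.exp_neg, ← Complex.exp_nat_mul (-(θ * Complex.I)) n]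
      have e3 : Complex.exp (-((n : ℂ) + 1 / 2) * θ * Complex.I) =
          Complex.exp (n * -(θ * Complex.I)) * Complex.exp (-(θ / 2) * Complex.I) := by
        rw [← Complex.exp_add]
        congr 1
        ring
      have e4 : Complex.exp (θ * Complex.I) * Complex.exp (-(θ * Complex.I)) = 1 := by
        rw [← Complex.exp_add, add_neg_cancel, Complex.exp_zero]
      rw [e3]
      generalize Complex.exp (θ * Complex.I) = u at e4 ⊢
      generalize Complex.exp (-(θ * Complex.I)) = v at e4 ⊢
      generalize Complex.exp (n * -(θ * Complex.I)) = w
      generalize Complex.exp (-(θ / 2) * Complex.I) = r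
      linear_combination (-(w * r * coefG q m * (u ^ m - 1))) * (Complex.I ^ 2 * e4 + Complex.I_sq))
  have h2 : HasSum (fun m => 4 * Complex.I *
      (((hilbertKernel n m - hilbertKernel n 0) * coefG q m : ℝ) : ℂ))
      (∮ z in C(0, 1), (z⁻¹) ^ n • z⁻¹ • tildeIntegrand q z) := by
    rw [circleIntegral]
    refine h.congr_fun fun m => ?_
    simp_rw [hF]
    rw [intervalIntegral.integral_const_mul, intervalIntegral.integral_sub
      (Continuous.intervalIntegrable (by fun_prop) _ _)
      (Continuous.intervalIntegrable (by fun_prop) _ _), integral_exp_half, integral_exp_half]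
    push_cast
    ring
  refine h2.unique (HasSum.mul_left _ ?_)
  exact Complex.hasSum_ofReal.2 (summable_coefTilde q n).hasSum

theorem hasSum_tildeGen (q : HPlus) {z : ℂ} (hz : ‖z‖ < 1) :
    HasSum (fun n => (coefTilde q n : ℂ) * z ^ n) (tildeGen q z) := by
  have h := (hasSum_cauchyPowerSeries_integral (circleIntegrable_tildeIntegrand q) hz).mul_left
    (Real.pi / 2 : ℂ)
  have e : (Real.pi / 2 : ℂ) * ((2 * Real.pi * Complex.I : ℂ)⁻¹ •
      ∮ ζ in C(0, 1), (ζ - (0 + z))⁻¹ • tildeIntegrand q ζ) = tildeGen q z := by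
    rw [tildeGen, projPlus, smul_eq_mul]
    congr 2
    refine congrArg (fun f => circleIntegral f 0 1) (funext fun ζ => ?_)
    rw [zero_add, smul_eq_mul, mul_comm, ← div_eq_mul_inv, tildeIntegrand]
  rw [e] at h
  refine h.congr_fun fun n => ?_
  rw [cauchyPowerSeries_apply]
  have e2 : (∮ ζ in C(0, 1), (z / (ζ - 0)) ^ n • (ζ - 0)⁻¹ • tildeIntegrand q ζ) =
      z ^ n • ∮ ζ in C(0, 1), (ζ⁻¹) ^ n • ζ⁻¹ • tildeIntegrand q ζ := by
    rw [← circleIntegral.integral_smul]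
    refine congrArg (fun f => circleIntegral f 0 1) (funext fun ζ => ?_)
    rw [sub_zero, div_eq_mul_inv, mul_pow, mul_smul]
  -- The prefactors cancel: (π/2) · (2πi)^(-1) · 4i = 1.
  rw [e2, circleIntegral_tildeIntegrand, smul_eq_mul, smul_eq_mul]
  have h1 : (Real.pi : ℂ) ≠ 0 := by exact_mod_cast Real.pi_ne_zero
  have hI := Complex.I_ne_zero
  field_simp
  norm_num

theorem qTilde_eq (q : HPlus) (n : ℕ) : qTilde q n = coefTilde q n := by
  have h1 : HasFPowerSeriesOnBall (tildeGen q)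
      (FormalMultilinearSeries.ofScalars ℂ (fun n => (coefTilde q n : ℂ))) 0 1 := by
    refine ⟨?_, one_pos, fun {y} hy => ?_⟩
    · refine ENNReal.le_of_forall_nnreal_lt fun t ht => ?_
      refine FormalMultilinearSeries.le_radius_of_summable _ ?_
      have ht' : ‖((t : ℝ) : ℂ)‖ < 1 := by
        rw [Complex.norm_real, Real.norm_eq_abs, NNReal.abs_eq]
        exact_mod_cast ht
      refine (hasSum_tildeGen q ht').summable.norm.congr fun n => ?_
      simp
    · have hy' : ‖y‖ < 1 := by
        simpa [Metric.mem_eball, edist_zero_right, enorm_eq_nnnorm, ← NNReal.coe_lt_coe] using hy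
      rw [zero_add]
      simpa [FormalMultilinearSeries.ofScalars_apply_eq, smul_eq_mul, mul_comm] using
        hasSum_tildeGen q hy'
  have h2 := h1.factorial_smul 1 n
  rw [← iteratedDeriv_eq_iteratedFDeriv] at h2
  rw [qTilde, ← h2]
  have hf : (n ! : ℂ) ≠ 0 := by exact_mod_cast n.factorial_ne_zero
  simp [hf]

/-! ### The two parts of the theorem -/

theorem hasSum_qHat_odd (q : HPlus) (n : ℕ) :
    HasSum (fun m : ℕ => qHat q (2 * m + 1) / (2 * ((n : ℝ) - m) + 1))
      (qCheck q (2 * n + 1) - (q 0 / (4 * (2 * n + 1)) + qTilde q n)) := by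
  -- Adding back the subtracted column, with ∑ G_m = q(0)/4, gives ∑ κ(n,m) G_m. Subtracting this
  -- from ∑ κ(n,m) q̂_{2m} leaves the odd q̂.
  have h1 := (hasSum_coefG q).mul_left (hilbertKernel n 0)
  have h2 := h1.add (summable_coefTilde q n).hasSum
  have e : hilbertKernel n 0 * (q 0 / 4) = q 0 / (4 * (2 * n + 1)) := by
    rw [hilbertKernel]
    push_cast
    rw [sub_zero]
    field_simp
  rw [e, ← coefTilde, ← qTilde_eq] at h2
  refine ((hasSum_qCheck q n).sub h2).congr_fun fun m => ?_
  rw [coefG_eq, div_eq_mul_one_div, ← hilbertKernel]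
  ring

theorem qHat_odd_eq (q : HPlus) {f : ℕ → ℝ}
    (h : ∀ n, f n = PowerSeries.coeff n (numSeries (PowerSeries.mk (coefF q)))) (n : ℕ) :
    PowerSeries.coeff n (PowerSeries.mk coeffE * PowerSeries.mk f) = qHat q (2 * n + 1) := by
  have e : PowerSeries.mk f = numSeries (PowerSeries.mk (coefF q)) := by
    ext n
    rw [PowerSeries.coeff_mk, h]
  rw [e, ← oddPart_mk_coeffE_mul, qHat_eq, oddPart, PowerSeries.coeff_mk]

/-- Composition q ↦ F ↦ (f, G), followed by f ↦ f/√(1-z) and G ↦ (G(1), q̃). The factors known only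
as bounded bijections have bounded inverses by the open mapping theorem. -/
theorem exists_equiv : ∃ Φ : HPlus ≃L[ℝ] SpectralSpace × ℝ × Ell2 (3 / 4), ∀ q : HPlus,
    (∀ n : ℕ, (Φ q).1 n = qHat q (2 * n + 1)) ∧ (Φ q).2.1 = q 0 ∧
      ∀ n : ℕ, (Φ q).2.2 n = qTilde q n := by
  obtain ⟨S, hS, hS'⟩ := exists_coefF_equiv
  obtain ⟨D, hD, hD'⟩ := exists_numSeries_dirSeries_equiv
  obtain ⟨A, hA⟩ := exists_spectralSpace_equiv
  obtain ⟨B, hB, hB1, hB2⟩ := exists_hilbert_equiv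
  let eS := ContinuousLinearEquiv.ofBijective S (LinearMap.ker_eq_bot.2 hS.1)
    (LinearMap.range_eq_top.2 hS.2)
  let eD := ContinuousLinearEquiv.ofBijective D (LinearMap.ker_eq_bot.2 hD.1)
    (LinearMap.range_eq_top.2 hD.2)
  let eB := ContinuousLinearEquiv.ofBijective B (LinearMap.ker_eq_bot.2 hB.1)
    (LinearMap.range_eq_top.2 hB.2)
  -- The Hilbert bijection outputs G(1) = q(0)/4.
  let e4 : ℝ ≃L[ℝ] ℝ := ContinuousLinearEquiv.smulLeft (Units.mk0 (4 : ℝ) four_ne_zero)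
  refine ⟨(eS.trans eD).trans (A.prodCongr (eB.trans (e4.prodCongr (.refl ℝ _)))), fun q => ?_⟩
  have hg : ∀ m, (D (S q)).2 m = coefG q m := fun m => by
    rw [(hD' (S q) m).2, hS', coefG]
  refine ⟨fun n => ?_, ?_, fun n => ?_⟩
  · change (A (D (S q)).1) n = _
    rw [hA]
    refine qHat_odd_eq q (fun k => ?_) n
    rw [(hD' (S q) k).1, hS']
  · change (4 : ℝ) * (B (D (S q)).2).1 = _
    have h := hB1 (D (S q)).2
    have h' := (hasSum_coefG q).congr_fun hg
    rw [h.unique h']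
    ring
  · change (B (D (S q)).2).2 n = _
    rw [qTilde_eq, coefTilde, ← (hB2 (D (S q)).2 n).tsum_eq]
    exact tsum_congr fun m => by rw [hg]

end HalfLineOscillator

open HalfLineOscillator
theorem theorem3p7 :
    (∀ q : HPlus,
      (∀ z : ℂ, ‖z‖ < 1 → HasSum (fun n => (qTilde q n : ℂ) * z ^ n) (tildeGen q z)) ∧
      ∀ n : ℕ,
        Summable (fun m : ℕ => qHat q (2 * m + 1) / (2 * ((n : ℝ) - m) + 1)) ∧
        qCheck q (2 * n + 1) = q 0 / (4 * (2 * n + 1)) + qTilde q n +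
          ∑' m : ℕ, qHat q (2 * m + 1) / (2 * ((n : ℝ) - m) + 1)) ∧
    ∃ Φ : HPlus ≃L[ℝ] SpectralSpace × ℝ × Ell2 (3 / 4), ∀ q : HPlus,
      (∀ n : ℕ, (Φ q).1 n = qHat q (2 * n + 1)) ∧
      (Φ q).2.1 = q 0 ∧
      ∀ n : ℕ, (Φ q).2.2 n = qTilde q n := by
  refine ⟨fun q => ⟨fun z hz => ?_, fun n => ?_⟩, exists_equiv⟩
  · simp_rw [qTilde_eq]
    exact hasSum_tildeGen q hz
  · have h := hasSum_qHat_odd q n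
    refine ⟨h.summable, ?_⟩
    rw [h.tsum_eq]
    ring
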